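/- Let $n\ge 0$, let $\mathrm{Par}_n$ be the set of partitions $\lambda=(\lambda_1\ge\dots\ge\lambda_n\ge0)$, and write $\mu\subseteq\lambda$ if $\mu_i\le\lambda_i$ for all $i$, and $|\lambda/\mu|=\sum_i(\lambda_i-\mu_i)$. Put $(a;q)_m=\prod_{j=0}^{m-1}(1-aq^j)$ and $\Delta(x)=\prod_{1\le i<j\le n}(x_i-x_j)$. **Little $q$-Jacobi polynomials.** The monic little $q$-Jacobi polynomials are $$p^L_m(x;a,b;q)=\frac{(aq;q)_m}{(-1)^mq^{-\binom m2}(abq^{m+1};q)_m}\sum_{i=0}^m\frac{(q^{-m};q)_i(abq^{m+1};q)_i}{(q;q)_i(aq;q)_i}(qx)^i .$$ For $\lambda\in\mathrm{Par}_n$ the Schur polynomials and the multivariate little $q$-Jacobi polynomials (at $t=q$) are $$s_\lambda=\frac{\det\big(x_i^{\lambda_j+n-j}\big)_{i,j=1}^n}{\Delta(x)},\qquad p^L_\lambda(x_1,\dots,x_n;a,b;q)=\frac{\det\big(p^L_{\lambda_j+n-j}(x_i;a,b;q)\big)_{i,j=1}^n}{\Delta(x)} .$$ Let $$\mathfrak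 L(f)=\sum_{k\in\mathbb Z_{\ge0}^n} f(q^{k_1},\dots,q^{k_n})\,\Delta(q^{k_1},\dots,q^{k_n})^2\prod_{i=1}^n\frac{(bq;q)_{k_i}}{(q;q)_{k_i}}(aq)^{k_i}$$ (for $0<q<1$ and $a=q^\alpha$ this is, up to a constant factor, the $q$-integral of $f(x)\Delta(x)^2\prod_i x_i^\alpha\frac{(qx_i;q)_\infty}{(bqx_i;q)_\infty}$ over $[0,1]^n$). The mixed moments are $M^L_{\lambda,\mu}(n;a,b;q)=\mathfrak L(s_\lambda p^L_\mu)/\mathfrak L((p^L_\mu)^2)$, and the dual mixed moments $N^L_{\lambda,\mu}(n;a,b;q)$ are the coefficients in $p^L_\lambda=\sum_{\mu\in\mathrm{Par}_n}N^L_{\lambda,\mu}s_\mu$. **Lecture hall tableaux.** Let $\mu\subseteq\lambda$ in $\mathrm{Par}_n$, and let $c(i,j)=j-i$ be the content of a cell. For inequalities $\prec_1,\prec_2$, a lecture hall tableau of shape $\lambda/\mu$ and type $(n,\prec_1,\prec_2)$ is a filling $T$ of the cells of $\lambda/\mu$ with nonnegative integers such that $$\frac{T(i,j)}{n+c(i,j)}\prec_1\frac{T(i,j+1)}{n+c(i,j+1)},\qquad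 \frac{T(i,j)}{n+c(i,j)}\prec_2\frac{T(i+1,j)}{n+c(i+1,j)}$$ whenever the cells involved lie in $\lambda/\mu$. With $o(m)=1$ for odd $m$ and $o(m)=0$ for even $m$, put $$LS^{(n,\prec_1,\prec_2)}_{\lambda/\mu}(1,q,q^2,\dots;u,v)=\sum_T\ \prod_{s\in\lambda/\mu}q^{T(s)}\,u^{\lfloor T(s)/(n+c(s))\rfloor}\,v^{o(\lfloor T(s)/(n+c(s))\rfloor)} ,$$ the sum being over all lecture hall tableaux $T$ of shape $\lambda/\mu$ and type $(n,\prec_1,\prec_2)$. **Theorem.** Let $K$ be a complete normed field (with multiplicative norm) of characteristic $0$; for instance $K=\mathbb C$, or $K=F((q))$ with a $q$-adic absolute value, where $q$ is the indeterminate and $u,v$ are constants of a field $F$ of characteristic $0$ (the formal power series version). Let $q,u,v\in K$ with $0<|q|<1$, $v\ne0$, $|uq|<1$, and $1+uvq^j\neq0$ for all $j\ge1$. Put $a=-uv$ and $b=-u/v$. Then, for all $\lambda\in\mathrm{Par}_n$: 1. For all $\mu\subseteq\lambda$ the series $LS^{(n,<,\le)}_{\lambda/\mu}(1,q,q^2,\dots;u,v)$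 and $LS^{(n,\ge,>)}_{\lambda/\mu}(1,q,q^2,\dots;u,v)$ converge unconditionally. 2. For all $\mu\in\mathrm{Par}_n$, $N^L_{\lambda,\mu}(n;-uv,-u/v;q)=(-1)^{|\lambda/\mu|}LS^{(n,<,\le)}_{\lambda/\mu}(1,q,q^2,\dots;u,v)$ if $\mu\subseteq\lambda$, and $N^L_{\lambda,\mu}(n;-uv,-u/v;q)=0$ otherwise. 3. We have $$p^L_\lambda(x_1,\dots,x_n;-uv,-u/v;q)=\sum_{\mu\subseteq\lambda}(-1)^{|\lambda/\mu|}LS^{(n,<,\le)}_{\lambda/\mu}(1,q,q^2,\dots;u,v)\,s_\mu(x_1,\dots,x_n),$$ $$s_\lambda(x_1,\dots,x_n)=\sum_{\mu\subseteq\lambda}LS^{(n,\ge,>)}_{\lambda/\mu}(1,q,q^2,\dots;u,v)\,p^L_\mu(x_1,\dots,x_n;-uv,-u/v;q).$$ 4. Suppose in addition that $|uvq|<1$, $u\neq0$, and $v+uq^j\ne0$ for all $j\ge1$. Then the series $\mathfrak L(f)$ converges unconditionally for every polynomial $f\in K[x_1,\dots,x_n]$; $\mathfrak L(p^L_\lambda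 p^L_\mu)=0$ if and only if $\lambda\ne\mu$; and $M^L_{\lambda,\mu}(n;-uv,-u/v;q)=LS^{(n,\ge,>)}_{\lambda/\mu}(1,q,q^2,\dots;u,v)$ if $\mu\subseteq\lambda$, and $M^L_{\lambda,\mu}(n;-uv,-u/v;q)=0$ otherwise. -/

import Mathlib

open Finset

noncomputable section

/-! ### Partitions and alternants -/

/-- Partitions with at most `n` parts, `lam 0 ≥ lam 1 ≥ ⋯ ≥ lam (n-1) ≥ 0`. The inherited pointwise
order `mu ≤ lam` is containment of Young diagrams. -/
abbrev Par (n : ℕ) : Type := {lam : Fin n → ℕ // Antitone lam}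

instance (n : ℕ) (lam : Par n) : Finite {mu : Par n // mu ≤ lam} :=
  Finite.of_injective
    (fun mu : {mu : Par n // mu ≤ lam} => (⟨mu.1.1, mu.2⟩ : {f : Fin n → ℕ // f ≤ lam.1}))
    (fun _ _ h => Subtype.ext (Subtype.ext (Subtype.mk.inj h)))

instance (n : ℕ) (lam : Par n) : Fintype {mu : Par n // mu ≤ lam} := Fintype.ofFinite _

/-- `Δ(x) = ∏_{i < j} (x_i - x_j)`. -/
def vandermondeProd (K : Type*) [Field K] (n : ℕ) : MvPolynomial (Fin n) K :=
  ∏ i : Fin n, ∏ j ∈ Finset.Ioi i, (MvPolynomial.X i - MvPolynomial.X j)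

/-- `det (p_{lam_j + n - j}(x_i))_{1 ≤ i, j ≤ n}`; the indices `i, j` of the code start at `0`. -/
def alternant {K : Type*} [Field K] (p : ℕ → Polynomial K) {n : ℕ} (lam : Par n) :
    MvPolynomial (Fin n) K :=
  (Matrix.of fun i j : Fin n =>
    Polynomial.aeval (MvPolynomial.X i : MvPolynomial (Fin n) K)
      (p (lam.1 j + (n - (j.1 + 1))))).det

theorem X_sub_X_dvd_alternant {K : Type*} [Field K] (p : ℕ → Polynomial K) {n : ℕ} (lam : Par n)
    {i j : Fin n} (hij : i ≠ j) :
    (MvPolynomial.X i - MvPolynomial.X j : MvPolynomial (Fin n) K) ∣ alternant p lam := by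
  rw [← Ideal.mem_span_singleton, ← Ideal.Quotient.eq_zero_iff_mem, alternant, RingHom.map_det]
  refine Matrix.det_zero_of_row_eq hij ?_
  funext k
  have h : Ideal.Quotient.mkₐ K (Ideal.span {(MvPolynomial.X i - MvPolynomial.X j :
      MvPolynomial (Fin n) K)}) (MvPolynomial.X i) = Ideal.Quotient.mkₐ K _ (MvPolynomial.X j) :=
    Ideal.Quotient.eq.2 (Ideal.mem_span_singleton_self _)
  change Ideal.Quotient.mkₐ K _ (Polynomial.aeval _ _) = Ideal.Quotient.mkₐ K _ (Polynomial.aeval _ _)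
  rw [← Polynomial.aeval_algHom_apply, ← Polynomial.aeval_algHom_apply, h]

theorem irreducible_X_sub_X {K : Type*} [Field K] {n : ℕ} {i j : Fin n} (hij : i ≠ j) :
    Irreducible (MvPolynomial.X i - MvPolynomial.X j : MvPolynomial (Fin n) K) := by
  have h := MvPolynomial.irreducible_sumSMulX (R := K)
    (Finsupp.single i 1 - Finsupp.single j 1 : Fin n →₀ K)
    ⟨i, by simp [hij.symm]⟩ (fun r hr => by
      have := hr i
      simp only [Finsupp.coe_sub, Pi.sub_apply, Finsupp.single_eq_same,
        Finsupp.single_eq_of_ne hij, sub_zero] at this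
      exact isUnit_of_dvd_one this)
  simpa [MvPolynomial.sumSMulX, map_sub] using h

theorem vandermondeProd_dvd_alternant {K : Type*} [Field K] (p : ℕ → Polynomial K) {n : ℕ}
    (lam : Par n) : vandermondeProd K n ∣ alternant p lam := by
  rw [vandermondeProd, Finset.prod_sigma']
  refine Finset.prod_dvd_of_isRelPrime ?_ ?_
  · rintro ⟨i, j⟩ hij ⟨k, l⟩ hkl hne
    simp only [coe_sigma, Set.mem_sigma_iff, coe_univ, Set.mem_univ, coe_Ioi, Set.mem_Ioi, true_and]
      at hij hkl
    change IsRelPrime (MvPolynomial.X i - MvPolynomial.X j) (MvPolynomial.X k - MvPolynomial.X l)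
    rw [(irreducible_X_sub_X hij.ne).isRelPrime_iff_not_dvd]
    rintro ⟨r, hr⟩
    have key : ∀ m : Fin n, m ≠ i → m ≠ j → (m = k ∨ m = l) → False := by
      intro m hi hj hm
      have := congrArg (MvPolynomial.eval (fun t => if t = m then (1 : K) else 0)) hr
      simp only [map_sub, map_mul, MvPolynomial.eval_X, hi.symm, hj.symm, if_false, sub_self,
        zero_mul] at this
      rcases hm with rfl | rfl
      · simp [hkl.ne'] at this
      · simp [hkl.ne] at this
    have h1 : k = i ∨ k = j := by
      by_contra! h
      exact key k h.1 h.2 (Or.inl rfl)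
    have h2 : l = i ∨ l = j := by
      by_contra! h
      exact key l h.1 h.2 (Or.inr rfl)
    apply hne
    rcases h1 with rfl | rfl <;> rcases h2 with rfl | rfl
    · exact absurd hkl (lt_irrefl _)
    · rfl
    · exact absurd hkl (not_lt.2 hij.le)
    · exact absurd hkl (lt_irrefl _)
  · rintro ⟨i, j⟩ hij
    simp only [mem_sigma, mem_univ, mem_Ioi, true_and] at hij
    exact X_sub_X_dvd_alternant p lam hij.ne

/-- The polynomial `det (p_{lam_j + n - j}(x_i)) / Δ(x)`. -/
def altQuotient {K : Type*} [Field K] (p : ℕ → Polynomial K) {n : ℕ} (lam : Par n) :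
    MvPolynomial (Fin n) K :=
  Classical.choose (vandermondeProd_dvd_alternant p lam)

theorem vandermondeProd_mul_altQuotient {K : Type*} [Field K] (p : ℕ → Polynomial K) {n : ℕ}
    (lam : Par n) : vandermondeProd K n * altQuotient p lam = alternant p lam :=
  (Classical.choose_spec (vandermondeProd_dvd_alternant p lam)).symm

/-- The Schur polynomial `s_lam(x_1, …, x_n)`. -/
def schurPoly (K : Type*) [Field K] {n : ℕ} (lam : Par n) : MvPolynomial (Fin n) K :=
  altQuotient (fun m => (Polynomial.X : Polynomial K) ^ m) lam

/-! ### Little `q`-Jacobi polynomials -/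

/-- `(a; q)_n = (1 - a)(1 - a q) ⋯ (1 - a q^(n-1))`. -/
def qPoch {K : Type*} [Field K] (a q : K) (n : ℕ) : K :=
  ∏ j ∈ Finset.range n, (1 - a * q ^ j)

/-- The monic little `q`-Jacobi polynomial
`(aq;q)_n / ((-1)^n q^(-binom(n,2)) (abq^(n+1);q)_n) · ₂φ₁(q^(-n), abq^(n+1); aq; q, qx)`.
The basic hypergeometric series terminates, since `(q^(-n);q)_i = 0` for `i > n`. -/
def littleQJacobi {K : Type*} [Field K] (a b q : K) (n : ℕ) : Polynomial K :=
  Polynomial.C (qPoch (a * q) q n /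
      ((-1) ^ n * (q ^ n.choose 2)⁻¹ * qPoch (a * b * q ^ (n + 1)) q n)) *
    ∑ i ∈ Finset.range (n + 1),
      Polynomial.C (qPoch (q ^ n)⁻¹ q i * qPoch (a * b * q ^ (n + 1)) q i /
          (qPoch q q i * qPoch (a * q) q i)) *
        (Polynomial.C q * Polynomial.X) ^ i

/-- The multivariate little `q`-Jacobi polynomial (at `t = q`)
`p^L_lam(x_1, …, x_n; a, b; q) = det (p^L_{lam_j + n - j}(x_i; a, b; q)) / Δ(x)`. -/
def multiLittleQJacobi {K : Type*} [Field K] (a b q : K) {n : ℕ} (lam : Par n) :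
    MvPolynomial (Fin n) K :=
  altQuotient (littleQJacobi a b q) lam

/-- The term at `x = (q^(k_1), …, q^(k_n))` of the orthogonality functional:
`f(x) Δ(x)^2 ∏_i (bq;q)_{k_i} / (q;q)_{k_i} (aq)^{k_i}`. -/
def jacobiTerm {K : Type*} [Field K] (a b q : K) {n : ℕ} (f : MvPolynomial (Fin n) K)
    (k : Fin n → ℕ) : K :=
  MvPolynomial.eval (fun i => q ^ k i) f * MvPolynomial.eval (fun i => q ^ k i) (vandermondeProd K n) ^ 2 *
    ∏ i : Fin n, qPoch (b * q) q (k i) / qPoch q q (k i) * (a * q) ^ k i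

/-- The linear functional for which the multivariate little `q`-Jacobi polynomials are orthogonal.
Up to the factor `((1-q) (q;q)_∞ / (bq;q)_∞)^n`, which is independent of `f`, it is the
`q`-integral of `f(x) Δ(x)^2 ∏_i x_i^α (q x_i;q)_∞ / (b q x_i;q)_∞` over `[0,1]^n`, with `a = q^α`. -/
def jacobiFunctional {K : Type*} [NormedField K] (a b q : K) {n : ℕ}
    (f : MvPolynomial (Fin n) K) : K :=
  ∑' k : Fin n → ℕ, jacobiTerm a b q f k

/-- The mixed moment `M^L_{lam,mu}(n; a, b; q) = 𝔏(s_lam p^L_mu) / 𝔏((p^L_mu)^2)`. -/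
def mixedMoment {K : Type*} [NormedField K] (a b q : K) {n : ℕ} (lam mu : Par n) : K :=
  jacobiFunctional a b q (schurPoly K lam * multiLittleQJacobi a b q mu) /
    jacobiFunctional a b q (multiLittleQJacobi a b q mu ^ 2)

/-- The dual mixed moment `N^L_{lam,mu}(n; a, b; q)`: the coefficient of `s_mu` in the Schur
expansion of `p^L_lam`, that is, the value at `mu` of the finitely supported `c` with
`p^L_lam = ∑ c_mu s_mu` (at most one such `c` exists, as Schur polynomials are linearly
independent). -/
def dualMixedMoment {K : Type*} [Field K] (a b q : K) {n : ℕ} (lam mu : Par n) : K :=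
  Function.invFun (Finsupp.linearCombination K (schurPoly K (n := n)))
    (multiLittleQJacobi a b q lam) mu

/-! ### Lecture hall tableaux -/

/-- The cells of the skew diagram `lam / mu`; the code numbers rows and columns from `0`. -/
abbrev Cell {n : ℕ} (lam mu : Par n) : Type :=
  {s : Fin n × ℕ // mu.1 s.1 ≤ s.2 ∧ s.2 < lam.1 s.1}

instance {n : ℕ} (lam mu : Par n) : Finite (Cell lam mu) :=
  Finite.of_injective
    (fun s : Cell lam mu => (⟨s.1.1, ⟨s.1.2, s.2.2⟩⟩ : (i : Fin n) × Fin (lam.1 i)))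
    (fun s t h => by
      obtain ⟨⟨i, j⟩, hs⟩ := s
      obtain ⟨⟨i', j'⟩, ht⟩ := t
      simp only [Sigma.mk.injEq] at h
      obtain ⟨rfl, h⟩ := h
      simp only [heq_eq_eq, Fin.mk.injEq] at h
      subst h
      rfl)

instance {n : ℕ} (lam mu : Par n) : Fintype (Cell lam mu) := Fintype.ofFinite _

/-- `n + c(s)`, with `c(i,j) = j - i` the content. It is positive, as `i < n`, so the subtraction
does not truncate. -/
def shiftedContent {n : ℕ} (s : Fin n × ℕ) : ℕ := n + s.2 - s.1.1

/-- Lecture hall tableaux of shape `lam / mu` and type `(n, R₁, R₂)`: the relation `R₁` holds between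
the numbers `T(s) / (n + c(s))` at horizontally adjacent cells (left, then right), and `R₂` between
those at vertically adjacent cells (upper, then lower). -/
def LHT {n : ℕ} (R₁ R₂ : ℚ → ℚ → Prop) (lam mu : Par n) : Type :=
  {T : Cell lam mu → ℕ //
    (∀ s t : Cell lam mu, t.1.1 = s.1.1 → t.1.2 = s.1.2 + 1 →
      R₁ ((T s : ℚ) / (shiftedContent s.1 : ℚ)) ((T t : ℚ) / (shiftedContent t.1 : ℚ))) ∧
    (∀ s t : Cell lam mu, t.1.1.1 = s.1.1.1 + 1 → t.1.2 = s.1.2 →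
      R₂ ((T s : ℚ) / (shiftedContent s.1 : ℚ)) ((T t : ℚ) / (shiftedContent t.1 : ℚ)))}

/-- `wt(T) = ∏_s x_{T(s)} u^⌊T(s)/(n+c(s))⌋ v^(o(⌊T(s)/(n+c(s))⌋))`, where `o(m)` is `1` if `m` is odd
and `0` otherwise. The division is integer division. -/
def LHT.weight {K : Type*} [Field K] (x : ℕ → K) (u v : K) {n : ℕ} {R₁ R₂ : ℚ → ℚ → Prop}
    {lam mu : Par n} (T : LHT R₁ R₂ lam mu) : K :=
  ∏ s : Cell lam mu, x (T.1 s) * u ^ (T.1 s / shiftedContent s.1) *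
    v ^ ((T.1 s / shiftedContent s.1) % 2)

/-- The lecture hall Schur function `LS^{(n,R₁,R₂)}_{lam/mu}(x; u, v)`. -/
def lectureHallSchur {K : Type*} [NormedField K] (R₁ R₂ : ℚ → ℚ → Prop) (x : ℕ → K) (u v : K)
    {n : ℕ} (lam mu : Par n) : K :=
  ∑' T : LHT R₁ R₂ lam mu, T.weight x u v

/-- `|lam / mu|`. -/
def skewSize {n : ℕ} (lam mu : Par n) : ℕ := ∑ i : Fin n, (lam.1 i - mu.1 i)

end

/-! ### Positions of partitions and Cauchy–Binet -/

/-! Encode `lam` by its strictly decreasing positions `lam_i + n - i`. If `c` is the unitriangular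
matrix expanding the one-variable little q-Jacobi polynomials in monomials, Cauchy–Binet shows that
the multivariate ones expand in Schur polynomials with coefficients the minors of `c` at these
positions, and that the minors of the inverse matrix give the reverse expansion
(`altQuotient_eq_sum_parDet`). It remains to recognise both kinds of minors as lecture hall Schur
functions.

Write an entry in a cell of shifted content s as ts + r with 0 ≤ r < s, and turn it into a letter,
ordered lexicographically by (t, r, -s). For adjacent cells, comparing the fractions amounts to
comparing the letters (`letterCode_lt_letterCode_iff`), and adjacent letters are never equal because
a letter determines its content. So type (<, ≤) means strictly increasing letters along rows and
columns, and type (≥, >) strictly decreasing ones. A letter of content s and weight w acts on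
polynomials by X^s ↦ X^s + w X^(s-1). On exterior products of monomials, the w-term removes the
corner of content s, and it vanishes if there is none. Hence generating functions of such tableaux
are minors of the product of these operators (`sum_letterTableaux_eq_parDet`). Replacing w by -w
inverts an operator, so the two tableau types, with signs on one of them, belong to inverse
matrices.

The infinite product of letters, with weights -w, must then be `c`. The letters of quotient t form a
level; up to rescaling, its matrix holds the coefficients of (x-1)(x-q)⋯(x-q^(m-1))
(`letterCoeff_level`). In that basis the little q-Jacobi polynomial has, again up to rescaling, the
coefficients of the one with a and b exchanged (`jacobiCoeff_eq_sum`). So each level trades -uv for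
-u/v or back, which accounts for the parity exponent of v. After t levels an exact remainder is
left, and it tends to the identity because |uq| < 1 (`tendsto_letterCoeff`).

For mixed moments, Andréief's identity reduces orthogonality to one variable, and pairing the
expansion of a Schur polynomial with one member of the orthogonal family reads off its coefficient.
The one-variable moments and the nonvanishing of the norms come from the functional equation of the
q-binomial series. -/

/-- The strictly decreasing sequence `lam_i + n - i` attached to a partition. -/
def partPos {n : ℕ} (lam : Par n) (i : Fin n) : ℕ := lam.1 i + (n - (i.1 + 1))

theorem partPos_strictAnti {n : ℕ} (lam : Par n) : StrictAnti (partPos lam) := by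
  intro i j hij
  have h1 := lam.2 hij.le
  have h2 : i.1 < j.1 := hij
  have := j.2
  unfold partPos
  omega

theorem partPos_injective {n : ℕ} : Function.Injective (partPos (n := n)) := by
  intro lam mu h
  apply Subtype.ext
  funext i
  have := congrFun h i
  unfold partPos at this
  omega

theorem partPos_le_partPos {n : ℕ} {lam mu : Par n} {i : Fin n} :
    partPos mu i ≤ partPos lam i ↔ mu.1 i ≤ lam.1 i := by
  unfold partPos
  omega

/-- A strictly decreasing sequence of naturals drops by at least one per step, so subtracting the
staircase does not truncate and leaves a weakly decreasing sequence. -/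
theorem exists_partPos_eq {n : ℕ} {g : Fin n → ℕ} (hg : StrictAnti g) :
    ∃ lam : Par n, partPos lam = g := by
  have key : ∀ d : ℕ, ∀ i j : Fin n, i.1 + d = j.1 → g j + d ≤ g i := by
    intro d
    induction d with
    | zero =>
      intro i j h
      have : i = j := Fin.ext (by simpa using h)
      simp [this]
    | succ d ih =>
      intro i j h
      have hj := j.2
      have h1 := ih i ⟨i.1 + d, by omega⟩ rfl
      have h2 : g j < g ⟨i.1 + d, by omega⟩ := hg (Fin.lt_def.2 (by simp only; omega))
      omega
  have hlow : ∀ i : Fin n, n - (i.1 + 1) ≤ g i := by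
    intro i
    have := i.2
    have := key (n - (i.1 + 1)) i ⟨n - 1, by omega⟩ (by simp only; omega)
    omega
  refine ⟨⟨fun i => g i - (n - (i.1 + 1)), ?_⟩, ?_⟩
  · intro i j hij
    have h1 : i.1 ≤ j.1 := hij
    have := key (j.1 - i.1) i j (by omega)
    have := j.2
    simp only
    omega
  · funext i
    have := hlow i
    simp only [partPos]
    omega

theorem strictAnti_eq_of_comp_perm {n : ℕ} {f g : Fin n → ℕ} (hf : StrictAnti f)
    (hg : StrictAnti g) {σ τ : Equiv.Perm (Fin n)} (h : f ∘ σ = g ∘ τ) : f = g := by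
  have hr : Set.range (f ∘ Fin.rev) = Set.range (g ∘ Fin.rev) := by
    have h1 := congrArg Set.range h
    rw [σ.surjective.range_comp, τ.surjective.range_comp] at h1
    rw [Fin.rev_surjective.range_comp, Fin.rev_surjective.range_comp, h1]
  have h2 := (StrictMono.range_inj (hf.comp Fin.rev_strictAnti) (hg.comp Fin.rev_strictAnti)).1 hr
  funext i
  have := congrFun h2 (Fin.rev i)
  simpa using this

/-- The n-element set of positions determines the partition, and an n-element set contained in
another one equals it. -/
theorem exists_partPos_ne {n : ℕ} {lam mu : Par n} (h : lam ≠ mu) :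
    ∃ i, ∀ j, partPos lam i ≠ partPos mu j := by
  by_contra! hcon
  choose σ hσ using hcon
  have hinj : Function.Injective σ := fun a b hab =>
    (partPos_strictAnti lam).injective (by rw [hσ, hσ, hab])
  refine h (partPos_injective (strictAnti_eq_of_comp_perm (partPos_strictAnti lam)
    (partPos_strictAnti mu) (σ := 1) (τ := Equiv.ofBijective σ
      (Finite.injective_iff_bijective.1 hinj)) ?_))
  funext j
  exact hσ j

/-- Cauchy–Binet. Expand by multilinearity over all index functions; the non-injective ones give
repeated rows, and an injective one is uniquely a strictly decreasing function composed with a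
permutation, whose sign rebuilds the determinant of `A`. -/
theorem det_sum_mul_eq_sum_det_mul_det {R : Type*} [CommRing R] {n : ℕ} (M : ℕ)
    (A : Fin n → ℕ → R) (B : ℕ → Fin n → R) :
    (Matrix.of fun i j : Fin n => ∑ k ∈ range M, A i k * B k j).det =
      ∑ g ∈ (Fintype.piFinset fun _ : Fin n => range M) with StrictAnti g,
        (Matrix.of fun i j : Fin n => A i (g j)).det *
          (Matrix.of fun i j : Fin n => B (g i) j).det := by
  have h1 : (Matrix.of fun i j : Fin n => ∑ k ∈ range M, A i k * B k j).det =
      ∑ f ∈ Fintype.piFinset fun _ : Fin n => range M,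
        (∏ i, A i (f i)) * (Matrix.of fun i j : Fin n => B (f i) j).det := by
    have h2 : (Matrix.of fun i j : Fin n => ∑ k ∈ range M, A i k * B k j) =
        fun i => ∑ k ∈ range M, A i k • B k := by
      funext i j
      simp [Finset.sum_apply]
    have h3 := (Matrix.detRowAlternating (n := Fin n) (R := R)).toMultilinearMap.map_sum_finset
      (fun i k => A i k • B k) (fun _ => range M)
    refine (congrArg Matrix.det h2).trans (h3.trans (sum_congr rfl fun f _ => ?_))
    have h4 := (Matrix.detRowAlternating (n := Fin n) (R := R)).toMultilinearMap.map_smul_univ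
      (fun i => A i (f i)) (fun i => B (f i))
    exact h4
  have h5 : ∀ f : Fin n → ℕ, ¬ Function.Injective f →
      (Matrix.of fun i j : Fin n => B (f i) j).det = 0 := by
    intro f hf
    simp only [Function.Injective, not_forall] at hf
    obtain ⟨i, j, hij, hne⟩ := hf
    refine Matrix.det_zero_of_row_eq hne ?_
    funext k
    simp [hij]
  rw [h1, ← sum_filter_of_ne (p := Function.Injective) (fun f _ hf => by
    by_contra hinj
    exact hf (by rw [h5 f hinj, mul_zero]))]
  have h6 : ∀ g : Fin n → ℕ, (Matrix.of fun i j : Fin n => A i (g j)).det *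
      (Matrix.of fun i j : Fin n => B (g i) j).det =
      ∑ σ : Equiv.Perm (Fin n), (∏ i, A i ((g ∘ σ) i)) *
        (Matrix.of fun i j : Fin n => B ((g ∘ σ) i) j).det := by
    intro g
    rw [← Matrix.det_transpose (Matrix.of fun i j : Fin n => A i (g j)), Matrix.det_apply', sum_mul]
    refine sum_congr rfl fun σ _ => ?_
    have h7 := Matrix.det_permute σ (Matrix.of fun i j : Fin n => B (g i) j)
    have h8 : (Matrix.of fun i j : Fin n => B ((g ∘ σ) i) j) =
      (Matrix.of fun i j : Fin n => B (g i) j).submatrix σ id := rfl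
    rw [h8, h7]
    simp only [Matrix.transpose_apply, Matrix.of_apply, Function.comp]
    ring
  simp_rw [h6]
  rw [← sum_product']
  symm
  refine sum_bij (fun x _ => x.1 ∘ x.2) ?_ ?_ ?_ ?_
  · rintro ⟨g, σ⟩ h
    simp only [mem_product, mem_filter, Fintype.mem_piFinset, mem_univ, and_true] at h ⊢
    exact ⟨fun i => h.1 _, h.2.injective.comp σ.injective⟩
  · rintro ⟨g, σ⟩ h ⟨g', σ'⟩ h' heq
    simp only [mem_product, mem_filter, Fintype.mem_piFinset, mem_univ, and_true] at h h' heq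
    have hg := strictAnti_eq_of_comp_perm h.2 h'.2 heq
    subst hg
    refine Prod.ext rfl (Equiv.ext fun i => h.2.injective (congrFun heq i))
  · intro f h
    simp only [mem_filter, Fintype.mem_piFinset] at h
    let σ := Tuple.sort (fun i => OrderDual.toDual (f i))
    have hm : Antitone (f ∘ σ) := fun i j hij => Tuple.monotone_sort (fun i => OrderDual.toDual (f i)) hij
    have hs : StrictAnti (f ∘ σ) := hm.strictAnti_of_injective (h.2.comp σ.injective)
    refine ⟨(f ∘ σ, σ⁻¹), ?_, ?_⟩
    · simp only [mem_product, mem_filter, Fintype.mem_piFinset, mem_univ, and_true]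
      exact ⟨fun i => h.1 _, hs⟩
    · funext i
      simp
  · rintro ⟨g, σ⟩ _
    rfl

/-- The minor `det (c(lam_i + n - i, mu_j + n - j))`. -/
def parDet {R : Type*} [CommRing R] (c : ℕ → ℕ → R) {n : ℕ} (lam mu : Par n) : R :=
  (Matrix.of fun i j : Fin n => c (partPos lam i) (partPos mu j)).det

/-- The zero block has n - r rows and r + 1 columns, one too many in total: a permutation avoiding
it would inject the r + 1 columns into the r rows above. -/
theorem det_eq_zero_of_block {R : Type*} [CommRing R] {n : ℕ} (M : Matrix (Fin n) (Fin n) R)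
    (r : Fin n) (h : ∀ i j, r ≤ i → j ≤ r → M i j = 0) : M.det = 0 := by
  rw [Matrix.det_apply']
  refine sum_eq_zero fun σ _ => ?_
  have : ∃ j, j ≤ r ∧ r ≤ σ j := by
    by_contra! hcon
    have h1 : (Finset.Iic r).card ≤ (Finset.Iio r).card :=
      Finset.card_le_card_of_injOn σ (fun j hj => by simpa using hcon j (by simpa using hj))
        σ.injective.injOn
    simp at h1
  obtain ⟨j, hj, hr⟩ := this
  exact mul_eq_zero_of_right _ (prod_eq_zero (mem_univ j) (h _ _ hr hj))

theorem parDet_eq_zero {R : Type*} [CommRing R] {c : ℕ → ℕ → R} (hc : ∀ m k, m < k → c m k = 0)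
    {n : ℕ} {lam mu : Par n} (h : ¬ mu ≤ lam) : parDet c lam mu = 0 := by
  have h' : ∃ r, lam.1 r < mu.1 r := by
    by_contra! hcon
    exact h hcon
  obtain ⟨r, hr⟩ := h'
  refine det_eq_zero_of_block _ r fun i j hi hj => hc _ _ ?_
  have h1 := (partPos_strictAnti lam).antitone hi
  have h2 := (partPos_strictAnti mu).antitone hj
  have h3 : partPos lam r < partPos mu r := not_le.1 fun hle => by
    have := partPos_le_partPos.1 hle
    omega
  omega

theorem parDet_self {R : Type*} [CommRing R] {c : ℕ → ℕ → R} (hc : ∀ m k, m < k → c m k = 0)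
    (h1 : ∀ m, c m m = 1) {n : ℕ} (lam : Par n) : parDet c lam lam = 1 := by
  unfold parDet
  rw [Matrix.det_of_isUpperTriangular]
  · simp [h1]
  · intro i j hij
    exact hc _ _ (partPos_strictAnti lam hij)

/-- A linear relation between two families of polynomials gives, through minors, the relation between
the symmetric polynomials attached to them. -/
theorem altQuotient_eq_sum_parDet {K : Type*} [Field K] {c : ℕ → ℕ → K}
    (hc : ∀ m k, m < k → c m k = 0) {p r : ℕ → Polynomial K}
    (h : ∀ m, p m = ∑ k ∈ range (m + 1), Polynomial.C (c m k) * r k) {n : ℕ} (lam : Par n) :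
    altQuotient p lam =
      ∑ mu : {mu : Par n // mu ≤ lam}, MvPolynomial.C (parDet c lam mu.1) * altQuotient r mu.1 := by
  have hV : vandermondeProd K n ≠ 0 := by
    refine prod_ne_zero_iff.2 fun i _ => prod_ne_zero_iff.2 fun j hj => ?_
    exact (irreducible_X_sub_X (mem_Ioi.1 hj).ne).ne_zero
  apply mul_left_cancel₀ hV
  rw [vandermondeProd_mul_altQuotient, mul_sum]
  have h0 : ∀ mu : Par n, vandermondeProd K n * (MvPolynomial.C (parDet c lam mu) *
      altQuotient r mu) = alternant r mu * MvPolynomial.C (parDet c lam mu) := by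
    intro mu
    rw [← vandermondeProd_mul_altQuotient]
    ring
  simp_rw [h0]
  -- A common bound on the positions lets all the one-variable expansions run over the same range,
  -- as Cauchy–Binet requires; the added coefficients are zero.
  obtain ⟨M, hM⟩ : ∃ M, ∀ i, partPos lam i < M :=
    ⟨∑ i, partPos lam i + 1, fun i => Nat.lt_succ_of_le
      (single_le_sum (f := partPos lam) (fun _ _ => Nat.zero_le _) (mem_univ i))⟩
  have h1 : alternant p lam = (Matrix.of fun i j : Fin n => ∑ k ∈ range M,
      Polynomial.aeval (MvPolynomial.X i : MvPolynomial (Fin n) K) (r k) *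
        MvPolynomial.C (c (partPos lam j) k)).det := by
    unfold alternant
    congr 1
    ext1 i j
    simp only [Matrix.of_apply]
    change Polynomial.aeval _ (p (partPos lam j)) = _
    rw [h, map_sum]
    refine (sum_subset (range_subset_range.2 (hM j)) fun k _ hk => ?_).trans
      (sum_congr rfl fun k _ => ?_)
    · rw [hc _ _ (by simpa using hk)]
      simp
    · rw [map_mul, Polynomial.aeval_C, mul_comm]
      rfl
  have h2 : ∀ mu : Par n, (Matrix.of fun i j : Fin n => (MvPolynomial.C (c (partPos lam j)
      (partPos mu i)) : MvPolynomial (Fin n) K)).det = MvPolynomial.C (parDet c lam mu) := by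
    intro mu
    rw [parDet, ← Matrix.det_transpose, RingHom.map_det]
    rfl
  rw [h1, det_sum_mul_eq_sum_det_mul_det]
  symm
  refine sum_bij_ne_zero (fun mu _ _ => partPos mu.1) ?_ ?_ ?_ ?_
  · rintro ⟨mu, hmu⟩ _ _
    simp only [mem_filter, Fintype.mem_piFinset, mem_range]
    exact ⟨fun i => (partPos_le_partPos.2 (hmu i)).trans_lt (hM i), partPos_strictAnti mu⟩
  · rintro mu _ _ nu _ _ heq
    exact Subtype.ext (partPos_injective heq)
  · intro g hg hne
    simp only [mem_filter] at hg
    obtain ⟨mu, rfl⟩ := exists_partPos_eq hg.2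
    rw [h2] at hne
    have hmu : mu ≤ lam := by
      by_contra hcon
      rw [parDet_eq_zero hc hcon] at hne
      simp at hne
    refine ⟨⟨mu, hmu⟩, mem_univ _, ?_, rfl⟩
    exact hne
  · rintro ⟨mu, hmu⟩ _ _
    rw [h2]
    rfl

/-! ### Linear independence of Schur polynomials -/

/-- Positions are distinct and decreasing, so a permuted exponent vector of one partition is the
sorted one of another only for the identity permutation and equal partitions. -/
theorem coeff_alternant_X_pow {K : Type*} [Field K] {n : ℕ} (lam mu : Par n) :
    MvPolynomial.coeff (Finsupp.equivFunOnFinite.symm (partPos lam))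
      (alternant (fun m => (Polynomial.X : Polynomial K) ^ m) mu) = if mu = lam then 1 else 0 := by
  unfold alternant
  rw [← Matrix.det_transpose, Matrix.det_apply', MvPolynomial.coeff_sum]
  have h : ∀ σ : Equiv.Perm (Fin n), MvPolynomial.coeff (Finsupp.equivFunOnFinite.symm (partPos lam))
      (((Equiv.Perm.sign σ : ℤ) : MvPolynomial (Fin n) K) * ∏ i, (Matrix.of fun i j : Fin n =>
        Polynomial.aeval (MvPolynomial.X i : MvPolynomial (Fin n) K)
          ((Polynomial.X : Polynomial K) ^ (mu.1 j + (n - (j.1 + 1))))).transpose (σ i) i) =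
      if partPos mu ∘ σ = partPos lam then ((Equiv.Perm.sign σ : ℤ) : K) else 0 := by
    intro σ
    have h1 : (∏ i, (Matrix.of fun i j : Fin n =>
        Polynomial.aeval (MvPolynomial.X i : MvPolynomial (Fin n) K)
          ((Polynomial.X : Polynomial K) ^ (mu.1 j + (n - (j.1 + 1))))).transpose (σ i) i) =
        MvPolynomial.monomial (Finsupp.equivFunOnFinite.symm (partPos mu ∘ σ)) (1 : K) := by
      rw [MvPolynomial.monomial_eq, Finsupp.prod_fintype _ _ (by simp)]
      simp [partPos]
    have h2 : ((Equiv.Perm.sign σ : ℤ) : MvPolynomial (Fin n) K) =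
        MvPolynomial.C ((Equiv.Perm.sign σ : ℤ) : K) := by simp
    rw [h1, h2, MvPolynomial.coeff_C_mul, MvPolynomial.coeff_monomial]
    simp only [EmbeddingLike.apply_eq_iff_eq, mul_ite, mul_one, mul_zero]
  rw [sum_congr rfl fun σ _ => h σ]
  by_cases hml : mu = lam
  · subst hml
    rw [if_pos rfl, sum_eq_single 1]
    · simp
    · intro σ _ hσ
      rw [if_neg]
      intro heq
      exact hσ (Equiv.ext fun i => (partPos_strictAnti mu).injective (congrFun heq i))
    · simp
  · rw [if_neg hml]
    refine sum_eq_zero fun σ _ => if_neg fun heq => hml (partPos_injective ?_)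
    exact strictAnti_eq_of_comp_perm (partPos_strictAnti mu) (partPos_strictAnti lam)
      (σ := σ) (τ := 1) heq

theorem linearIndependent_schurPoly (K : Type*) [Field K] (n : ℕ) :
    LinearIndependent K (schurPoly K (n := n)) := by
  rw [linearIndependent_iff]
  intro l hl
  ext lam
  have h1 : vandermondeProd K n * Finsupp.linearCombination K (schurPoly K (n := n)) l = 0 := by
    rw [hl, mul_zero]
  rw [Finsupp.linearCombination_apply, Finsupp.sum, mul_sum] at h1
  have h2 := congrArg (MvPolynomial.coeff (Finsupp.equivFunOnFinite.symm (partPos lam))) h1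
  rw [MvPolynomial.coeff_sum] at h2
  simp only [mul_smul_comm, schurPoly, vandermondeProd_mul_altQuotient, MvPolynomial.coeff_smul,
    coeff_alternant_X_pow, smul_eq_mul, mul_ite, mul_one, mul_zero, MvPolynomial.coeff_zero] at h2
  simpa using h2

/-- Linear independence of Schur polynomials makes the preimage chosen by `Function.invFun` the only
possible one. -/
theorem dualMixedMoment_eq {K : Type*} [Field K] {a b q : K} {n : ℕ} {lam : Par n} {d : Par n → K}
    (h : multiLittleQJacobi a b q lam =
      ∑ mu : {mu : Par n // mu ≤ lam}, MvPolynomial.C (d mu.1) * schurPoly K mu.1)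
    (hd : ∀ mu, ¬ mu ≤ lam → d mu = 0) (mu : Par n) : dualMixedMoment a b q lam mu = d mu := by
  classical
  let S : Finset (Par n) :=
    (univ : Finset {mu : Par n // mu ≤ lam}).map (Function.Embedding.subtype _)
  have hS : ∀ nu, nu ∈ S ↔ nu ≤ lam := fun nu => by simp [S]
  let l : Par n →₀ K := Finsupp.onFinset S d fun nu hnu => by
    rw [hS]
    by_contra hcon
    exact hnu (hd nu hcon)
  have hl : Finsupp.linearCombination K (schurPoly K (n := n)) l = multiLittleQJacobi a b q lam := by
    rw [h, Finsupp.linearCombination_apply, Finsupp.onFinset_sum _ (by simp)]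
    rw [← sum_subtype (p := fun mu => mu ≤ lam) S hS
      (fun nu => MvPolynomial.C (d nu) * schurPoly K nu)]
    refine sum_congr rfl fun nu _ => ?_
    rw [MvPolynomial.smul_eq_C_mul]
  have hinj : Function.Injective (Finsupp.linearCombination K (schurPoly K (n := n))) :=
    linearIndependent_schurPoly K n
  unfold dualMixedMoment
  rw [← hl, Function.leftInverse_invFun hinj l]
  rfl

/-! ### One-particle operators -/

/-- The operator `X^s ↦ X^s + w X^(s-1)`, fixing the other monomials. -/
noncomputable def lowerOp {K : Type*} [Field K] (s : ℕ) (w : K) : Module.End K (Polynomial K) :=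
  1 + w • ((Polynomial.monomial (s - 1)).comp (Polynomial.lcoeff K s))

/-- The ordered product of the operators `lowerOp (c p) (w p)` for `p < L`. -/
noncomputable def letterOp {K : Type*} [Field K] (c : ℕ → ℕ) (w : ℕ → K) :
    ℕ → Module.End K (Polynomial K)
  | 0 => 1
  | L + 1 => letterOp c w L * lowerOp (c L) (w L)

/-- The matrix of `letterOp` in the monomial basis. -/
noncomputable def letterCoeff {K : Type*} [Field K] (c : ℕ → ℕ) (w : ℕ → K) (L m k : ℕ) : K :=
  (letterOp c w L (Polynomial.X ^ m)).coeff k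

section LetterOp

variable {K : Type*} [Field K]

theorem lowerOp_X_pow (s : ℕ) (w : K) (m : ℕ) :
    lowerOp s w (Polynomial.X ^ m) =
      Polynomial.X ^ m + if m = s then w • (Polynomial.X : Polynomial K) ^ (m - 1) else 0 := by
  unfold lowerOp
  by_cases h : m = s
  · subst h
    simp [Polynomial.lcoeff_apply, Polynomial.X_pow_eq_monomial]
  · simp [Polynomial.lcoeff_apply, Polynomial.coeff_X_pow, h, Ne.symm h]

/-- The part X^s ↦ X^(s-1) squares to zero. This needs 1 ≤ s: at s = 0 the truncated s - 1 would
again be s. -/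
theorem lowerOp_mul_lowerOp_neg {s : ℕ} (hs : 1 ≤ s) (w : K) :
    lowerOp s w * lowerOp s (-w) = 1 := by
  have h : ((Polynomial.monomial (s - 1)).comp (Polynomial.lcoeff K s) : Module.End K _) *
      ((Polynomial.monomial (s - 1)).comp (Polynomial.lcoeff K s)) = 0 := by
    refine LinearMap.ext fun p => ?_
    have : s - 1 ≠ s := by omega
    simp [Polynomial.lcoeff_apply, Polynomial.coeff_monomial, this]
  unfold lowerOp
  rw [add_mul, mul_add, mul_add, smul_mul_smul_comm, h]
  simp

theorem letterCoeff_zero (c : ℕ → ℕ) (w : ℕ → K) (m k : ℕ) :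
    letterCoeff c w 0 m k = if m = k then 1 else 0 := by
  simp [letterCoeff, letterOp, Polynomial.coeff_X_pow, eq_comm]

/-- The last factor acts first. Thus `letterCoeff c w L m k` counts strictly increasing fillings of
a row of cells with shifted contents k + 1, …, m, built from the right end. -/
theorem letterCoeff_succ (c : ℕ → ℕ) (w : ℕ → K) (L m k : ℕ) :
    letterCoeff c w (L + 1) m k =
      letterCoeff c w L m k + if m = c L then w L * letterCoeff c w L (m - 1) k else 0 := by
  unfold letterCoeff
  rw [letterOp, Module.End.mul_apply, lowerOp_X_pow, map_add, Polynomial.coeff_add]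
  split_ifs <;> simp

theorem letterCoeff_eq_zero (c : ℕ → ℕ) (w : ℕ → K) (L : ℕ) :
    ∀ m k, m < k → letterCoeff c w L m k = 0 := by
  induction L with
  | zero =>
    intro m k h
    rw [letterCoeff_zero, if_neg h.ne]
  | succ L ih =>
    intro m k h
    rw [letterCoeff_succ, ih m k h, ih (m - 1) k (by omega)]
    simp

theorem letterCoeff_self {c : ℕ → ℕ} (hc : ∀ p, 1 ≤ c p) (w : ℕ → K) (L m : ℕ) :
    letterCoeff c w L m m = 1 := by
  induction L with
  | zero => rw [letterCoeff_zero, if_pos rfl]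
  | succ L ih =>
    rw [letterCoeff_succ, ih]
    split_ifs with h
    · rw [letterCoeff_eq_zero _ _ _ _ _ (by have := hc L; omega)]
      simp
    · simp

theorem letterOp_X_pow (c : ℕ → ℕ) (w : ℕ → K) (L m : ℕ) :
    letterOp c w L (Polynomial.X ^ m) =
      ∑ j ∈ range (m + 1), letterCoeff c w L m j • (Polynomial.X : Polynomial K) ^ j := by
  ext k
  rw [Polynomial.finsetSum_coeff]
  simp only [Polynomial.coeff_smul, Polynomial.coeff_X_pow, smul_eq_mul, mul_ite, mul_one, mul_zero,
    sum_ite_eq, mem_range]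
  split_ifs with h
  · rfl
  · exact letterCoeff_eq_zero _ _ _ _ _ (by omega)

theorem letterOp_succ_eq_lowerOp_mul (c : ℕ → ℕ) (w : ℕ → K) (L : ℕ) :
    letterOp c w (L + 1) =
      lowerOp (c 0) (w 0) * letterOp (fun p => c (p + 1)) (fun p => w (p + 1)) L := by
  induction L with
  | zero => simp [letterOp]
  | succ L ih => rw [letterOp, ih, letterOp, mul_assoc]

/-- The product of inverse factors in opposite order telescopes from the middle. This is why the two
tableau types give inverse matrices. -/
theorem letterOp_reverse_mul {c : ℕ → ℕ} (hc : ∀ p, 1 ≤ c p) (w : ℕ → K) (L : ℕ) :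
    letterOp (fun p => c (L - 1 - p)) (fun p => w (L - 1 - p)) L * letterOp c (fun p => -w p) L =
      1 := by
  induction L with
  | zero => simp [letterOp]
  | succ L ih =>
    rw [letterOp_succ_eq_lowerOp_mul, letterOp]
    have h1 : ∀ p, L + 1 - 1 - (p + 1) = L - 1 - p := fun p => by omega
    simp only [h1]
    simp only [Nat.add_sub_cancel, Nat.sub_zero]
    rw [mul_assoc, ← mul_assoc (letterOp _ _ L) (letterOp _ _ L), ih, one_mul,
      lowerOp_mul_lowerOp_neg (hc L)]

theorem sum_letterCoeff_mul_reverse {c : ℕ → ℕ} (hc : ∀ p, 1 ≤ c p) (w : ℕ → K) (L m k : ℕ) :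
    ∑ j ∈ range (m + 1), letterCoeff c (fun p => -w p) L m j *
      letterCoeff (fun p => c (L - 1 - p)) (fun p => w (L - 1 - p)) L j k =
      if m = k then 1 else 0 := by
  have h := congrArg (fun f : Module.End K (Polynomial K) => (f (Polynomial.X ^ m)).coeff k)
    (letterOp_reverse_mul hc w L)
  simp only [Module.End.mul_apply, Module.End.one_apply] at h
  rw [letterOp_X_pow, map_sum, Polynomial.finsetSum_coeff] at h
  simp only [map_smul, Polynomial.coeff_smul, smul_eq_mul, Polynomial.coeff_X_pow] at h
  simp only [eq_comm (a := m)]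
  exact h

end LetterOp

/-! ### Tableaux with ordered letters -/

theorem partPos_eq_shiftedContent {n : ℕ} (lam : Par n) (i : Fin n) {j : ℕ} (h : lam.1 i = j + 1) :
    shiftedContent (i, j) = partPos lam i := by
  have := i.2
  simp only [shiftedContent, partPos]
  omega

theorem shiftedContent_pos {n : ℕ} (s : Fin n × ℕ) : 1 ≤ shiftedContent s := by
  have := s.1.2
  simp only [shiftedContent]
  omega

/-- Fillings of `lam / mu` with letters `p < L` such that the letter `p` is only used in cells of
shifted content `c p`, and with `r` between horizontally and vertically adjacent letters. -/
noncomputable def letterTableaux (r : ℕ → ℕ → Prop) (c : ℕ → ℕ) (L : ℕ) {n : ℕ} (lam mu : Par n) :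
    Finset (Cell lam mu → ℕ) := by
  classical
  exact {G ∈ Fintype.piFinset fun _ : Cell lam mu => range L |
    (∀ s, c (G s) = shiftedContent s.1) ∧
    (∀ s t : Cell lam mu, t.1.1 = s.1.1 → t.1.2 = s.1.2 + 1 → r (G s) (G t)) ∧
    (∀ s t : Cell lam mu, t.1.1.1 = s.1.1.1 + 1 → t.1.2 = s.1.2 → r (G s) (G t))}

theorem mem_letterTableaux {r : ℕ → ℕ → Prop} {c : ℕ → ℕ} {L : ℕ} {n : ℕ} {lam mu : Par n}
    {G : Cell lam mu → ℕ} : G ∈ letterTableaux r c L lam mu ↔ (∀ s, G s < L) ∧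
      (∀ s, c (G s) = shiftedContent s.1) ∧
      (∀ s t : Cell lam mu, t.1.1 = s.1.1 → t.1.2 = s.1.2 + 1 → r (G s) (G t)) ∧
      (∀ s t : Cell lam mu, t.1.1.1 = s.1.1.1 + 1 → t.1.2 = s.1.2 → r (G s) (G t)) := by
  simp [letterTableaux]

theorem sum_letterTableaux_reverse {K : Type*} [Field K] (c : ℕ → ℕ) (w : ℕ → K) (L : ℕ) {n : ℕ}
    (lam mu : Par n) :
    ∑ G ∈ letterTableaux (· > ·) c L lam mu, ∏ s, w (G s) =
      ∑ G ∈ letterTableaux (· < ·) (fun p => c (L - 1 - p)) L lam mu, ∏ s, w (L - 1 - G s) := by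
  refine sum_bij' (fun G _ s => L - 1 - G s) (fun G _ s => L - 1 - G s) ?_ ?_ ?_ ?_ ?_
  · intro G hG
    rw [mem_letterTableaux] at hG ⊢
    obtain ⟨h1, h2, h3, h4⟩ := hG
    refine ⟨fun s => by have := h1 s; omega, fun s => ?_, fun s t hs ht => ?_, fun s t hs ht => ?_⟩
    · have := h1 s
      rw [← h2 s]
      congr 1
      omega
    · have := h3 s t hs ht
      have := h1 s
      omega
    · have := h4 s t hs ht
      have := h1 s
      omega
  · intro G hG
    rw [mem_letterTableaux] at hG ⊢
    obtain ⟨h1, h2, h3, h4⟩ := hG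
    refine ⟨fun s => by have := h1 s; omega, fun s => h2 s, fun s t hs ht => ?_, fun s t hs ht => ?_⟩
    · have := h3 s t hs ht
      have := h1 t
      omega
    · have := h4 s t hs ht
      have := h1 t
      omega
  · intro G hG
    rw [mem_letterTableaux] at hG
    funext s
    have := hG.1 s
    change L - 1 - (L - 1 - G s) = G s
    omega
  · intro G hG
    rw [mem_letterTableaux] at hG
    funext s
    have := hG.1 s
    change L - 1 - (L - 1 - G s) = G s
    omega
  · intro G hG
    rw [mem_letterTableaux] at hG
    refine prod_congr rfl fun s _ => ?_
    have := hG.1 s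
    congr 1
    simp only
    omega

/-! ### Removing a corner cell from a skew shape. -/

section RemoveCorner

variable {n : ℕ} {lam nu mu : Par n} {i : Fin n}

/-- `nu` is obtained from `lam` by removing the last cell of row `i`. -/
def IsRemoveCorner (lam nu : Par n) (i : Fin n) : Prop :=
  lam.1 i = nu.1 i + 1 ∧ ∀ j, j ≠ i → lam.1 j = nu.1 j

theorem IsRemoveCorner.le (h : IsRemoveCorner lam nu i) : nu ≤ lam := by
  intro j
  by_cases hj : j = i
  · subst hj
    have := h.1
    change nu.1 j ≤ lam.1 j
    omega
  · exact (h.2 j hj).ge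

/-- The removed cell. -/
def IsRemoveCorner.corner (h : IsRemoveCorner lam nu i) (hmu : mu ≤ nu) : Cell lam mu :=
  ⟨(i, nu.1 i), hmu i, by simp [h.1]⟩

/-- The remaining cells. -/
def IsRemoveCorner.incl (h : IsRemoveCorner lam nu i) (s : Cell nu mu) : Cell lam mu :=
  ⟨s.1, s.2.1, s.2.2.trans_le (h.le _)⟩

theorem IsRemoveCorner.eq_corner_or (h : IsRemoveCorner lam nu i) (hmu : mu ≤ nu)
    (s : Cell lam mu) : s = h.corner hmu ∨ s.1.2 < nu.1 s.1.1 := by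
  obtain ⟨⟨j, k⟩, hs1, hs2⟩ := s
  simp only at hs1 hs2 ⊢
  by_cases hj : j = i
  · subst hj
    rw [h.1] at hs2
    rcases Nat.lt_succ_iff_lt_or_eq.1 hs2 with h1 | h1
    · exact Or.inr h1
    · exact Or.inl (Subtype.ext (Prod.ext rfl h1))
  · right
    rwa [← h.2 j hj]

theorem IsRemoveCorner.incl_ne_corner (h : IsRemoveCorner lam nu i) (hmu : mu ≤ nu)
    (s : Cell nu mu) : h.incl s ≠ h.corner hmu := by
  intro heq
  have h1 : s.1 = (i, nu.1 i) := congrArg Subtype.val heq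
  have h2 := s.2.2
  rw [h1] at h2
  simp at h2

theorem IsRemoveCorner.prod_cell {M : Type*} [CommMonoid M] (h : IsRemoveCorner lam nu i)
    (hmu : mu ≤ nu) (f : Cell lam mu → M) :
    ∏ s, f s = f (h.corner hmu) * ∏ s : Cell nu mu, f (h.incl s) := by
  classical
  rw [Fintype.prod_eq_mul_prod_compl (h.corner hmu)]
  congr 1
  symm
  refine prod_bij (fun s _ => h.incl s) ?_ ?_ ?_ ?_
  · intro s _
    simpa using h.incl_ne_corner hmu s
  · intro s _ t _ hst
    exact Subtype.ext (congrArg (fun x : Cell lam mu => x.1) hst)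
  · intro s hs
    rcases h.eq_corner_or hmu s with h1 | h1
    · simp [h1] at hs
    · exact ⟨⟨s.1, s.2.1, h1⟩, mem_univ _, rfl⟩
  · intro s _
    rfl

/-- Extend a filling by the letter `L` in the removed cell. -/
def extendFilling (L : ℕ) (G : Cell nu mu → ℕ) (s : Cell lam mu) : ℕ :=
  if hs : s.1.2 < nu.1 s.1.1 then G ⟨s.1, s.2.1, hs⟩ else L

theorem IsRemoveCorner.extendFilling_corner (h : IsRemoveCorner lam nu i) (hmu : mu ≤ nu) (L : ℕ)
    (G : Cell nu mu → ℕ) : extendFilling L G (h.corner hmu) = L := by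
  simp [extendFilling, IsRemoveCorner.corner]

theorem IsRemoveCorner.extendFilling_incl (h : IsRemoveCorner lam nu i) (L : ℕ)
    (G : Cell nu mu → ℕ) (s : Cell nu mu) : extendFilling L G (h.incl s) = G s := by
  have hs : s.1.2 < nu.1 s.1.1 := s.2.2
  simp [extendFilling, IsRemoveCorner.incl, hs]

theorem IsRemoveCorner.corner_not_left (h : IsRemoveCorner lam nu i) (hmu : mu ≤ nu)
    (t : Cell lam mu) : ¬ (t.1.1 = (h.corner hmu).1.1 ∧ t.1.2 = (h.corner hmu).1.2 + 1) := by
  rintro ⟨h1, h2⟩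
  have h3 := t.2.2
  simp only [IsRemoveCorner.corner] at h1 h2
  rw [h1, h2, h.1] at h3
  exact lt_irrefl _ h3

theorem IsRemoveCorner.corner_not_above (h : IsRemoveCorner lam nu i) (hmu : mu ≤ nu)
    (t : Cell lam mu) :
    ¬ (t.1.1.1 = (h.corner hmu).1.1.1 + 1 ∧ t.1.2 = (h.corner hmu).1.2) := by
  rintro ⟨h1, h2⟩
  have h3 := t.2.2
  simp only [IsRemoveCorner.corner] at h1 h2
  have h4 : t.1.1 ≠ i := fun h => by
    have := congrArg Fin.val h
    omega
  rw [h.2 _ h4, h2] at h3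
  have h5 : i ≤ t.1.1 := Fin.le_def.2 (by omega)
  exact absurd (nu.2 h5) (not_le.2 h3)

theorem IsRemoveCorner.shiftedContent_corner (h : IsRemoveCorner lam nu i) (hmu : mu ≤ nu) :
    shiftedContent (h.corner hmu).1 = partPos lam i :=
  partPos_eq_shiftedContent lam i h.1

/-- Split by whether the corner carries the letter `L`. If not, uniqueness excludes `L` altogether;
if so, deleting the corner leaves a filling of `nu` with smaller letters. -/
theorem sum_letterTableaux_succ_of_corner {K : Type*} [Field K] {c : ℕ → ℕ} (w : ℕ → K) {L : ℕ}
    (h : IsRemoveCorner lam nu i) (hmu : mu ≤ nu) (hL : partPos lam i = c L)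
    (huniq : ∀ s : Cell lam mu, shiftedContent s.1 = c L → ∀ G ∈ letterTableaux (· < ·) c (L + 1)
      lam mu, G s = L → s = h.corner hmu) :
    ∑ G ∈ letterTableaux (· < ·) c (L + 1) lam mu, ∏ s, w (G s) =
      ∑ G ∈ letterTableaux (· < ·) c L lam mu, ∏ s, w (G s) +
        w L * ∑ G ∈ letterTableaux (· < ·) c L nu mu, ∏ s, w (G s) := by
  classical
  rw [← sum_filter_add_sum_filter_not _ (fun G => G (h.corner hmu) ≠ L)]
  congr 1
  · refine sum_congr ?_ fun _ _ => rfl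
    ext G
    rw [mem_filter, mem_letterTableaux, mem_letterTableaux]
    constructor
    · rintro ⟨⟨h1, h2, h3⟩, hne⟩
      refine ⟨fun s => ?_, h2, h3⟩
      refine lt_of_le_of_ne (Nat.lt_succ_iff.1 (h1 s)) fun heq => hne ?_
      rw [← huniq s (by rw [← h2, heq]) G (mem_letterTableaux.2 ⟨h1, h2, h3⟩) heq]
      exact heq
    · rintro ⟨h1, h2, h3⟩
      exact ⟨⟨fun s => (h1 s).trans (Nat.lt_succ_self L), h2, h3⟩, (h1 _).ne⟩
  · rw [mul_sum]
    refine sum_bij' (fun G _ s => G (h.incl s)) (fun G _ => extendFilling L G) ?_ ?_ ?_ ?_ ?_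
    · intro G hG
      rw [mem_filter, not_not] at hG
      have hmem := hG.1
      rw [mem_letterTableaux] at hmem ⊢
      obtain ⟨h1, h2, h3, h4⟩ := hmem
      refine ⟨fun s => ?_, fun s => h2 _, fun s t => h3 (h.incl s) (h.incl t),
        fun s t => h4 (h.incl s) (h.incl t)⟩
      refine lt_of_le_of_ne (Nat.lt_succ_iff.1 (h1 _)) fun heq => h.incl_ne_corner hmu s ?_
      exact huniq _ (by rw [← h2, heq]) G hG.1 heq
    · intro G hG
      rw [mem_filter, not_not, mem_letterTableaux]
      rw [mem_letterTableaux] at hG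
      obtain ⟨h1, h2, h3, h4⟩ := hG
      have hcell : ∀ s : Cell lam mu, s = h.corner hmu ∨ ∃ t : Cell nu mu, s = h.incl t := by
        intro s
        exact (h.eq_corner_or hmu s).imp_right fun h5 => ⟨⟨s.1, s.2.1, h5⟩, rfl⟩
      -- The corner has no right or lower neighbour and its letter exceeds all others, so the
      -- extended filling remains strictly increasing.
      have hlt : ∀ s t : Cell lam mu, s ≠ h.corner hmu →
          (∀ s' t' : Cell nu mu, s = h.incl s' → t = h.incl t' → G s' < G t') →
          extendFilling L G s < extendFilling L G t := by
        intro s t hs hst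
        obtain ⟨s', rfl⟩ := (hcell s).resolve_left hs
        rcases hcell t with rfl | ⟨t', rfl⟩
        · rw [h.extendFilling_incl, h.extendFilling_corner]
          exact h1 _
        · rw [h.extendFilling_incl, h.extendFilling_incl]
          exact hst _ _ rfl rfl
      refine ⟨⟨fun s => ?_, fun s => ?_, fun s t hs ht => ?_, fun s t hs ht => ?_⟩,
        h.extendFilling_corner hmu L G⟩
      · rcases hcell s with rfl | ⟨t, rfl⟩
        · rw [h.extendFilling_corner]
          exact Nat.lt_succ_self L
        · rw [h.extendFilling_incl]
          exact (h1 t).trans (Nat.lt_succ_self L)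
      · rcases hcell s with rfl | ⟨t, rfl⟩
        · rw [h.extendFilling_corner, h.shiftedContent_corner, hL]
        · rw [h.extendFilling_incl, h2]
          rfl
      · refine hlt s t (fun heq => h.corner_not_left hmu t ⟨by rw [← heq, hs], by rw [← heq, ht]⟩) ?_
        rintro s' t' rfl rfl
        exact h3 s' t' hs ht
      · refine hlt s t (fun heq => h.corner_not_above hmu t ⟨by rw [← heq, hs], by rw [← heq, ht]⟩) ?_
        rintro s' t' rfl rfl
        exact h4 s' t' hs ht
    · intro G hG
      rw [mem_filter, not_not] at hG
      funext s
      rcases h.eq_corner_or hmu s with rfl | h5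
      · rw [h.extendFilling_corner, hG.2]
      · exact h.extendFilling_incl L _ ⟨s.1, s.2.1, h5⟩
    · intro G _
      funext s
      exact h.extendFilling_incl L G s
    · intro G hG
      rw [mem_filter, not_not] at hG
      rw [h.prod_cell hmu, hG.2]

end RemoveCorner

/-- A cell to the right would need a letter above the largest one. -/
theorem letterTableaux_corner_of_eq {c : ℕ → ℕ} {L : ℕ} {n : ℕ} {lam mu : Par n}
    {G : Cell lam mu → ℕ} (hG : G ∈ letterTableaux (· < ·) c (L + 1) lam mu) {s : Cell lam mu}
    (hs : G s = L) : lam.1 s.1.1 = s.1.2 + 1 := by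
  rw [mem_letterTableaux] at hG
  obtain ⟨h1, -, h3, -⟩ := hG
  by_contra hne
  have h5 := s.2.2
  have h6 := s.2.1
  have h7 := h3 s ⟨(s.1.1, s.1.2 + 1), by simp only; omega, by simp only; omega⟩ rfl rfl
  have h8 := h1 ⟨(s.1.1, s.1.2 + 1), by simp only; omega, by simp only; omega⟩
  omega

theorem letterTableaux_subset_succ {c : ℕ → ℕ} {L : ℕ} {n : ℕ} {lam mu : Par n}
    (h : ∀ G ∈ letterTableaux (· < ·) c (L + 1) lam mu, ∀ s, G s ≠ L) :
    letterTableaux (· < ·) c (L + 1) lam mu = letterTableaux (· < ·) c L lam mu := by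
  ext G
  constructor
  · intro hG
    have hne := h G hG
    rw [mem_letterTableaux] at hG ⊢
    exact ⟨fun s => lt_of_le_of_ne (Nat.lt_succ_iff.1 (hG.1 s)) (hne s), hG.2⟩
  · intro hG
    rw [mem_letterTableaux] at hG ⊢
    exact ⟨fun s => (hG.1 s).trans (Nat.lt_succ_self L), hG.2⟩

theorem parDet_letterCoeff_succ_of_ne {K : Type*} [Field K] {c : ℕ → ℕ} {w : ℕ → K} {L : ℕ} {n : ℕ}
    {lam mu : Par n} (h : ∀ i, partPos lam i ≠ c L) :
    parDet (letterCoeff c w (L + 1)) lam mu = parDet (letterCoeff c w L) lam mu := by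
  unfold parDet
  congr 1
  ext i j
  simp [letterCoeff_succ, h i]

/-- Positions are distinct, so the new letter alters row `i` only, and the determinant is linear in
that row. -/
theorem parDet_letterCoeff_succ {K : Type*} [Field K] {c : ℕ → ℕ} {w : ℕ → K} {L : ℕ} {n : ℕ}
    {lam mu : Par n} {i : Fin n} (h : partPos lam i = c L) :
    parDet (letterCoeff c w (L + 1)) lam mu = parDet (letterCoeff c w L) lam mu +
      w L * ((Matrix.of fun i j : Fin n => letterCoeff c w L (partPos lam i)
        (partPos mu j)).updateRow i
        fun j => letterCoeff c w L (partPos lam i - 1) (partPos mu j)).det := by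
  unfold parDet
  set M := Matrix.of fun i j : Fin n => letterCoeff c w L (partPos lam i) (partPos mu j) with hM
  have h1 : (Matrix.of fun i j : Fin n => letterCoeff c w (L + 1) (partPos lam i) (partPos mu j)) =
      M.updateRow i (M i + w L • fun j => letterCoeff c w L (partPos lam i - 1) (partPos mu j)) := by
    ext k j
    by_cases hk : k = i
    · subst hk
      simp [hM, letterCoeff_succ, h]
    · have : partPos lam k ≠ c L := fun heq =>
        hk ((partPos_strictAnti lam).injective (heq.trans h.symm))
      simp [hM, letterCoeff_succ, this, hk]
  rw [h1, Matrix.det_updateRow_add, Matrix.det_updateRow_smul, Matrix.updateRow_eq_self]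

theorem exists_isRemoveCorner {n : ℕ} {lam : Par n} {i : Fin n} (h0 : 1 ≤ lam.1 i)
    (h : ∀ j, i < j → lam.1 j < lam.1 i) : ∃ nu, IsRemoveCorner lam nu i := by
  refine ⟨⟨fun j => if j = i then lam.1 i - 1 else lam.1 j, ?_⟩, ?_, ?_⟩
  · intro j k hjk
    have h1 := lam.2 hjk
    simp only
    split_ifs with h2 h3 h3
    · exact le_rfl
    · subst h2
      omega
    · subst h3
      have := h k (lt_of_le_of_ne hjk (Ne.symm h2))
      omega
    · exact h1
  · simp only [if_true]
    omega
  · intro j hj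
    simp only [if_neg hj]

/-- The generating function of tableaux with ordered letters is a minor of the one-particle
matrix. -/
theorem sum_letterTableaux_eq_parDet {K : Type*} [Field K] {c : ℕ → ℕ} (hc : ∀ p, 1 ≤ c p)
    (w : ℕ → K) (L : ℕ) {n : ℕ} (mu : Par n) : ∀ lam : Par n, mu ≤ lam →
    ∑ G ∈ letterTableaux (· < ·) c L lam mu, ∏ s, w (G s) = parDet (letterCoeff c w L) lam mu := by
  induction L with
  | zero =>
    intro lam hle
    by_cases h : mu = lam
    · subst h
      rw [parDet_self (letterCoeff_eq_zero c w 0) (letterCoeff_self hc w 0)]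
      have hE : IsEmpty (Cell mu mu) := ⟨fun s => by have := s.2; omega⟩
      have h1 : letterTableaux (· < ·) c 0 mu mu = {isEmptyElim} := by
        ext G
        rw [mem_letterTableaux, mem_singleton]
        simp only [IsEmpty.forall_iff, and_self, true_iff]
        exact Subsingleton.elim _ _
      rw [h1, sum_singleton]
      exact Fintype.prod_empty _
    · have h2 : ∃ i, mu.1 i < lam.1 i := by
        by_contra! hcon
        exact h (le_antisymm hle hcon)
      obtain ⟨i, hi⟩ := h2
      have h1 : letterTableaux (· < ·) c 0 lam mu = ∅ := by
        ext G
        rw [mem_letterTableaux]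
        simp only [notMem_empty, iff_false]
        intro hG
        exact absurd (hG.1 ⟨(i, mu.1 i), le_rfl, hi⟩) (Nat.not_lt_zero _)
      rw [h1, sum_empty]
      unfold parDet
      obtain ⟨k, hk⟩ := exists_partPos_ne (Ne.symm h)
      rw [Matrix.det_eq_zero_of_row_eq_zero k]
      intro j
      simp [letterCoeff_zero, hk j]
  | succ L ih =>
    intro lam hle
    have hsc : ∀ G ∈ letterTableaux (· < ·) c (L + 1) lam mu, ∀ s, G s = L →
        partPos lam s.1.1 = c L := by
      intro G hG s hs
      have h1 := letterTableaux_corner_of_eq hG hs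
      rw [mem_letterTableaux] at hG
      rw [← partPos_eq_shiftedContent lam _ h1, ← hs, hG.2.1]
    by_cases hi : ∃ i, partPos lam i = c L
    swap
    · push Not at hi
      rw [parDet_letterCoeff_succ_of_ne hi, ← ih lam hle, letterTableaux_subset_succ]
      intro G hG s hs
      exact hi _ (hsc G hG s hs)
    · obtain ⟨i, hi⟩ := hi
      have hrow : ∀ G ∈ letterTableaux (· < ·) c (L + 1) lam mu, ∀ s, G s = L →
          s.1 = (i, lam.1 i - 1) ∧ mu.1 i ≤ lam.1 i - 1 := by
        intro G hG s hs
        have h1 : s.1.1 = i := (partPos_strictAnti lam).injective ((hsc G hG s hs).trans hi.symm)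
        have h2 := letterTableaux_corner_of_eq hG hs
        rw [h1] at h2
        have h3 := s.2.1
        rw [h1] at h3
        exact ⟨Prod.ext h1 (by simp only; omega), by omega⟩
      rw [parDet_letterCoeff_succ hi, ← ih lam hle]
      by_cases hnu : ∃ nu, IsRemoveCorner lam nu i
      · obtain ⟨nu, hnu⟩ := hnu
        have hdet : ((Matrix.of fun i j : Fin n => letterCoeff c w L (partPos lam i)
            (partPos mu j)).updateRow i
            fun j => letterCoeff c w L (partPos lam i - 1) (partPos mu j)).det =
            parDet (letterCoeff c w L) nu mu := by
          unfold parDet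
          congr 1
          ext k j
          by_cases hk : k = i
          · subst hk
            have : partPos lam k - 1 = partPos nu k := by
              unfold partPos
              have := hnu.1
              omega
            simp [this]
          · have : partPos lam k = partPos nu k := by
              unfold partPos
              rw [hnu.2 k hk]
            simp [hk, this]
        rw [hdet]
        -- If the corner lies in `mu`, it is not a cell of the skew shape: no filling uses the new
        -- letter, and the minor for `nu` is zero as well.
        by_cases hmu : mu ≤ nu
        · rw [sum_letterTableaux_succ_of_corner w hnu hmu hi, ih nu hmu]
          intro s _ G hG hs
          refine Subtype.ext ((hrow G hG s hs).1.trans ?_)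
          simp [IsRemoveCorner.corner, hnu.1]
        · rw [parDet_eq_zero (letterCoeff_eq_zero c w L) hmu, mul_zero, add_zero,
            letterTableaux_subset_succ]
          intro G hG s hs
          refine hmu fun j => ?_
          by_cases hj : j = i
          · subst hj
            have h1 := (hrow G hG s hs).2
            have h2 := hnu.1
            change mu.1 j ≤ nu.1 j
            omega
          · exact (hle j).trans (hnu.2 j hj).le
      -- With no corner to remove, the next row already occupies the lowered position, so the
      -- determinant has two equal rows.
      · have hnext : ∃ k : Fin n, k ≠ i ∧ partPos lam k = partPos lam i - 1 := by
          have h1 : ∃ k : Fin n, k.1 = i.1 + 1 ∧ lam.1 k = lam.1 i := by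
            by_contra! hcon
            refine hnu (exists_isRemoveCorner ?_ ?_)
            -- An empty row is no exception: its position is `c L` ≥ 1, so there is a row below it,
            -- which is empty too.
            · have h2 := hc L
              rw [← hi] at h2
              unfold partPos at h2
              by_contra h3
              have h4 : i.1 + 1 < n := by omega
              have h5 := hcon ⟨i.1 + 1, h4⟩ rfl
              have h6 := lam.2 (show i ≤ ⟨i.1 + 1, h4⟩ from Fin.le_def.2 (Nat.le_succ _))
              omega
            · intro j hj
              have hj' : i.1 < j.1 := hj
              have h4 : i.1 + 1 < n := by have := j.2; omega
              have h5 := hcon ⟨i.1 + 1, h4⟩ rfl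
              have h6 := lam.2 (show i ≤ ⟨i.1 + 1, h4⟩ from Fin.le_def.2 (Nat.le_succ _))
              have h7 := lam.2 (show (⟨i.1 + 1, h4⟩ : Fin n) ≤ j from Fin.le_def.2 hj')
              omega
          obtain ⟨k, hk1, hk2⟩ := h1
          refine ⟨k, fun h => by rw [h] at hk1; omega, ?_⟩
          unfold partPos
          have := k.2
          omega
        obtain ⟨k, hki, hk⟩ := hnext
        have hdet : ((Matrix.of fun i j : Fin n => letterCoeff c w L (partPos lam i)
            (partPos mu j)).updateRow i
            fun j => letterCoeff c w L (partPos lam i - 1) (partPos mu j)).det = 0 := by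
          refine Matrix.det_zero_of_row_eq hki ?_
          funext j
          simp [hki, hk]
        rw [hdet, mul_zero, add_zero, letterTableaux_subset_succ]
        intro G hG s hs
        have h1 := hrow G hG s hs
        have hs1 : s.1.1 = i := by rw [h1.1]
        have h2 := s.2.2
        rw [hs1] at h2
        -- If the row below were equally long, the cell under the letter `L` would need a larger
        -- letter.
        refine hnu (exists_isRemoveCorner (by omega) fun j hj => ?_)
        refine lt_of_le_of_ne (lam.2 hj.le) fun heq => ?_
        have h3 := hG
        rw [mem_letterTableaux] at h3
        have hj' : i.1 < j.1 := hj
        have h4 : i.1 + 1 < n := by have := j.2; omega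
        have h6 := lam.2 (show i ≤ ⟨i.1 + 1, h4⟩ from Fin.le_def.2 (Nat.le_succ _))
        have h7 := lam.2 (show (⟨i.1 + 1, h4⟩ : Fin n) ≤ j from Fin.le_def.2 hj')
        have h9 := mu.2 (show i ≤ ⟨i.1 + 1, h4⟩ from Fin.le_def.2 (Nat.le_succ _))
        have h10 : s.1.2 = lam.1 i - 1 := by rw [h1.1]
        have h8 := h3.2.2.2 s ⟨(⟨i.1 + 1, h4⟩, s.1.2), by simp only; omega, by simp only; omega⟩
          (by simp only [hs1]) rfl
        have h11 := h3.1 ⟨(⟨i.1 + 1, h4⟩, s.1.2), by simp only; omega, by simp only; omega⟩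
        omega

/-! ### `q`-binomial coefficients -/

section QBinomial

variable {K : Type*} [Field K]

theorem qPoch_zero (a q : K) : qPoch a q 0 = 1 := by simp [qPoch]

theorem qPoch_succ (a q : K) (n : ℕ) : qPoch a q (n + 1) = qPoch a q n * (1 - a * q ^ n) := by
  simp [qPoch, prod_range_succ]

theorem qPoch_add (a q : K) (m n : ℕ) :
    qPoch a q (m + n) = qPoch a q m * qPoch (a * q ^ m) q n := by
  simp only [qPoch, prod_range_add, pow_add]
  congr 1
  exact prod_congr rfl fun j _ => by ring

theorem qPoch_succ_left (a q : K) (n : ℕ) :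
    qPoch a q (n + 1) = (1 - a) * qPoch (a * q) q n := by
  rw [add_comm, qPoch_add, qPoch_succ, qPoch_zero]
  simp

theorem qPoch_ne_zero {a q : K} (n : ℕ) (h : ∀ j, j < n → 1 - a * q ^ j ≠ 0) : qPoch a q n ≠ 0 :=
  prod_ne_zero_iff.2 fun j hj => h j (mem_range.1 hj)

/-- The `q`-binomial coefficient. -/
noncomputable def gaussBinom (q : K) (m k : ℕ) : K :=
  if k ≤ m then qPoch q q m / (qPoch q q k * qPoch q q (m - k)) else 0

theorem gaussBinom_of_lt (q : K) {m k : ℕ} (h : m < k) : gaussBinom q m k = 0 :=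
  if_neg (not_le.2 h)

theorem gaussBinom_symm (q : K) {m k : ℕ} (h : k ≤ m) :
    gaussBinom q m (m - k) = gaussBinom q m k := by
  rw [gaussBinom, gaussBinom, if_pos h, if_pos (Nat.sub_le _ _), Nat.sub_sub_self h, mul_comm]

variable {q : K}

theorem qPoch_self_ne_zero (hq : ∀ j : ℕ, 1 ≤ j → 1 - q ^ j ≠ 0) (n : ℕ) : qPoch q q n ≠ 0 :=
  qPoch_ne_zero n fun j _ => by
    rw [← pow_succ']
    exact hq _ (Nat.succ_pos j)

theorem gaussBinom_zero_right (hq : ∀ j : ℕ, 1 ≤ j → 1 - q ^ j ≠ 0) (m : ℕ) :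
    gaussBinom q m 0 = 1 := by
  simp [gaussBinom, qPoch_zero, qPoch_self_ne_zero hq m]

theorem gaussBinom_self (hq : ∀ j : ℕ, 1 ≤ j → 1 - q ^ j ≠ 0) (m : ℕ) :
    gaussBinom q m m = 1 := by
  simp [gaussBinom, qPoch_zero, qPoch_self_ne_zero hq m]

theorem gaussBinom_add_mul (hq : ∀ j : ℕ, 1 ≤ j → 1 - q ^ j ≠ 0) (d k : ℕ) :
    gaussBinom q (d + k) k * (qPoch q q k * qPoch q q d) = qPoch q q (d + k) := by
  rw [gaussBinom, if_pos (Nat.le_add_left _ _), Nat.add_sub_cancel]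
  have h1 := qPoch_self_ne_zero hq k
  have h2 := qPoch_self_ne_zero hq d
  field_simp

theorem gaussBinom_succ_succ (hq : ∀ j : ℕ, 1 ≤ j → 1 - q ^ j ≠ 0) (m k : ℕ) :
    gaussBinom q (m + 1) (k + 1) = gaussBinom q m (k + 1) + q ^ (m - k) * gaussBinom q m k := by
  rcases lt_trichotomy m k with h | h | h
  · simp [gaussBinom_of_lt, h, h.trans (Nat.lt_succ_self k)]
  · subst h
    rw [gaussBinom_self hq, gaussBinom_self hq, gaussBinom_of_lt q (Nat.lt_succ_self m)]
    simp
  · obtain ⟨d, rfl⟩ : ∃ d, m = (d + 1) + k := ⟨m - k - 1, by omega⟩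
    have h1 := gaussBinom_add_mul hq (d + 1) (k + 1)
    have h2 := gaussBinom_add_mul hq d (k + 1)
    have h3 := gaussBinom_add_mul hq (d + 1) k
    rw [show d + 1 + (k + 1) = d + 1 + k + 1 by ring] at h1
    rw [show d + (k + 1) = d + 1 + k by ring] at h2
    rw [qPoch_succ q q k, qPoch_succ q q d, qPoch_succ q q (d + 1 + k)] at h1
    rw [qPoch_succ q q k] at h2
    rw [qPoch_succ q q d] at h3
    have h4 := qPoch_self_ne_zero hq k
    have h5 := qPoch_self_ne_zero hq d
    have h6 : 1 - q * q ^ k ≠ 0 := by rw [← pow_succ']; exact hq _ (Nat.succ_pos k)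
    have h7 : 1 - q * q ^ d ≠ 0 := by rw [← pow_succ']; exact hq _ (Nat.succ_pos d)
    rw [Nat.add_sub_cancel]
    apply mul_right_cancel₀ (mul_ne_zero (mul_ne_zero h4 h6) (mul_ne_zero h5 h7))
    rw [h1, add_mul, show gaussBinom q (d + 1 + k) (k + 1) * (qPoch q q k * (1 - q * q ^ k) *
      (qPoch q q d * (1 - q * q ^ d))) = gaussBinom q (d + 1 + k) (k + 1) * (qPoch q q k *
      (1 - q * q ^ k) * qPoch q q d) * (1 - q * q ^ d) by ring, h2,
      show q ^ (d + 1) * gaussBinom q (d + 1 + k) k * (qPoch q q k * (1 - q * q ^ k) *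
      (qPoch q q d * (1 - q * q ^ d))) = q ^ (d + 1) * (gaussBinom q (d + 1 + k) k * (qPoch q q k *
      (qPoch q q d * (1 - q * q ^ d)))) * (1 - q * q ^ k) by ring, h3]
    ring

theorem gaussBinom_succ_succ' (hq : ∀ j : ℕ, 1 ≤ j → 1 - q ^ j ≠ 0) (m k : ℕ) :
    gaussBinom q (m + 1) (k + 1) = q ^ (k + 1) * gaussBinom q m (k + 1) + gaussBinom q m k := by
  rcases lt_trichotomy m k with h | h | h
  · simp [gaussBinom_of_lt, h, h.trans (Nat.lt_succ_self k)]
  · subst h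
    rw [gaussBinom_self hq, gaussBinom_self hq, gaussBinom_of_lt q (Nat.lt_succ_self m)]
    simp
  · have h1 := gaussBinom_succ_succ hq m (m - k - 1)
    rw [show m - k - 1 + 1 = m - k by omega, show m - (m - k - 1) = k + 1 by omega] at h1
    rw [← gaussBinom_symm q (show k + 1 ≤ m + 1 by omega), ← gaussBinom_symm q (show k + 1 ≤ m by omega),
      ← gaussBinom_symm q (show k ≤ m by omega), show m + 1 - (k + 1) = m - k by omega,
      show m - (k + 1) = m - k - 1 by omega, h1]
    ring

theorem gaussBinom_mul_gaussBinom (hq : ∀ j : ℕ, 1 ≤ j → 1 - q ^ j ≠ 0) {n i k : ℕ} (hi : i ≤ n) :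
    gaussBinom q (n + k) (n - i + k) * gaussBinom q (n - i + k) k =
      gaussBinom q (n + k) k * gaussBinom q n i := by
  obtain ⟨d, rfl⟩ : ∃ d, n = d + i := ⟨n - i, by omega⟩
  simp only [gaussBinom]
  rw [if_pos (by omega), if_pos (by omega), if_pos (by omega), if_pos (by omega)]
  have h1 : d + i + k - (d + i - i + k) = i := by omega
  have h2 : d + i - i + k - k = d := by omega
  have h3 : d + i + k - k = d + i := by omega
  have h4 : d + i - i = d := by omega
  rw [h1, h2, h3, h4]
  have e1 := qPoch_self_ne_zero hq (d + k)
  have e2 := qPoch_self_ne_zero hq i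
  have e3 := qPoch_self_ne_zero hq k
  have e4 := qPoch_self_ne_zero hq d
  have e5 := qPoch_self_ne_zero hq (d + i)
  field_simp

/-- `(x - y)(x - yq) ⋯ (x - yq^(n-1))`. -/
noncomputable def qShiftProd (q x y : K) (n : ℕ) : K := ∏ j ∈ range n, (x - y * q ^ j)

theorem qShiftProd_succ (x y : K) (n : ℕ) :
    qShiftProd q x y (n + 1) = qShiftProd q x y n * (x - y * q ^ n) := by
  simp [qShiftProd, prod_range_succ]

/-- The `q`-binomial theorem in convolution form. -/
theorem qShiftProd_eq_sum (hq : ∀ j : ℕ, 1 ≤ j → 1 - q ^ j ≠ 0) (x y z : K) (n : ℕ) :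
    qShiftProd q x z n =
      ∑ i ∈ range (n + 1), gaussBinom q n i * qShiftProd q y z i * qShiftProd q x y (n - i) := by
  induction n with
  | zero => simp [qShiftProd, gaussBinom_self hq]
  | succ n ih =>
    rw [qShiftProd_succ, ih, sum_mul]
    -- Split x - z q^n as (x - y q^(n-i)) + q^(n-i) (y - z q^i), extending one of the two products;
    -- q-Pascal then recombines the terms.
    have h1 : ∀ i ∈ range (n + 1), gaussBinom q n i * qShiftProd q y z i *
        qShiftProd q x y (n - i) * (x - z * q ^ n) =
        gaussBinom q n i * qShiftProd q y z i * qShiftProd q x y (n + 1 - i) +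
        q ^ (n - i) * gaussBinom q n i * qShiftProd q y z (i + 1) * qShiftProd q x y (n - i) := by
      intro i hi
      obtain ⟨d, rfl⟩ : ∃ d, n = d + i := ⟨n - i, by have := mem_range.1 hi; omega⟩
      rw [show d + i + 1 - i = d + i - i + 1 by omega, qShiftProd_succ, qShiftProd_succ,
        Nat.add_sub_cancel]
      ring
    rw [sum_congr rfl h1, sum_add_distrib, sum_range_succ' _ (n + 1)]
    rw [sum_range_succ' (fun i => gaussBinom q n i * qShiftProd q y z i *
      qShiftProd q x y (n + 1 - i)) n]
    have h2 : ∀ i ∈ range (n + 1), gaussBinom q (n + 1) (i + 1) * qShiftProd q y z (i + 1) *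
        qShiftProd q x y (n + 1 - (i + 1)) =
        gaussBinom q n (i + 1) * qShiftProd q y z (i + 1) * qShiftProd q x y (n + 1 - (i + 1)) +
        q ^ (n - i) * gaussBinom q n i * qShiftProd q y z (i + 1) * qShiftProd q x y (n - i) := by
      intro i _
      rw [gaussBinom_succ_succ hq, Nat.add_sub_add_right]
      ring
    rw [sum_congr rfl h2, sum_add_distrib, sum_range_succ (fun i => gaussBinom q n (i + 1) *
      qShiftProd q y z (i + 1) * qShiftProd q x y (n + 1 - (i + 1))) n,
      gaussBinom_of_lt q (Nat.lt_succ_self n), gaussBinom_zero_right hq, gaussBinom_zero_right hq]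
    ring

theorem qShiftProd_one (y : K) (n : ℕ) : qShiftProd q 1 y n = qPoch y q n := rfl

theorem choose_two_succ (i : ℕ) : (i + 1).choose 2 = i.choose 2 + i := by
  rw [Nat.choose_succ_succ' i 1, Nat.choose_one_right, add_comm]

/-- `(x - 1)(x - q) ⋯ (x - q^(n-1))` in the monomial basis. -/
theorem sum_gaussBinom_mul_pow (hq : ∀ j : ℕ, 1 ≤ j → 1 - q ^ j ≠ 0) (x : K) (n : ℕ) :
    ∑ i ∈ range (n + 1), (-1) ^ (n - i) * q ^ (n - i).choose 2 * gaussBinom q n i * x ^ i =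
      qShiftProd q x 1 n := by
  have h0 : ∀ i, qShiftProd q 0 1 i = (-1) ^ i * q ^ i.choose 2 := by
    intro i
    induction i with
    | zero => simp [qShiftProd]
    | succ i ih =>
      rw [qShiftProd_succ, ih, choose_two_succ, pow_add, pow_succ]
      ring
  have h1 : ∀ i, qShiftProd q x 0 i = x ^ i := by
    intro i
    simp [qShiftProd]
  -- The convolution at y = 0, z = 1, where the two products become monomials, read in reverse
  -- order.
  rw [qShiftProd_eq_sum hq x 0 1 n, ← sum_range_reflect]
  refine sum_congr rfl fun i hi => ?_
  have hi' := mem_range.1 hi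
  rw [h0, h1, show n + 1 - 1 - i = n - i by omega, show n - (n - i) = i by omega,
    gaussBinom_symm q (by omega)]
  ring

end QBinomial

/-! ### Coefficients of the little `q`-Jacobi polynomials -/

section Coefficients

variable {K : Type*} [Field K] {q : K}

/-- The coefficient of `x^k` in `(x - 1)(x - q) ⋯ (x - q^(m-1))`. -/
noncomputable def fallCoeff (q : K) (m k : ℕ) : K :=
  if k ≤ m then (-1) ^ (m - k) * q ^ (m - k).choose 2 * gaussBinom q m k else 0

/-- The coefficient of `x^k` in the `m`-th little `q`-Jacobi polynomial. -/
noncomputable def jacobiCoeff (a b q : K) (m k : ℕ) : K :=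
  fallCoeff q m k * (qPoch (a * q ^ (k + 1)) q (m - k) / qPoch (a * b * q ^ (m + k + 1)) q (m - k))

theorem jacobiCoeff_of_lt (a b : K) (m k : ℕ) (h : m < k) : jacobiCoeff a b q m k = 0 := by
  rw [jacobiCoeff, fallCoeff, if_neg (not_le.2 h), zero_mul]

theorem jacobiCoeff_self (hq : ∀ j : ℕ, 1 ≤ j → 1 - q ^ j ≠ 0) (a b : K) (m : ℕ) :
    jacobiCoeff a b q m m = 1 := by
  simp [jacobiCoeff, fallCoeff, qPoch_zero, gaussBinom_self hq]

/-- Reversing the factors clears the negative powers of q, so that the terminating series acquires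
q-binomial coefficients. -/
theorem qPoch_inv_pow (hq0 : q ≠ 0) (hq : ∀ j : ℕ, 1 ≤ j → 1 - q ^ j ≠ 0) {m i : ℕ} (hi : i ≤ m) :
    qPoch (q ^ m)⁻¹ q i * q ^ i * q ^ m.choose 2 =
      (-1) ^ i * q ^ (m - i).choose 2 * gaussBinom q m i * qPoch q q i := by
  induction i with
  | zero => simp [qPoch_zero, gaussBinom_zero_right hq]
  | succ i ih =>
    have ih' := ih (by omega)
    obtain ⟨d, rfl⟩ : ∃ d, m = (d + 1) + i := ⟨m - i - 1, by omega⟩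
    rw [show d + 1 + i - i = d + 1 by omega, choose_two_succ d] at ih'
    rw [show d + 1 + i - (i + 1) = d by omega, qPoch_succ, qPoch_succ]
    have h1 := gaussBinom_add_mul hq (d + 1) i
    have h2 := gaussBinom_add_mul hq d (i + 1)
    rw [show d + (i + 1) = d + 1 + i by ring, ← h1, qPoch_succ, qPoch_succ] at h2
    have h3 := qPoch_self_ne_zero hq d
    have h4 := qPoch_self_ne_zero hq i
    have h5 : gaussBinom q (d + 1 + i) (i + 1) * (1 - q * q ^ i) =
        gaussBinom q (d + 1 + i) i * (1 - q * q ^ d) := by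
      apply mul_right_cancel₀ (mul_ne_zero h3 h4)
      linear_combination h2
    have h6 : (1 - (q ^ (d + 1 + i))⁻¹ * q ^ i) * q ^ (d + 1) = -(1 - q * q ^ d) := by
      rw [pow_add q (d + 1) i]
      field_simp
      ring
    apply mul_right_cancel₀ (pow_ne_zero d hq0)
    calc qPoch (q ^ (d + 1 + i))⁻¹ q i * (1 - (q ^ (d + 1 + i))⁻¹ * q ^ i) * q ^ (i + 1) *
          q ^ (d + 1 + i).choose 2 * q ^ d
        = (qPoch (q ^ (d + 1 + i))⁻¹ q i * q ^ i * q ^ (d + 1 + i).choose 2) *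
          ((1 - (q ^ (d + 1 + i))⁻¹ * q ^ i) * q ^ (d + 1)) := by ring
      _ = _ := by
          rw [ih', h6]
          linear_combination (-1) ^ i * q ^ (d.choose 2 + d) * qPoch q q i * h5

theorem littleQJacobi_eq_sum (hq0 : q ≠ 0) (hq : ∀ j : ℕ, 1 ≤ j → 1 - q ^ j ≠ 0) {a b : K}
    (ha : ∀ j : ℕ, 1 ≤ j → 1 - a * q ^ j ≠ 0) (hab : ∀ j : ℕ, 2 ≤ j → 1 - a * b * q ^ j ≠ 0)
    (m : ℕ) : littleQJacobi a b q m =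
      ∑ k ∈ range (m + 1), Polynomial.C (jacobiCoeff a b q m k) * Polynomial.X ^ k := by
  unfold littleQJacobi
  rw [mul_sum]
  refine sum_congr rfl fun i hi => ?_
  have hi' : i ≤ m := Nat.lt_succ_iff.1 (mem_range.1 hi)
  rw [mul_pow, ← Polynomial.C_pow, ← mul_assoc, ← mul_assoc, ← Polynomial.C_mul, ← Polynomial.C_mul]
  congr 2
  rw [jacobiCoeff, fallCoeff, if_pos hi']
  have h1 := qPoch_inv_pow hq0 hq hi'
  have haq : ∀ (k n : ℕ), 1 ≤ k → qPoch (a * q ^ k) q n ≠ 0 := fun k n hk =>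
    qPoch_ne_zero n fun j _ => by
      rw [mul_assoc, ← pow_add]
      exact ha _ (by omega)
  have habq : ∀ (k n : ℕ), 2 ≤ k → qPoch (a * b * q ^ k) q n ≠ 0 := fun k n hk =>
    qPoch_ne_zero n fun j _ => by
      rw [mul_assoc, ← pow_add]
      exact hab _ (by omega)
  have h2 : qPoch (a * q) q m = qPoch (a * q) q i * qPoch (a * q ^ (i + 1)) q (m - i) := by
    rw [show qPoch (a * q) q m = qPoch (a * q) q (i + (m - i)) by rw [Nat.add_sub_cancel' hi'],
      qPoch_add, mul_assoc a, ← pow_succ']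
  have h3 : qPoch (a * b * q ^ (m + 1)) q m = qPoch (a * b * q ^ (m + 1)) q i *
      qPoch (a * b * q ^ (m + i + 1)) q (m - i) := by
    rw [show qPoch (a * b * q ^ (m + 1)) q m = qPoch (a * b * q ^ (m + 1)) q (i + (m - i)) by
      rw [Nat.add_sub_cancel' hi'], qPoch_add, mul_assoc (a * b), ← pow_add]
    congr 3
    ring
  have n1 : qPoch (a * q) q i ≠ 0 := by simpa using haq 1 i le_rfl
  -- For m = 0 the product is empty. The case is separate because 1 - a b q^j is known to be nonzero
  -- only for j ≥ 2.
  have n2 : qPoch (a * b * q ^ (m + 1)) q m ≠ 0 := by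
    rcases Nat.eq_zero_or_pos m with h | h
    · subst h
      simp [qPoch_zero]
    · exact habq _ _ (by omega)
  rw [h3] at n2
  have n3 := left_ne_zero_of_mul n2
  have n4 := right_ne_zero_of_mul n2
  have n5 := qPoch_self_ne_zero hq i
  have n6 : q ^ m.choose 2 ≠ 0 := pow_ne_zero _ hq0
  rw [h2, h3]
  have h5 : ((-1 : K) ^ m) = (-1) ^ (m - i) * (-1) ^ i := by
    rw [← pow_add, Nat.sub_add_cancel hi']
  have h7 : ((-1 : K) ^ (m - i)) * (-1) ^ (m - i) = 1 := by rw [← mul_pow]; simp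
  have n7 : (-1 : K) ^ m ≠ 0 := pow_ne_zero _ (by simp)
  generalize qPoch (q ^ m)⁻¹ q i = P at h1 ⊢
  field_simp
  rw [h5]
  linear_combination (qPoch (a * q ^ (i + 1)) q (m - i)) * h1 -
    (-1) ^ i * q ^ (m - i).choose 2 * gaussBinom q m i * qPoch q q i *
    qPoch (a * q ^ (i + 1)) q (m - i) * h7

/-- Factor by factor, -a q^(k+1+j) (1 - b q^(n+k-j)) = a b q^(n+2k+1) - a q^(k+1+j); the binomial
powers of q correct the mismatch of exponents. -/
theorem prod_Ioc_sub_mul_qPoch {a b : K} (n k i : ℕ) (hi : i ≤ n) :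
    (∏ s ∈ Ioc (n - i + k) (n + k), (-(a * q ^ s))) * qPoch (b * q ^ (n - i + k + 1)) q i *
      q ^ i.choose 2 * q ^ (n - i).choose 2 =
      q ^ n.choose 2 * qShiftProd q (a * b * q ^ (n + k + k + 1)) (a * q ^ (k + 1)) i := by
  induction i with
  | zero => simp [qPoch_zero, qShiftProd]
  | succ i ih =>
    have ih' := ih (by omega)
    obtain ⟨d, rfl⟩ : ∃ d, n = (d + 1) + i := ⟨n - i - 1, by omega⟩
    rw [show d + 1 + i - i = d + 1 by omega, choose_two_succ d] at ih'
    rw [show d + 1 + i - (i + 1) = d by omega, qShiftProd_succ, ← mul_assoc, ← ih', choose_two_succ i,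
      qPoch_succ_left]
    have h1 : Ioc (d + k) (d + 1 + i + k) = insert (d + 1 + k) (Ioc (d + 1 + k) (d + 1 + i + k)) := by
      ext x
      simp only [mem_Ioc, mem_insert]
      omega
    rw [h1, prod_insert (by simp), show d + k + 1 = d + 1 + k by ring, mul_assoc b, ← pow_succ]
    ring

/-- The contiguity between the coefficients of the polynomials with parameters `(a, b)` and
`(b, a)`. -/
theorem jacobiCoeff_eq_sum (hq : ∀ j : ℕ, 1 ≤ j → 1 - q ^ j ≠ 0) {a b : K}
    (hab : ∀ j : ℕ, 2 ≤ j → 1 - a * b * q ^ j ≠ 0) (m k : ℕ) :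
    jacobiCoeff a b q m k = ∑ j ∈ range (m + 1),
      (∏ s ∈ Ioc j m, (-(a * q ^ s))) * jacobiCoeff b a q m j * fallCoeff q j k := by
  by_cases hk : k ≤ m
  swap
  · rw [jacobiCoeff_of_lt _ _ _ _ (not_le.1 hk)]
    refine (sum_eq_zero fun j hj => ?_).symm
    rw [fallCoeff, if_neg (by have := mem_range.1 hj; omega), mul_zero]
  obtain ⟨n, rfl⟩ : ∃ n, m = n + k := ⟨m - k, by omega⟩
  have h1 : ∑ j ∈ range (n + k + 1), (∏ s ∈ Ioc j (n + k), (-(a * q ^ s))) *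
      jacobiCoeff b a q (n + k) j * fallCoeff q j k =
      ∑ i ∈ range (n + 1), (∏ s ∈ Ioc (n - i + k) (n + k), (-(a * q ^ s))) *
      jacobiCoeff b a q (n + k) (n - i + k) * fallCoeff q (n - i + k) k := by
    rw [show n + k + 1 = k + (n + 1) by ring, sum_range_add, sum_eq_zero, zero_add,
      ← sum_range_reflect]
    · refine sum_congr rfl fun i hi => ?_
      rw [show k + (n + 1 - 1 - i) = n - i + k by have := mem_range.1 hi; omega]
    · intro j hj
      rw [fallCoeff, if_neg (by have := mem_range.1 hj; omega), mul_zero]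
  rw [h1, jacobiCoeff, fallCoeff, if_pos hk, Nat.add_sub_cancel]
  have habq : ∀ n' : ℕ, 1 ≤ n → qPoch (a * b * q ^ (n + k + k + 1)) q n' ≠ 0 := fun n' hn =>
    qPoch_ne_zero n' fun j _ => by
      rw [mul_assoc, ← pow_add]
      exact hab _ (by omega)
  have hX : qPoch (a * b * q ^ (n + k + k + 1)) q n ≠ 0 := by
    rcases Nat.eq_zero_or_pos n with h | h
    · subst h
      simp [qPoch_zero]
    · exact habq _ h
  -- The intermediate point a b q^(n+2k+1) of the convolution is chosen to cancel an initial part of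
  -- the denominator, leaving exactly the denominator of the coefficient with a and b exchanged.
  have h2 : qPoch (a * q ^ (k + 1)) q n = ∑ i ∈ range (n + 1), gaussBinom q n i *
      qShiftProd q (a * b * q ^ (n + k + k + 1)) (a * q ^ (k + 1)) i *
      qPoch (a * b * q ^ (n + k + k + 1)) q (n - i) := by
    rw [← qShiftProd_one, qShiftProd_eq_sum hq 1 (a * b * q ^ (n + k + k + 1))]
    rfl
  rw [h2, sum_div, mul_sum]
  refine sum_congr rfl fun i hi => ?_
  have hi' : i ≤ n := Nat.lt_succ_iff.1 (mem_range.1 hi)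
  have h3 := prod_Ioc_sub_mul_qPoch (q := q) (a := a) (b := b) n k i hi'
  have h4 := gaussBinom_mul_gaussBinom hq (k := k) hi'
  have h5 : qPoch (a * b * q ^ (n + k + k + 1)) q n = qPoch (a * b * q ^ (n + k + k + 1)) q (n - i) *
      qPoch (b * a * q ^ (n + k + (n - i + k) + 1)) q i := by
    conv_lhs => rw [← Nat.sub_add_cancel hi']
    rw [qPoch_add, Nat.sub_add_cancel hi', mul_assoc (a * b), ← pow_add, mul_comm b a]
    congr 3
    ring
  rw [h5] at hX ⊢
  have n1 := left_ne_zero_of_mul hX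
  have n2 := right_ne_zero_of_mul hX
  rw [jacobiCoeff, fallCoeff, if_pos (by omega), fallCoeff, if_pos (by omega),
    show n + k - (n - i + k) = i by omega, Nat.add_sub_cancel]
  have h6 : (-1 : K) ^ n = (-1) ^ i * (-1) ^ (n - i) := by
    rw [← pow_add, Nat.add_sub_cancel' hi']
  rw [h6]
  clear h5 hX
  generalize qPoch (b * a * q ^ (n + k + (n - i + k) + 1)) q i = P at n2 ⊢
  field_simp
  linear_combination (-gaussBinom q (n + k) k * gaussBinom q n i) * h3 -
    ((∏ s ∈ Ioc (n - i + k) (n + k), (-(a * q ^ s))) * qPoch (b * q ^ (n - i + k + 1)) q i *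
      q ^ i.choose 2 * q ^ (n - i).choose 2) * h4

end Coefficients

/-! ### Letters for lecture hall tableaux -/

/-- The shifted content of the cells in which the letter `p` may be used. -/
def letterContent (D p : ℕ) : ℕ := D - p % D

/-- The weight of the letter `p`. With `s = D - p % D` and `p / D = t D + r`, it stands for the entry
`t s + r` in a cell of shifted content `s`, provided that `r < s`. -/
def letterWeight {K : Type*} [Field K] (q u v : K) (D p : ℕ) : K :=
  if p / D % D < letterContent D p then
    q ^ (p / D / D * letterContent D p + p / D % D) * u ^ (p / D / D) * v ^ (p / D / D % 2)
  else 0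

theorem letterContent_pos {D : ℕ} (hD : 0 < D) (p : ℕ) : 1 ≤ letterContent D p := by
  have := Nat.mod_lt p hD
  unfold letterContent
  omega

/-! ### The matrix of one level of letters, and the exact remainder after several levels. -/

section Level

variable {K : Type*} [Field K] {q u v : K} {D : ℕ}

/-- Inside a block of `D` letters with common quotient and remainder, the contents run through D, D
- 1, …, 1. A descent uses decreasing letters, hence increasing contents here, so a position drops at
most once per block. -/
theorem letterCoeff_block (hD : 0 < D) (N k : ℕ) (r : ℕ) (hr : r ≤ D) : ∀ m ≤ D,
    letterCoeff (letterContent D) (fun p => -letterWeight q u v D p) (N * D + r) m k =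
      letterCoeff (letterContent D) (fun p => -letterWeight q u v D p) (N * D) m k -
      if D < m + r ∧ N % D < m then q ^ (N / D * m + N % D) * u ^ (N / D) * v ^ (N / D % 2) *
        letterCoeff (letterContent D) (fun p => -letterWeight q u v D p) (N * D) (m - 1) k
      else 0 := by
  induction r with
  | zero =>
    intro m hm
    rw [if_neg (by omega), sub_zero, add_zero]
  | succ r ih =>
    intro m hm
    have hdiv : (N * D + r) / D = N := by
      rw [mul_comm, Nat.mul_add_div hD, Nat.div_eq_of_lt (by omega), add_zero]
    have hmod : (N * D + r) % D = r := by
      rw [mul_comm, Nat.mul_add_mod, Nat.mod_eq_of_lt (by omega)]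
    have hc : letterContent D (N * D + r) = D - r := by rw [letterContent, hmod]
    rw [← add_assoc, letterCoeff_succ, ih (by omega) m hm, ih (by omega) (m - 1) (by omega), hc,
      letterWeight, hc, hdiv]
    by_cases h1 : m = D - r
    -- The letter of content m enters now; the position m - 1 reached by it has not yet been touched
    -- in this block.
    · rw [if_neg (by omega), if_pos h1, if_neg (show ¬ (D < m - 1 + r ∧ N % D < m - 1) by omega),
        ← h1]
      by_cases h2 : N % D < m
      · rw [if_pos h2, if_pos ⟨by omega, h2⟩]
        ring
      · rw [if_neg h2, if_neg (fun h => h2 h.2)]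
        ring
    · rw [if_neg h1, add_zero]
      congr 1
      refine if_congr ?_ rfl rfl
      omega

theorem letterCoeff_row (hD : 0 < D) (N m k : ℕ) (hm : m ≤ D) :
    letterCoeff (letterContent D) (fun p => -letterWeight q u v D p) ((N + 1) * D) m k =
      letterCoeff (letterContent D) (fun p => -letterWeight q u v D p) (N * D) m k -
      if N % D < m then q ^ (N / D * m + N % D) * u ^ (N / D) * v ^ (N / D % 2) *
        letterCoeff (letterContent D) (fun p => -letterWeight q u v D p) (N * D) (m - 1) k
      else 0 := by
  rw [add_mul, one_mul, letterCoeff_block hD N k D le_rfl m hm]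
  congr 1
  refine if_congr ?_ rfl rfl
  omega

/-- The factor by which the weights of the `t`-th level differ from those of the `0`-th one. -/
def levelScale (q u v : K) (t m k : ℕ) : K := ∏ s ∈ Ioc k m, ((q ^ s) ^ t * (u ^ t * v ^ (t % 2)))

theorem levelScale_self (t m : ℕ) : levelScale q u v t m m = 1 := by simp [levelScale]

theorem levelScale_succ (t : ℕ) {m k : ℕ} (h : k ≤ m) : levelScale q u v t (m + 1) k =
    levelScale q u v t m k * ((q ^ (m + 1)) ^ t * (u ^ t * v ^ (t % 2))) := by
  rw [levelScale, prod_Ioc_succ_top (by omega), levelScale]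

theorem levelScale_mul (t : ℕ) {m j k : ℕ} (h1 : k ≤ j) (h2 : j ≤ m) :
    levelScale q u v t m j * levelScale q u v t j k = levelScale q u v t m k := by
  rw [mul_comm]
  exact prod_Ioc_consecutive _ h1 h2

/-- The signed generating function of strictly increasing sequences of length `m - j` below `R`. -/
noncomputable def boundedFallCoeff (q : K) (R m j : ℕ) : K :=
  if j ≤ m then (-1) ^ (m - j) * q ^ (m - j).choose 2 * gaussBinom q (min R m) (m - j) else 0

theorem boundedFallCoeff_self_left {m j : ℕ} (h : m ≤ D) :
    boundedFallCoeff q D m j = fallCoeff q m j := by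
  unfold boundedFallCoeff fallCoeff
  split_ifs with h1
  · rw [min_eq_right h, gaussBinom_symm q h1]
  · rfl

theorem boundedFallCoeff_zero (hq : ∀ j : ℕ, 1 ≤ j → 1 - q ^ j ≠ 0) (m j : ℕ) :
    boundedFallCoeff q 0 m j = if m = j then 1 else 0 := by
  unfold boundedFallCoeff
  by_cases h : m = j
  · subst h
    simp [gaussBinom_self hq]
  · rw [if_neg h]
    split_ifs with h1
    · rw [gaussBinom_of_lt q (by omega), mul_zero]
    · rfl

/-- The q-Pascal rule, according to whether the remainder `R` is used. A cell of content m admits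
only remainders below m, so nothing changes once m ≤ R. -/
theorem boundedFallCoeff_succ (hq : ∀ j : ℕ, 1 ≤ j → 1 - q ^ j ≠ 0) (R m j : ℕ) (hj : j ≤ m) :
    boundedFallCoeff q (R + 1) m j = boundedFallCoeff q R m j -
      if R < m ∧ j + 1 ≤ m then q ^ R * boundedFallCoeff q R (m - 1) j else 0 := by
  unfold boundedFallCoeff
  rw [if_pos hj, if_pos hj]
  by_cases h : R < m
  · by_cases hjm : j = m
    · subst hjm
      simp [gaussBinom_zero_right hq]
    · obtain ⟨d, rfl⟩ : ∃ d, m = j + d + 1 := ⟨m - j - 1, by omega⟩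
      rw [if_pos ⟨h, by omega⟩, if_pos (by omega), show j + d + 1 - j = d + 1 by omega,
        show j + d + 1 - 1 - j = d by omega, min_eq_left (by omega), min_eq_left (by omega),
        min_eq_left (by omega), gaussBinom_succ_succ hq, choose_two_succ]
      by_cases hd : d ≤ R
      · obtain ⟨e, rfl⟩ : ∃ e, R = d + e := ⟨R - d, by omega⟩
        rw [Nat.add_sub_cancel_left]
        ring
      · rw [gaussBinom_of_lt q (show R < d by omega), gaussBinom_of_lt q (show R < d + 1 by omega)]
        ring
  · rw [if_neg (fun hh => h hh.1), sub_zero, min_eq_right (by omega), min_eq_right (by omega)]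

/-- In cells of contents j + 1, …, m the remainders form a strictly increasing sequence below min R
m, which automatically respects every bound r < s; the common quotient t contributes the scale. -/
theorem letterCoeff_level (hq : ∀ j : ℕ, 1 ≤ j → 1 - q ^ j ≠ 0) (hD : 0 < D) (t k : ℕ) (R : ℕ)
    (hR : R ≤ D) : ∀ m ≤ D,
    letterCoeff (letterContent D) (fun p => -letterWeight q u v D p) ((t * D + R) * D) m k =
      ∑ j ∈ range (m + 1), levelScale q u v t m j * boundedFallCoeff q R m j *
        letterCoeff (letterContent D) (fun p => -letterWeight q u v D p) (t * D * D) j k := by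
  induction R with
  | zero =>
    intro m _
    rw [sum_eq_single m]
    · rw [levelScale_self, boundedFallCoeff_zero hq, if_pos rfl]
      simp
    · intro j _ hj
      rw [boundedFallCoeff_zero hq, if_neg hj.symm]
      simp
    · simp
  | succ R ih =>
    intro m hm
    have hdiv : (t * D + R) / D = t := by
      rw [mul_comm, Nat.mul_add_div hD, Nat.div_eq_of_lt (by omega), add_zero]
    have hmod : (t * D + R) % D = R := by
      rw [mul_comm, Nat.mul_add_mod, Nat.mod_eq_of_lt (by omega)]
    rw [← add_assoc, letterCoeff_row hD _ _ _ hm, hdiv, hmod, ih (by omega) m hm,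
      ih (by omega) (m - 1) (by omega)]
    have h1 : ∀ j ∈ range (m + 1), levelScale q u v t m j * boundedFallCoeff q (R + 1) m j *
        letterCoeff (letterContent D) (fun p => -letterWeight q u v D p) (t * D * D) j k =
        levelScale q u v t m j * boundedFallCoeff q R m j *
        letterCoeff (letterContent D) (fun p => -letterWeight q u v D p) (t * D * D) j k -
        levelScale q u v t m j * (if R < m ∧ j + 1 ≤ m then q ^ R * boundedFallCoeff q R (m - 1) j
          else 0) *
        letterCoeff (letterContent D) (fun p => -letterWeight q u v D p) (t * D * D) j k := by
      intro j hj
      rw [boundedFallCoeff_succ hq R m j (Nat.lt_succ_iff.1 (mem_range.1 hj))]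
      ring
    rw [sum_congr rfl h1, sum_sub_distrib]
    congr 1
    by_cases h : R < m
    · obtain ⟨m, rfl⟩ : ∃ m', m = m' + 1 := ⟨m - 1, by omega⟩
      rw [if_pos h, Nat.add_sub_cancel, sum_range_succ _ (m + 1), if_neg (by omega), mul_zero, zero_mul,
        add_zero, mul_sum]
      refine sum_congr rfl fun j hj => ?_
      have hj' := mem_range.1 hj
      rw [if_pos ⟨h, by omega⟩, levelScale_succ t (by omega)]
      ring
    · rw [if_neg h]
      refine (sum_eq_zero fun j _ => ?_).symm
      rw [if_neg (fun hh => h hh.1), mul_zero, zero_mul]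

/-- The coefficients of the little `q`-Jacobi polynomial, with `a = -uv` and `b = -u/v`, after removal
of the first `t` levels. -/
noncomputable def shiftedCoeff (q u v : K) (t m k : ℕ) : K :=
  levelScale q u v t m k *
    if t % 2 = 0 then jacobiCoeff (-(u * v)) (-(u / v)) q m k
    else jacobiCoeff (-(u / v)) (-(u * v)) q m k

/-- Consecutive scales differ by z q^s at each content s, with z = uv for even t and z = u/v for odd
t. This z is -a for the current first parameter, so `jacobiCoeff_eq_sum` peels off one level and
exchanges the parameters. -/
theorem shiftedCoeff_eq_sum (hq : ∀ j : ℕ, 1 ≤ j → 1 - q ^ j ≠ 0) (hv : v ≠ 0)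
    (hu : ∀ j : ℕ, 2 ≤ j → 1 - u * u * q ^ j ≠ 0) (t m k : ℕ) :
    shiftedCoeff q u v t m k = ∑ j ∈ range (m + 1), shiftedCoeff q u v (t + 1) m j *
      (levelScale q u v t j k * fallCoeff q j k) := by
  have h1 : -(u * v) * -(u / v) = u * u := by
    field_simp
  have h2 : -(u / v) * -(u * v) = u * u := by
    field_simp
  have hscale : ∀ z : K, u ^ (t + 1) * v ^ ((t + 1) % 2) = u ^ t * v ^ (t % 2) * z → ∀ j,
      levelScale q u v (t + 1) m j = levelScale q u v t m j * ∏ s ∈ Ioc j m, (-(-z * q ^ s)) := by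
    intro z hz j
    rw [levelScale, levelScale, ← prod_mul_distrib]
    refine prod_congr rfl fun s _ => ?_
    rw [hz]
    ring
  have key : ∀ z a b : K, u ^ (t + 1) * v ^ ((t + 1) % 2) = u ^ t * v ^ (t % 2) * z → a = -z →
      (∀ j : ℕ, 2 ≤ j → 1 - a * b * q ^ j ≠ 0) →
      levelScale q u v t m k * jacobiCoeff a b q m k = ∑ j ∈ range (m + 1),
        levelScale q u v (t + 1) m j * jacobiCoeff b a q m j *
        (levelScale q u v t j k * fallCoeff q j k) := by
    intro z a b hz ha hab
    rw [jacobiCoeff_eq_sum hq hab, mul_sum]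
    refine sum_congr rfl fun j hj => ?_
    have hj' := mem_range.1 hj
    by_cases hjk : k ≤ j
    · rw [hscale z hz, ha, ← levelScale_mul t hjk (show j ≤ m by omega)]
      ring
    · rw [fallCoeff, if_neg hjk]
      ring
  unfold shiftedCoeff
  rcases Nat.mod_two_eq_zero_or_one t with ht | ht
  · have ht' : (t + 1) % 2 = 1 := by omega
    simp only [ht, ht', if_true, one_ne_zero, if_false]
    refine key (u * v) _ _ ?_ rfl (by simpa only [h1] using hu)
    rw [ht, ht']
    ring
  · have ht' : (t + 1) % 2 = 0 := by omega
    simp only [ht, ht', if_true, one_ne_zero, if_false]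
    refine key (u / v) _ _ ?_ rfl (by simpa only [h2] using hu)
    rw [ht, ht']
    field_simp
    exact pow_succ u t

/-- The product of remainder and accumulated levels does not depend on t: the level split off from
the remainder is the one that joins the letters. -/
theorem sum_shiftedCoeff_mul_letterCoeff (hq : ∀ j : ℕ, 1 ≤ j → 1 - q ^ j ≠ 0) (hv : v ≠ 0)
    (hu : ∀ j : ℕ, 2 ≤ j → 1 - u * u * q ^ j ≠ 0) (hD : 0 < D) (t m k : ℕ) (hm : m ≤ D) :
    ∑ j ∈ range (m + 1), shiftedCoeff q u v t m j *
      letterCoeff (letterContent D) (fun p => -letterWeight q u v D p) (t * D * D) j k =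
      jacobiCoeff (-(u * v)) (-(u / v)) q m k := by
  induction t with
  | zero =>
    have h1 : ∀ j, shiftedCoeff q u v 0 m j = jacobiCoeff (-(u * v)) (-(u / v)) q m j := by
      intro j
      simp [shiftedCoeff, levelScale]
    simp only [h1, zero_mul, letterCoeff_zero, mul_ite, mul_one, mul_zero]
    rw [sum_ite_eq']
    split_ifs with h
    · rfl
    · exact (jacobiCoeff_of_lt _ _ _ _ (by simpa using h)).symm
  | succ t ih =>
    rw [← ih]
    have h1 : ∀ i ∈ range (m + 1), shiftedCoeff q u v (t + 1) m i *
        letterCoeff (letterContent D) (fun p => -letterWeight q u v D p) ((t + 1) * D * D) i k =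
        ∑ j ∈ range (m + 1), shiftedCoeff q u v (t + 1) m i * (levelScale q u v t i j *
          fallCoeff q i j) *
          letterCoeff (letterContent D) (fun p => -letterWeight q u v D p) (t * D * D) j k := by
      intro i hi
      have hi' : i ≤ m := Nat.lt_succ_iff.1 (mem_range.1 hi)
      rw [add_mul t 1 D, one_mul, letterCoeff_level hq hD t k D le_rfl i (hi'.trans hm), mul_sum]
      refine (sum_subset (range_subset_range.2 (by omega)) fun j _ hj => ?_).trans
        (sum_congr rfl fun j _ => ?_)
      · rw [boundedFallCoeff, if_neg (by simpa using hj)]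
        ring
      · rw [boundedFallCoeff_self_left (hi'.trans hm)]
        ring
    rw [sum_congr rfl h1, sum_comm]
    refine sum_congr rfl fun j _ => ?_
    rw [shiftedCoeff_eq_sum hq hv hu t m j, sum_mul]

end Level

/-! ### Convergence of the one-particle matrix to the little q-Jacobi coefficients. -/

section Limit

open Filter Topology

variable {K : Type*} [NormedField K] {q u v : K} {D : ℕ}

theorem tendsto_levelScale (hq1 : ‖q‖ < 1) (huq : ‖u * q‖ < 1) {m k : ℕ} (h : k < m) :
    Tendsto (fun t => levelScale q u v t m k) atTop (𝓝 0) := by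
  have h1 : ∀ s ∈ Ioc k m, Tendsto (fun t : ℕ => (q ^ s) ^ t * (u ^ t * v ^ (t % 2))) atTop (𝓝 0) := by
    intro s hs
    have hs1 : 1 ≤ s := by have := mem_Ioc.1 hs; omega
    have h2 : ‖q ^ s * u‖ < 1 := by
      obtain ⟨s, rfl⟩ : ∃ s', s = s' + 1 := ⟨s - 1, by omega⟩
      rw [show q ^ (s + 1) * u = q ^ s * (u * q) by ring, norm_mul, norm_pow]
      have h3 : ‖q‖ ^ s ≤ 1 := pow_le_one₀ (norm_nonneg _) hq1.le
      calc ‖q‖ ^ s * ‖u * q‖ ≤ 1 * ‖u * q‖ := by gcongr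
        _ < 1 := by rwa [one_mul]
    have h4 := tendsto_pow_atTop_nhds_zero_of_norm_lt_one h2
    have h5 : Tendsto (fun t : ℕ => ‖(q ^ s * u) ^ t‖ * max 1 ‖v‖) atTop (𝓝 0) := by
      simpa using (tendsto_norm_zero.comp h4).mul_const (max 1 ‖v‖)
    refine squeeze_zero_norm (fun t => ?_) h5
    rw [← mul_assoc, ← mul_pow, norm_mul]
    gcongr
    rcases Nat.mod_two_eq_zero_or_one t with ht | ht <;> rw [ht] <;> simp
  have h2 := tendsto_finsetProd (Ioc k m) h1
  rwa [prod_eq_zero (i := m) (by simp [h]) rfl] at h2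

theorem tendsto_shiftedCoeff (hq1 : ‖q‖ < 1) (huq : ‖u * q‖ < 1) {m k : ℕ} (h : k < m) :
    Tendsto (fun t => shiftedCoeff q u v t m k) atTop (𝓝 0) := by
  have h1 : Tendsto (fun t => ‖levelScale q u v t m k‖ *
      (‖jacobiCoeff (-(u * v)) (-(u / v)) q m k‖ + ‖jacobiCoeff (-(u / v)) (-(u * v)) q m k‖))
      atTop (𝓝 0) := by
    simpa using (tendsto_norm_zero.comp (tendsto_levelScale (v := v) hq1 huq h)).mul_const
      (‖jacobiCoeff (-(u * v)) (-(u / v)) q m k‖ + ‖jacobiCoeff (-(u / v)) (-(u * v)) q m k‖)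
  refine squeeze_zero_norm (fun t => ?_) h1
  rw [shiftedCoeff, norm_mul]
  gcongr
  split_ifs
  · exact le_add_of_nonneg_right (norm_nonneg _)
  · exact le_add_of_nonneg_left (norm_nonneg _)

theorem one_sub_pow_ne_zero (hq1 : ‖q‖ < 1) (j : ℕ) (hj : 1 ≤ j) : 1 - q ^ j ≠ 0 := by
  intro h
  have h1 : ‖q ^ j‖ = 1 := by rw [← sub_eq_zero.1 h, norm_one]
  rw [norm_pow] at h1
  exact (pow_lt_one₀ (norm_nonneg _) hq1 (by omega)).ne h1

/-- With ab = u², the norm of u² q^j is |uq|² |q|^(j-2) < 1, so the denominators involving ab need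
no separate hypothesis. -/
theorem one_sub_sq_mul_pow_ne_zero (hq1 : ‖q‖ < 1) (huq : ‖u * q‖ < 1) (j : ℕ) (hj : 2 ≤ j) :
    1 - u * u * q ^ j ≠ 0 := by
  intro h
  obtain ⟨j, rfl⟩ : ∃ j', j = j' + 2 := ⟨j - 2, by omega⟩
  have h1 : ‖u * u * q ^ (j + 2)‖ = 1 := by rw [← sub_eq_zero.1 h, norm_one]
  rw [show u * u * q ^ (j + 2) = (u * q) ^ 2 * q ^ j by ring, norm_mul, norm_pow, norm_pow] at h1
  have h2 : ‖u * q‖ ^ 2 < 1 := pow_lt_one₀ (norm_nonneg _) huq (by omega)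
  have h3 : ‖q‖ ^ j ≤ 1 := pow_le_one₀ (norm_nonneg _) hq1.le
  have h4 : ‖u * q‖ ^ 2 * ‖q‖ ^ j ≤ ‖u * q‖ ^ 2 * 1 := by gcongr
  linarith

/-- In the exact identity the diagonal remainder is 1 and the others tend to zero; by induction on m
they multiply convergent quantities. -/
theorem tendsto_letterCoeff (hq1 : ‖q‖ < 1) (huq : ‖u * q‖ < 1) (hv : v ≠ 0) (hD : 0 < D) (k : ℕ) :
    ∀ m ≤ D, Tendsto (fun t => letterCoeff (letterContent D) (fun p => -letterWeight q u v D p)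
      (t * D * D) m k) atTop (𝓝 (jacobiCoeff (-(u * v)) (-(u / v)) q m k)) := by
  intro m
  induction m using Nat.strong_induction_on with
  | _ m ih =>
    intro hm
    have hq := one_sub_pow_ne_zero hq1
    have h1 : ∀ t, letterCoeff (letterContent D) (fun p => -letterWeight q u v D p)
        (t * D * D) m k = jacobiCoeff (-(u * v)) (-(u / v)) q m k - ∑ j ∈ range m,
          shiftedCoeff q u v t m j * letterCoeff (letterContent D)
            (fun p => -letterWeight q u v D p) (t * D * D) j k := by
      intro t
      rw [← sum_shiftedCoeff_mul_letterCoeff hq hv (one_sub_sq_mul_pow_ne_zero hq1 huq) hD t m k hm,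
        sum_range_succ]
      have : shiftedCoeff q u v t m m = 1 := by
        simp [shiftedCoeff, levelScale_self, jacobiCoeff_self hq]
      rw [this]
      ring
    simp_rw [h1]
    have h2 : Tendsto (fun t => ∑ j ∈ range m, shiftedCoeff q u v t m j * letterCoeff
        (letterContent D) (fun p => -letterWeight q u v D p) (t * D * D) j k) atTop
        (𝓝 (∑ j ∈ range m, 0 * jacobiCoeff (-(u * v)) (-(u / v)) q j k)) := by
      refine tendsto_finsetSum _ fun j hj => ?_
      have hj' := mem_range.1 hj
      exact (tendsto_shiftedCoeff hq1 huq hj').mul (ih j hj' (by omega))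
    simpa using h2.const_sub (jacobiCoeff (-(u * v)) (-(u / v)) q m k)

end Limit

/-! ### The inverse matrix and the limit for reversed letters. -/

/-- The inverse of a unitriangular matrix. -/
noncomputable def unitriangularInv {K : Type*} [Field K] (c : ℕ → ℕ → K) (m k : ℕ) : K :=
  (if m = k then 1 else 0) - ∑ j : Fin m, c m j * unitriangularInv c j k
termination_by m
decreasing_by exact j.2

theorem unitriangularInv_eq {K : Type*} [Field K] (c : ℕ → ℕ → K) (m k : ℕ) :
    unitriangularInv c m k =
      (if m = k then 1 else 0) - ∑ j ∈ range m, c m j * unitriangularInv c j k := by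
  rw [unitriangularInv, Fin.sum_univ_eq_sum_range (fun j => c m j * unitriangularInv c j k)]

theorem unitriangularInv_of_lt {K : Type*} [Field K] (c : ℕ → ℕ → K) (m : ℕ) :
    ∀ k, m < k → unitriangularInv c m k = 0 := by
  induction m using Nat.strong_induction_on with
  | _ m ih =>
    intro k hk
    rw [unitriangularInv_eq, if_neg hk.ne, sum_eq_zero, sub_zero]
    intro j hj
    have := mem_range.1 hj
    rw [ih j this k (by omega), mul_zero]

theorem eq_sum_unitriangularInv {K : Type*} [Field K] {c : ℕ → ℕ → K} (hc : ∀ m, c m m = 1)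
    {p r : ℕ → Polynomial K} (h : ∀ m, p m = ∑ k ∈ range (m + 1), Polynomial.C (c m k) * r k)
    (m : ℕ) : r m = ∑ k ∈ range (m + 1), Polynomial.C (unitriangularInv c m k) * p k := by
  induction m using Nat.strong_induction_on with
  | _ m ih =>
    have h1 : r m = p m - ∑ j ∈ range m, Polynomial.C (c m j) * r j := by
      rw [h m, sum_range_succ, hc]
      simp
    have h2 : ∀ j ∈ range m, Polynomial.C (c m j) * r j =
        ∑ k ∈ range (m + 1), Polynomial.C (c m j * unitriangularInv c j k) * p k := by
      intro j hj
      have hj' := mem_range.1 hj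
      rw [ih j hj', mul_sum]
      refine (sum_subset (range_subset_range.2 (by omega)) fun k _ hk => ?_).trans
        (sum_congr rfl fun k _ => ?_)
      · rw [unitriangularInv_of_lt c j k (by simpa using hk)]
        simp
      · rw [Polynomial.C_mul, mul_assoc]
    rw [h1, sum_congr rfl h2, sum_comm]
    simp_rw [unitriangularInv_eq c m, ← sum_mul, ← map_sum, map_sub, sub_mul]
    rw [sum_sub_distrib]
    congr 1
    rw [sum_eq_single m]
    · simp
    · intro k _ hk
      simp [hk.symm]
    · simp

-- At each finite stage the reversed product inverts the signed one, so both obey the recursion of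
-- `unitriangularInv`, through which the limit passes by induction on m.
open Filter Topology in
theorem tendsto_letterCoeff_reverse {K : Type*} [NormedField K] {q u v : K} {D : ℕ}
    (hq1 : ‖q‖ < 1) (huq : ‖u * q‖ < 1) (hv : v ≠ 0) (hD : 0 < D) (k : ℕ) :
    ∀ m ≤ D, Tendsto (fun t => letterCoeff (fun p => letterContent D (t * D * D - 1 - p))
      (fun p => letterWeight q u v D (t * D * D - 1 - p)) (t * D * D) m k) atTop
      (𝓝 (unitriangularInv (jacobiCoeff (-(u * v)) (-(u / v)) q) m k)) := by
  intro m
  induction m using Nat.strong_induction_on with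
  | _ m ih =>
    intro hm
    have hc := fun p => letterContent_pos hD p
    have h1 : ∀ t, letterCoeff (fun p => letterContent D (t * D * D - 1 - p))
        (fun p => letterWeight q u v D (t * D * D - 1 - p)) (t * D * D) m k =
        (if m = k then 1 else 0) - ∑ j ∈ range m, letterCoeff (letterContent D)
          (fun p => -letterWeight q u v D p) (t * D * D) m j *
          letterCoeff (fun p => letterContent D (t * D * D - 1 - p))
            (fun p => letterWeight q u v D (t * D * D - 1 - p)) (t * D * D) j k := by
      intro t
      rw [← sum_letterCoeff_mul_reverse hc (letterWeight q u v D), sum_range_succ,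
        letterCoeff_self hc]
      ring
    simp_rw [h1]
    rw [unitriangularInv_eq]
    refine Tendsto.const_sub _ (tendsto_finsetSum _ fun j hj => ?_)
    have hj' := mem_range.1 hj
    exact (tendsto_letterCoeff hq1 huq hv hD j m hm).mul (ih j hj' (by omega))

/-! ### Summation over functions on a finite type -/

/-- A finite set of functions lies in a box, and the sum over a box factors into bounded partial
sums. -/
theorem summable_prod_apply {ι κ : Type*} [Fintype ι] {g : ι → κ → ℝ}
    (h0 : ∀ i k, 0 ≤ g i k) (hg : ∀ i, Summable (g i)) :
    Summable fun f : ι → κ => ∏ i, g i (f i) := by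
  classical
  refine summable_of_sum_le (c := ∏ i, ∑' k, g i k) (fun f => prod_nonneg fun i _ => h0 _ _)
    fun S => ?_
  calc ∑ f ∈ S, ∏ i, g i (f i)
      ≤ ∑ f ∈ Fintype.piFinset fun i => S.image fun f => f i, ∏ i, g i (f i) := by
        refine sum_le_sum_of_subset_of_nonneg (fun f hf => ?_) fun f _ _ =>
          prod_nonneg fun i _ => h0 _ _
        rw [Fintype.mem_piFinset]
        exact fun i => mem_image.2 ⟨f, hf, rfl⟩
    _ = ∏ i, ∑ k ∈ S.image fun f => f i, g i k := (prod_univ_sum _ _).symm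
    _ ≤ ∏ i, ∑' k, g i k :=
        prod_le_prod (fun i _ => sum_nonneg fun k _ => h0 _ _) fun i _ =>
          Summable.sum_le_tsum _ (fun k _ => h0 i k) (hg i)

theorem summable_norm_prod_apply {ι κ K : Type*} [Fintype ι] [NormedField K] {g : ι → κ → K}
    (hg : ∀ i, Summable fun k => ‖g i k‖) : Summable fun f : ι → κ => ‖∏ i, g i (f i)‖ := by
  simp only [norm_prod]
  exact summable_prod_apply (g := fun i k => ‖g i k‖) (fun i k => norm_nonneg _) hg

-- Unconditional summability allows summing along growing cubes, where the sum factors.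
open Filter Topology in
theorem tsum_prod_apply {ι K : Type*} [Fintype ι] [NormedField K] [CompleteSpace K]
    {g : ι → ℕ → K} (hg : ∀ i, Summable fun k => ‖g i k‖) :
    ∑' f : ι → ℕ, ∏ i, g i (f i) = ∏ i, ∑' k, g i k := by
  classical
  have h1 : Tendsto (fun N : ℕ => Fintype.piFinset fun _ : ι => range N) atTop atTop := by
    refine tendsto_atTop_finset_of_monotone (fun N M h => Fintype.piFinset_subset _ _ fun _ =>
      range_subset_range.2 h) fun f => ?_
    refine ⟨∑ i, f i + 1, Fintype.mem_piFinset.2 fun i => mem_range.2 (Nat.lt_succ_of_le ?_)⟩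
    exact single_le_sum (f := f) (fun _ _ => Nat.zero_le _) (mem_univ i)
  have h2 := ((summable_norm_prod_apply hg).of_norm.hasSum).comp h1
  have h3 : Tendsto (fun N : ℕ => ∏ i, ∑ k ∈ range N, g i k) atTop (𝓝 (∏ i, ∑' k, g i k)) :=
    tendsto_finsetProd _ fun i _ => ((hg i).of_norm.hasSum).tendsto_sum_nat
  refine tendsto_nhds_unique h2 (h3.congr fun N => ?_)
  exact prod_univ_sum _ _

/-! ### Lecture hall tableaux as tableaux with ordered letters -/

/-- The letter standing for the entry `x` in a cell of shifted content `s`. -/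
def letterCode (D x s : ℕ) : ℕ := (x / s * D + x % s) * D + (D - s)

section Code

variable {D : ℕ}

theorem letterCode_div {x s : ℕ} (hs : 1 ≤ s) (hsD : s ≤ D) :
    letterCode D x s / D = x / s * D + x % s := by
  rw [letterCode, mul_comm _ D, Nat.mul_add_div (by omega),
    Nat.div_eq_of_lt (show D - s < D by omega), add_zero]

theorem letterContent_letterCode {x s : ℕ} (hs : 1 ≤ s) (hsD : s ≤ D) :
    letterContent D (letterCode D x s) = s := by
  rw [letterContent, letterCode, mul_comm _ D, Nat.mul_add_mod, Nat.mod_eq_of_lt (by omega)]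
  omega

theorem letterCode_div_div {x s : ℕ} (hs : 1 ≤ s) (hsD : s ≤ D) :
    letterCode D x s / D / D = x / s := by
  have := Nat.mod_lt x hs
  rw [letterCode_div hs hsD, mul_comm _ D, Nat.mul_add_div (by omega),
    Nat.div_eq_of_lt (show x % s < D by omega), add_zero]

theorem letterCode_div_mod {x s : ℕ} (hs : 1 ≤ s) (hsD : s ≤ D) :
    letterCode D x s / D % D = x % s := by
  have := Nat.mod_lt x hs
  rw [letterCode_div hs hsD, mul_comm _ D, Nat.mul_add_mod, Nat.mod_eq_of_lt (by omega)]

theorem letterWeight_letterCode {K : Type*} [Field K] (q u v : K) {x s : ℕ} (hs : 1 ≤ s)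
    (hsD : s ≤ D) :
    letterWeight q u v D (letterCode D x s) = q ^ x * u ^ (x / s) * v ^ (x / s % 2) := by
  rw [letterWeight, letterContent_letterCode hs hsD, letterCode_div_div hs hsD,
    letterCode_div_mod hs hsD, if_pos (Nat.mod_lt x hs), Nat.div_add_mod']

/-- Cutting at t D² letters is the same as bounding the integer quotient by t in every cell. -/
theorem letterCode_lt_iff {x s t : ℕ} (hs : 1 ≤ s) (hsD : s ≤ D) :
    letterCode D x s < t * D * D ↔ x < t * s := by
  rw [← Nat.div_lt_iff_lt_mul (by omega), ← Nat.div_lt_iff_lt_mul (by omega),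
    letterCode_div_div hs hsD, Nat.div_lt_iff_lt_mul (by omega)]

theorem exists_letterCode_eq {p : ℕ} (hD : 0 < D) (hp : p / D % D < letterContent D p) :
    letterCode D (p / D / D * letterContent D p + p / D % D) (letterContent D p) = p := by
  have h1 := Nat.mod_lt p hD
  have h2 : D - letterContent D p = p % D := by
    unfold letterContent
    omega
  unfold letterCode
  rw [mul_comm (p / D / D), Nat.mul_add_div (letterContent_pos hD p), Nat.div_eq_of_lt hp, add_zero,
    Nat.mul_add_mod, Nat.mod_eq_of_lt hp, Nat.div_add_mod', h2, Nat.div_add_mod']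

theorem letterCode_injective {x y s : ℕ} (hs : 1 ≤ s) (hsD : s ≤ D)
    (h : letterCode D x s = letterCode D y s) : x = y := by
  have h1 := letterCode_div_div hs hsD (x := x)
  have h2 := letterCode_div_mod hs hsD (x := x)
  rw [h, letterCode_div_div hs hsD] at h1
  rw [h, letterCode_div_mod hs hsD] at h2
  rw [← Nat.div_add_mod' x s, ← Nat.div_add_mod' y s, h1, h2]

theorem mul_add_lt_mul_add_iff {A B a b : ℕ} (ha : a < D) (hb : b < D) :
    A * D + a < B * D + b ↔ A < B ∨ A = B ∧ a < b := by
  rcases lt_trichotomy A B with h | h | h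
  · have := Nat.mul_le_mul_right D (Nat.succ_le_of_lt h)
    rw [Nat.succ_mul] at this
    constructor
    · exact fun _ => Or.inl h
    · intro _
      omega
  · subst h
    omega
  · have := Nat.mul_le_mul_right D (Nat.succ_le_of_lt h)
    rw [Nat.succ_mul] at this
    constructor
    · intro _
      omega
    · intro _
      omega

/-- Quotients decide first. For equal quotients, since a < s, one has a/s < b/(s+1) exactly when a <
b; at a = b the cell of smaller content has the larger fraction, and the last digit D - s ranks it
higher too. -/
theorem letterCode_lt_letterCode_iff {x y s : ℕ} (hs : 1 ≤ s) (hsD : s + 1 ≤ D) :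
    letterCode D x s < letterCode D y (s + 1) ↔
      (x : ℚ) / (s : ℚ) < (y : ℚ) / ((s + 1 : ℕ) : ℚ) := by
  have hx := Nat.mod_lt x hs
  have hy : y % (s + 1) < s + 1 := Nat.mod_lt y (Nat.succ_pos s)
  have hs0 : (0 : ℚ) < (s : ℚ) := by exact_mod_cast hs
  have hs1 : (0 : ℚ) < ((s + 1 : ℕ) : ℚ) := by exact_mod_cast Nat.succ_pos s
  rw [div_lt_div_iff₀ hs0 hs1]
  have h1 : (x : ℚ) * ((s + 1 : ℕ) : ℚ) < (y : ℚ) * (s : ℚ) ↔ x * (s + 1) < y * s := by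
    exact_mod_cast Iff.rfl
  rw [h1, letterCode, letterCode, mul_add_lt_mul_add_iff (by omega) (by omega),
    mul_add_lt_mul_add_iff (by omega) (by omega)]
  have ex := Nat.div_add_mod' x s
  have ey := Nat.div_add_mod' y (s + 1)
  generalize x / s = A at *
  generalize x % s = a at *
  generalize y / (s + 1) = B at *
  generalize y % (s + 1) = b at *
  subst ex ey
  have h2 : (A < B ∨ A = B ∧ a < b) ↔
      (A * s + a) * (s + 1) < (B * (s + 1) + b) * s := by
    rcases lt_trichotomy A B with h | h | h
    · refine iff_of_true (Or.inl h) ?_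
      have h3 := Nat.mul_le_mul_right (s * (s + 1)) (Nat.succ_le_of_lt h)
      have h4 : a * (s + 1) < s * (s + 1) := Nat.mul_lt_mul_of_pos_right hx (Nat.succ_pos s)
      nlinarith
    · subst h
      have h5 : (A * s + a) * (s + 1) < (A * (s + 1) + b) * s ↔ a * (s + 1) < b * s := by
        constructor <;> intro h <;> nlinarith
      rw [h5]
      constructor
      · rintro (h6 | ⟨-, h6⟩)
        · omega
        · have := Nat.mul_le_mul_right s (Nat.succ_le_of_lt h6)
          nlinarith
      · intro h6
        refine Or.inr ⟨rfl, ?_⟩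
        by_contra h7
        have := Nat.mul_le_mul_right s (not_lt.1 h7)
        nlinarith
    · refine iff_of_false (by omega) (not_lt.2 ?_)
      have h3 := Nat.mul_le_mul_right (s * (s + 1)) (Nat.succ_le_of_lt h)
      have h4 : b * s ≤ s * (s + 1) := by nlinarith
      nlinarith
  rw [← h2]
  omega

/-- The last digit records the content. Thus weak inequalities between adjacent cells also become
strict ones between letters. -/
theorem letterCode_ne_letterCode {x y s : ℕ} (hs : 1 ≤ s) (hsD : s + 1 ≤ D) :
    letterCode D x s ≠ letterCode D y (s + 1) := by
  intro h
  have h1 := letterContent_letterCode (x := x) hs (show s ≤ D by omega)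
  rw [h, letterContent_letterCode (by omega) hsD] at h1
  omega

end Code

theorem shiftedContent_right {n : ℕ} {s t : Fin n × ℕ} (h1 : t.1 = s.1) (h2 : t.2 = s.2 + 1) :
    shiftedContent t = shiftedContent s + 1 := by
  have := s.1.2
  unfold shiftedContent
  rw [h1, h2]
  omega

theorem shiftedContent_below {n : ℕ} {s t : Fin n × ℕ} (h1 : t.1.1 = s.1.1 + 1) (h2 : t.2 = s.2) :
    shiftedContent s = shiftedContent t + 1 := by
  have := t.1.2
  unfold shiftedContent
  omega

theorem shiftedContent_le_partPos {n : ℕ} {lam mu : Par n} (s : Cell lam mu) :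
    shiftedContent s.1 ≤ partPos lam s.1.1 := by
  have := s.1.1.2
  have := s.2.2
  unfold shiftedContent partPos
  omega

/-! ### Convergence of the tableau sums and their exhaustion by finite sets of letters. -/

section Summability

variable {K : Type*} [NormedField K] {q u v : K}

/-- Writing x = ts + r, the sum is geometric in t with ratio |q^s u| ≤ |uq|, over finitely many r;
the power of v is bounded. -/
theorem summable_entry_weight (hq1 : ‖q‖ < 1) (huq : ‖u * q‖ < 1) {s : ℕ} (hs : 1 ≤ s) :
    Summable fun x : ℕ => ‖q ^ x * u ^ (x / s) * v ^ (x / s % 2)‖ := by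
  have hne : NeZero s := ⟨by omega⟩
  have h2 : ‖q ^ s * u‖ < 1 := by
    obtain ⟨s, rfl⟩ : ∃ s', s = s' + 1 := ⟨s - 1, by omega⟩
    rw [show q ^ (s + 1) * u = q ^ s * (u * q) by ring, norm_mul, norm_pow]
    have h3 : ‖q‖ ^ s ≤ 1 := pow_le_one₀ (norm_nonneg _) hq1.le
    calc ‖q‖ ^ s * ‖u * q‖ ≤ 1 * ‖u * q‖ := by gcongr
      _ < 1 := by rwa [one_mul]
  have h3 : Summable fun t : ℕ => ‖q ^ s * u‖ ^ t * max 1 ‖v‖ :=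
    (summable_geometric_of_lt_one (norm_nonneg _) h2).mul_right _
  have h4 : Summable fun r : Fin s => ‖q‖ ^ r.1 := (hasSum_fintype _).summable
  have h5 := h3.mul_of_nonneg h4 (fun t => by positivity) (fun r => by positivity)
  have h6 := (Nat.divModEquiv s).summable_iff.2 h5
  refine Summable.of_nonneg_of_le (fun x => norm_nonneg _) (fun x => ?_) h6
  simp only [Function.comp, Nat.divModEquiv_apply, Fin.val_ofNat]
  have h7 : q ^ x = (q ^ s) ^ (x / s) * q ^ (x % s) := by
    rw [← pow_mul, ← pow_add, Nat.div_add_mod]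
  have h8 : ‖v ^ (x / s % 2)‖ ≤ max 1 ‖v‖ := by
    rcases Nat.mod_two_eq_zero_or_one (x / s) with ht | ht <;> rw [ht] <;> simp
  calc ‖q ^ x * u ^ (x / s) * v ^ (x / s % 2)‖
      = ‖q ^ s * u‖ ^ (x / s) * ‖v ^ (x / s % 2)‖ * ‖q‖ ^ (x % s) := by
        rw [h7]
        simp only [norm_mul, norm_pow, mul_pow]
        ring
    _ ≤ _ := by gcongr

theorem summable_weight [CompleteSpace K] (hq1 : ‖q‖ < 1) (huq : ‖u * q‖ < 1) (R₁ R₂ : ℚ → ℚ → Prop)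
    {n : ℕ} (lam mu : Par n) :
    Summable fun T : LHT R₁ R₂ lam mu => T.weight (fun m => q ^ m) u v := by
  have h1 := summable_norm_prod_apply (g := fun (s : Cell lam mu) (x : ℕ) =>
    q ^ x * u ^ (x / shiftedContent s.1) * v ^ (x / shiftedContent s.1 % 2))
    fun s => summable_entry_weight hq1 huq (shiftedContent_pos s.1)
  exact h1.of_norm.comp_injective (i := fun T : LHT R₁ R₂ lam mu => T.1) Subtype.val_injective

open Filter Topology in
theorem tendsto_sum_letterTableaux [CompleteSpace K] (hq1 : ‖q‖ < 1) (huq : ‖u * q‖ < 1)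
    {R₁ R₂ : ℚ → ℚ → Prop} {r : ℕ → ℕ → Prop} {n : ℕ} {lam mu : Par n} {D : ℕ} (hD : 0 < D)
    (hlam : ∀ i, partPos lam i ≤ D)
    (h₁ : ∀ x y s : ℕ, 1 ≤ s → s + 1 ≤ D → (R₁ ((x : ℚ) / (s : ℚ)) ((y : ℚ) / ((s + 1 : ℕ) : ℚ)) ↔
      r (letterCode D x s) (letterCode D y (s + 1))))
    (h₂ : ∀ x y s : ℕ, 1 ≤ s → s + 1 ≤ D → (R₂ ((x : ℚ) / ((s + 1 : ℕ) : ℚ)) ((y : ℚ) / (s : ℚ)) ↔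
      r (letterCode D x (s + 1)) (letterCode D y s))) :
    Tendsto (fun t => ∑ G ∈ letterTableaux r (letterContent D) (t * D * D) lam mu,
      ∏ s, letterWeight q u v D (G s)) atTop
      (𝓝 (lectureHallSchur R₁ R₂ (fun m => q ^ m) u v lam mu)) := by
  classical
  have hsD : ∀ s : Cell lam mu, shiftedContent s.1 ≤ D := fun s =>
    (shiftedContent_le_partPos s).trans (hlam _)
  have hs1 : ∀ s : Cell lam mu, 1 ≤ shiftedContent s.1 := fun s => shiftedContent_pos _
  have hvalid : ∀ T : Cell lam mu → ℕ, ((∀ s t : Cell lam mu, t.1.1 = s.1.1 → t.1.2 = s.1.2 + 1 →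
      R₁ ((T s : ℚ) / (shiftedContent s.1 : ℚ)) ((T t : ℚ) / (shiftedContent t.1 : ℚ))) ∧
      (∀ s t : Cell lam mu, t.1.1.1 = s.1.1.1 + 1 → t.1.2 = s.1.2 →
      R₂ ((T s : ℚ) / (shiftedContent s.1 : ℚ)) ((T t : ℚ) / (shiftedContent t.1 : ℚ)))) ↔
      ((∀ s t : Cell lam mu, t.1.1 = s.1.1 → t.1.2 = s.1.2 + 1 →
      r (letterCode D (T s) (shiftedContent s.1)) (letterCode D (T t) (shiftedContent t.1))) ∧
      (∀ s t : Cell lam mu, t.1.1.1 = s.1.1.1 + 1 → t.1.2 = s.1.2 →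
      r (letterCode D (T s) (shiftedContent s.1)) (letterCode D (T t) (shiftedContent t.1)))) := by
    intro T
    refine and_congr (forall_congr' fun s => forall_congr' fun t => forall_congr' fun e1 =>
      forall_congr' fun e2 => ?_) (forall_congr' fun s => forall_congr' fun t =>
      forall_congr' fun e1 => forall_congr' fun e2 => ?_)
    · have h := hsD t
      rw [shiftedContent_right e1 e2] at h ⊢
      exact h₁ _ _ _ (hs1 s) h
    · have h := hsD s
      rw [shiftedContent_below e1 e2] at h ⊢
      exact h₂ _ _ _ (hs1 t) h
  -- Tableaux with all quotients below t; they exhaust the lecture hall tableaux and match the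
  -- letter tableaux with the first t D² letters.
  let F : ℕ → Finset (LHT R₁ R₂ lam mu) := fun t =>
    (Fintype.piFinset fun s : Cell lam mu => range (t * shiftedContent s.1)).preimage
      (fun T : LHT R₁ R₂ lam mu => T.1) Subtype.val_injective.injOn
  have hF : ∀ t T, T ∈ F t ↔ ∀ s, T.1 s < t * shiftedContent s.1 := by
    intro t T
    refine Finset.mem_preimage.trans (Fintype.mem_piFinset.trans ?_)
    simp only [mem_range]
  have hlim : Tendsto F atTop atTop := by
    refine tendsto_atTop_finset_of_monotone (fun t t' h T hT => ?_) fun T => ?_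
    · rw [hF] at hT ⊢
      exact fun s => (hT s).trans_le (Nat.mul_le_mul_right _ h)
    · refine ⟨∑ s, T.1 s + 1, (hF _ _).2 fun s => ?_⟩
      have h1 : T.1 s ≤ ∑ s, T.1 s :=
        single_le_sum (f := T.1) (fun _ _ => Nat.zero_le _) (mem_univ s)
      have h2 := Nat.mul_le_mul_left (∑ s, T.1 s + 1) (hs1 s)
      omega
  refine ((summable_weight hq1 huq R₁ R₂ lam mu).hasSum.comp hlim).congr fun t => ?_
  refine sum_of_injOn (fun T s => letterCode D (T.1 s) (shiftedContent s.1)) ?_ ?_ ?_ ?_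
  · intro T _ T' _ h
    refine Subtype.ext (funext fun s => ?_)
    exact letterCode_injective (hs1 s) (hsD s) (congrFun h s)
  · intro T hT
    rw [mem_coe, hF] at hT
    rw [mem_coe, mem_letterTableaux]
    refine ⟨fun s => (letterCode_lt_iff (hs1 s) (hsD s)).2 (hT s),
      fun s => letterContent_letterCode (hs1 s) (hsD s), (hvalid T.1).1 T.2⟩
  -- A letter with r ≥ s represents no entry and has weight zero, so fillings outside the image
  -- contribute nothing.
  · intro G hG hG'
    by_contra hne
    rw [← ne_eq, prod_ne_zero_iff] at hne
    apply hG'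
    rw [mem_letterTableaux] at hG
    obtain ⟨g1, g2, g3⟩ := hG
    have hw : ∀ s, G s / D % D < shiftedContent s.1 := by
      intro s
      by_contra hcon
      refine hne s (mem_univ s) ?_
      rw [letterWeight, g2, if_neg hcon]
    let T : Cell lam mu → ℕ := fun s => G s / D / D * shiftedContent s.1 + G s / D % D
    have hT : ∀ s, letterCode D (T s) (shiftedContent s.1) = G s := by
      intro s
      have h := exists_letterCode_eq hD (p := G s)
      rw [g2] at h
      exact h (hw s)
    have hTv := (hvalid T).2 (by simpa only [hT] using g3)
    let T' : LHT R₁ R₂ lam mu := ⟨T, hTv⟩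
    refine ⟨T', ?_, funext hT⟩
    rw [mem_coe, hF]
    intro s
    rw [← letterCode_lt_iff (hs1 s) (hsD s)]
    change letterCode D (T s) _ < _
    rw [hT]
    exact g1 s
  · intro T _
    refine prod_congr rfl fun s _ => ?_
    rw [letterWeight_letterCode q u v (hs1 s) (hsD s)]

end Summability

/-! ### The orthogonality functional in one variable -/

/-! ### The q-binomial series and its functional equation. -/

section Series

open Filter Topology

variable {K : Type*} [NormedField K] {q : K}

theorem summable_qBinomialSeries (hq1 : ‖q‖ < 1) (B : K) {z : K} (hz : ‖z‖ < 1) :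
    Summable fun k : ℕ => ‖qPoch B q k / qPoch q q k * z ^ k‖ := by
  have h1 : Tendsto (fun k : ℕ => ‖(1 - B * q ^ k) / (1 - q ^ (k + 1)) * z‖) atTop (𝓝 ‖z‖) := by
    have h2 := tendsto_pow_atTop_nhds_zero_of_norm_lt_one hq1
    have h3 : Tendsto (fun k : ℕ => (1 - B * q ^ k) / (1 - q ^ (k + 1)) * z) atTop
        (𝓝 ((1 - B * 0) / (1 - 0) * z)) :=
      (((h2.const_mul B).const_sub 1).div (((tendsto_add_atTop_iff_nat 1).2 h2).const_sub 1)
        (by simp)).mul_const z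
    simpa using h3.norm
  obtain ⟨r, hr1, hr2⟩ := exists_between hz
  refine summable_of_ratio_norm_eventually_le hr2 ?_
  filter_upwards [h1.eventually_lt_const hr1] with k hk
  have h4 := one_sub_pow_ne_zero hq1 _ (Nat.succ_pos k)
  have h5 : qPoch B q (k + 1) / qPoch q q (k + 1) * z ^ (k + 1) =
      (1 - B * q ^ k) / (1 - q ^ (k + 1)) * z * (qPoch B q k / qPoch q q k * z ^ k) := by
    rw [qPoch_succ, qPoch_succ, ← pow_succ' q k]
    have := qPoch_self_ne_zero (one_sub_pow_ne_zero hq1) k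
    field_simp
    ring
  rw [norm_norm, norm_norm, h5, norm_mul]
  gcongr

variable [CompleteSpace K]

/-- The termwise difference of the series at z and zq loses its constant term and the factor 1 -
q^(k+1); shifting the index gives back multiples of the two series. -/
theorem tsum_qBinomialSeries_mul (hq1 : ‖q‖ < 1) (B : K) {z : K} (hz : ‖z‖ < 1) :
    (1 - z) * ∑' k : ℕ, qPoch B q k / qPoch q q k * z ^ k =
      (1 - B * z) * ∑' k : ℕ, qPoch B q k / qPoch q q k * (z * q) ^ k := by
  have hzq : ‖z * q‖ < 1 := by
    rw [norm_mul]
    exact mul_lt_one_of_nonneg_of_lt_one_left (norm_nonneg _) hz hq1.le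
  have s1 := (summable_qBinomialSeries hq1 B hz).of_norm
  have s2 := (summable_qBinomialSeries hq1 B hzq).of_norm
  have h1 : ∑' k : ℕ, (qPoch B q k / qPoch q q k * z ^ k -
      qPoch B q k / qPoch q q k * (z * q) ^ k) =
      ∑' k : ℕ, (z * (qPoch B q k / qPoch q q k * z ^ k) -
        B * z * (qPoch B q k / qPoch q q k * (z * q) ^ k)) := by
    rw [(s1.sub s2).tsum_eq_zero_add]
    simp only [qPoch_zero, pow_zero, sub_self, zero_add]
    refine tsum_congr fun k => ?_
    have h4 := one_sub_pow_ne_zero hq1 _ (Nat.succ_pos k)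
    have := qPoch_self_ne_zero (one_sub_pow_ne_zero hq1) k
    rw [qPoch_succ, qPoch_succ, ← pow_succ' q k]
    field_simp
    ring
  rw [s1.tsum_sub s2, (s1.mul_left z).tsum_sub (s2.mul_left (B * z)), tsum_mul_left,
    tsum_mul_left] at h1
  linear_combination h1

theorem qPoch_mul_tsum_qBinomialSeries (hq1 : ‖q‖ < 1) (B : K) {z : K} (hz : ‖z‖ < 1) (N : ℕ) :
    qPoch z q N * ∑' k : ℕ, qPoch B q k / qPoch q q k * z ^ k =
      qPoch (B * z) q N * ∑' k : ℕ, qPoch B q k / qPoch q q k * (z * q ^ N) ^ k := by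
  induction N with
  | zero => simp [qPoch_zero]
  | succ N ih =>
    have hzq : ‖z * q ^ N‖ < 1 := by
      rw [norm_mul, norm_pow]
      exact mul_lt_one_of_nonneg_of_lt_one_left (norm_nonneg _) hz
        (pow_le_one₀ (norm_nonneg _) hq1.le)
    have h := tsum_qBinomialSeries_mul hq1 B hzq
    rw [qPoch_succ, qPoch_succ, pow_succ, ← mul_assoc z]
    linear_combination (1 - z * q ^ N) * ih + qPoch (B * z) q N * h

/-- A zero at z would propagate to every z q^N, whereas the values there tend to the constant term
1. -/
theorem tsum_qBinomialSeries_ne_zero (hq1 : ‖q‖ < 1) (B : K) {z : K} (hz : ‖z‖ < 1)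
    (hB : ∀ j : ℕ, 1 - B * z * q ^ j ≠ 0) :
    ∑' k : ℕ, qPoch B q k / qPoch q q k * z ^ k ≠ 0 := by
  intro h0
  have h1 : ∀ N, ∑' k : ℕ, qPoch B q k / qPoch q q k * (z * q ^ N) ^ k = 0 := by
    intro N
    have h := qPoch_mul_tsum_qBinomialSeries hq1 B hz N
    rw [h0, mul_zero] at h
    exact (mul_eq_zero.1 h.symm).resolve_left (qPoch_ne_zero N fun j _ => hB j)
  have h2 : Tendsto (fun N : ℕ => ∑' k : ℕ, qPoch B q k / qPoch q q k * (z * q ^ N) ^ k) atTop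
      (𝓝 (∑' k : ℕ, if k = 0 then (1 : K) else 0)) := by
    refine tendsto_tsum_of_dominated_convergence (summable_qBinomialSeries hq1 B hz) (fun k => ?_)
      (Eventually.of_forall fun N k => ?_)
    · have h3 : Tendsto (fun N : ℕ => (z * q ^ N) ^ k) atTop (𝓝 ((z * 0) ^ k)) :=
        ((tendsto_pow_atTop_nhds_zero_of_norm_lt_one hq1).const_mul z).pow k
      have h4 := h3.const_mul (qPoch B q k / qPoch q q k)
      convert h4 using 2
      by_cases hk : k = 0
      · subst hk
        simp [qPoch_zero]
      · simp [hk]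
    · rw [norm_mul, norm_mul]
      gcongr
      rw [norm_pow, norm_pow, norm_mul, norm_pow]
      gcongr
      exact mul_le_of_le_one_right (norm_nonneg _) (pow_le_one₀ (norm_nonneg _) hq1.le)
  simp only [h1, tsum_ite_eq] at h2
  exact zero_ne_one (tendsto_nhds_unique tendsto_const_nhds h2)

end Series

/-- The one-variable functional of the little `q`-Jacobi polynomials. -/
noncomputable def littleFunctional {K : Type*} [NormedField K] (a b q : K) (p : Polynomial K) : K :=
  ∑' k : ℕ, qPoch (b * q) q k / qPoch q q k * (a * q) ^ k * p.eval (q ^ k)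

/-! ### Moments, orthogonality and norms in one variable. -/

section Functional

variable {K : Type*} [NormedField K] {a b q : K}

theorem summable_littleFunctional (hq1 : ‖q‖ < 1) (haq : ‖a * q‖ < 1) (p : Polynomial K) :
    Summable fun k : ℕ => ‖qPoch (b * q) q k / qPoch q q k * (a * q) ^ k * p.eval (q ^ k)‖ := by
  induction p using Polynomial.induction_on' with
  | add p r hp hr =>
    refine Summable.of_nonneg_of_le (fun k => norm_nonneg _) (fun k => ?_) (hp.add hr)
    rw [Polynomial.eval_add, mul_add]
    exact norm_add_le _ _
  | monomial j c =>
    refine Summable.of_nonneg_of_le (fun k => norm_nonneg _) (fun k => ?_)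
      ((summable_qBinomialSeries hq1 (b * q) haq).mul_right ‖c‖)
    rw [Polynomial.eval_monomial, norm_mul _ (c * _), norm_mul c]
    gcongr
    rw [norm_pow, norm_pow]
    exact mul_le_of_le_one_right (norm_nonneg _)
      (pow_le_one₀ (pow_nonneg (norm_nonneg _) _) (pow_le_one₀ (norm_nonneg _) hq1.le))

theorem littleFunctional_X_pow (j : ℕ) : littleFunctional a b q (Polynomial.X ^ j) =
    ∑' k : ℕ, qPoch (b * q) q k / qPoch q q k * (a * q * q ^ j) ^ k := by
  refine tsum_congr fun k => ?_
  rw [Polynomial.eval_pow, Polynomial.eval_X, mul_pow _ (q ^ j), ← pow_mul, ← pow_mul, mul_comm j k,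
    mul_assoc]

/-- On x^d the sum is (x-1)(x-q)⋯(x-q^(m-1)) at x = q^d, which is zero for d < m: an m-th order
q-difference kills lower degrees. -/
theorem sum_fallCoeff_mul_eval (hq : ∀ j : ℕ, 1 ≤ j → 1 - q ^ j ≠ 0) {m : ℕ} {p : Polynomial K}
    (hp : p.natDegree < m) : ∑ i ∈ range (m + 1), fallCoeff q m i * p.eval (q ^ i) = 0 := by
  simp_rw [Polynomial.eval_eq_sum_range, mul_sum]
  rw [sum_comm]
  refine sum_eq_zero fun d hd => ?_
  have h1 : ∀ i ∈ range (m + 1), fallCoeff q m i * (p.coeff d * (q ^ i) ^ d) =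
      p.coeff d * ((-1) ^ (m - i) * q ^ (m - i).choose 2 * gaussBinom q m i * (q ^ d) ^ i) := by
    intro i hi
    rw [fallCoeff, if_pos (Nat.lt_succ_iff.1 (mem_range.1 hi)), ← pow_mul, ← pow_mul, mul_comm d i]
    ring
  rw [sum_congr rfl h1, ← mul_sum, sum_gaussBinom_mul_pow hq, qShiftProd,
    prod_eq_zero (i := d) (mem_range.2 (by have := mem_range.1 hd; omega)) (by simp), mul_zero]

/-- `(αx; q)_n` as a polynomial in `x`. -/
noncomputable def qPochPoly (α q : K) (n : ℕ) : Polynomial K :=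
  ∏ j ∈ range n, (1 - Polynomial.C (α * q ^ j) * Polynomial.X)

theorem eval_qPochPoly (α x : K) (n : ℕ) : (qPochPoly α q n).eval x = qPoch (α * x) q n := by
  rw [qPochPoly, Polynomial.eval_prod, qPoch]
  refine prod_congr rfl fun j _ => ?_
  simp only [Polynomial.eval_sub, Polynomial.eval_one, Polynomial.eval_mul, Polynomial.eval_C,
    Polynomial.eval_X]
  ring

theorem natDegree_qPochPoly_le (α : K) (n : ℕ) : (qPochPoly α q n).natDegree ≤ n := by
  refine (Polynomial.natDegree_prod_le _ _).trans ?_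
  calc ∑ j ∈ range n, (1 - Polynomial.C (α * q ^ j) * Polynomial.X).natDegree
      ≤ ∑ _j ∈ range n, 1 := by
        refine sum_le_sum fun j _ => (Polynomial.natDegree_sub_le _ _).trans ?_
        rw [Polynomial.natDegree_one]
        exact max_le (Nat.zero_le _)
          ((Polynomial.natDegree_C_mul_le (α * q ^ j) Polynomial.X).trans Polynomial.natDegree_X_le)
    _ = n := by simp

/-- Multiplication by x - q^m. -/
theorem fallCoeff_succ_succ (hq : ∀ j : ℕ, 1 ≤ j → 1 - q ^ j ≠ 0) (m i : ℕ) :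
    fallCoeff q (m + 1) (i + 1) = fallCoeff q m i - q ^ m * fallCoeff q m (i + 1) := by
  unfold fallCoeff
  rcases lt_trichotomy m i with h | h | h
  · rw [if_neg (by omega), if_neg (by omega), if_neg (by omega)]
    ring
  · subst h
    rw [if_pos le_rfl, if_pos le_rfl, if_neg (by omega)]
    simp [gaussBinom_self hq]
  · obtain ⟨d, rfl⟩ : ∃ d, m = i + d + 1 := ⟨m - i - 1, by omega⟩
    rw [if_pos (by omega), if_pos (by omega), if_pos (by omega), gaussBinom_succ_succ' hq,
      show i + d + 1 + 1 - (i + 1) = d + 1 by omega, show i + d + 1 - i = d + 1 by omega,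
      show i + d + 1 - (i + 1) = d by omega, choose_two_succ]
    ring

theorem fallCoeff_succ_zero (hq : ∀ j : ℕ, 1 ≤ j → 1 - q ^ j ≠ 0) (m : ℕ) :
    fallCoeff q (m + 1) 0 = -(q ^ m * fallCoeff q m 0) := by
  unfold fallCoeff
  rw [if_pos (by omega), if_pos (by omega), gaussBinom_zero_right hq, gaussBinom_zero_right hq,
    Nat.sub_zero, Nat.sub_zero, choose_two_succ]
  ring

/-- The recursion for `fallCoeff` expresses the sum for m + 1 at c by those for m at cq and at c,
hence the induction for all c at once. -/
theorem sum_fallCoeff_div (hq : ∀ j : ℕ, 1 ≤ j → 1 - q ^ j ≠ 0) (m : ℕ) : ∀ c : K,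
    (∀ j : ℕ, 1 - c * q ^ j ≠ 0) →
    ∑ i ∈ range (m + 1), fallCoeff q m i / (1 - c * q ^ i) =
      (-1) ^ m * c ^ m * q ^ m.choose 2 * qPoch q q m / qPoch c q (m + 1) := by
  induction m with
  | zero =>
    intro c _
    simp [fallCoeff, qPoch_zero, qPoch_succ, gaussBinom_self hq]
  | succ m ih =>
    intro c hc
    have h1 : ∑ i ∈ range (m + 1 + 1), fallCoeff q (m + 1) i / (1 - c * q ^ i) =
        ∑ i ∈ range (m + 1), fallCoeff q m i / (1 - c * q * q ^ i) -
          q ^ m * ∑ i ∈ range (m + 1), fallCoeff q m i / (1 - c * q ^ i) := by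
      rw [sum_range_succ', fallCoeff_succ_zero hq, sum_congr rfl fun i _ => by
        rw [fallCoeff_succ_succ hq m i], sum_range_succ' (fun i => fallCoeff q m i /
          (1 - c * q ^ i)) m]
      simp_rw [sub_div, mul_div_assoc]
      rw [sum_sub_distrib, ← mul_sum, sum_range_succ (fun i => fallCoeff q m (i + 1) /
          (1 - c * q ^ (i + 1))) m]
      have h2 : fallCoeff q m (m + 1) = 0 := by rw [fallCoeff, if_neg (by omega)]
      have h3 : ∀ i : ℕ, c * q * q ^ i = c * q ^ (i + 1) := fun i => by ring
      simp_rw [h3, h2]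
      ring
    rw [h1, ih c hc, ih (c * q) fun j => by
      have := hc (j + 1)
      rwa [pow_succ', ← mul_assoc] at this]
    have n1 : qPoch c q (m + 1 + 1) ≠ 0 := qPoch_ne_zero _ fun j _ => hc j
    have e1 := qPoch_succ c q (m + 1)
    have e2 := qPoch_succ_left c q (m + 1)
    have n2 : qPoch c q (m + 1) ≠ 0 := qPoch_ne_zero _ fun j _ => hc j
    have n3 : qPoch (c * q) q (m + 1) ≠ 0 := right_ne_zero_of_mul (e2 ▸ n1)
    have n4 : 1 - c ≠ 0 := left_ne_zero_of_mul (e2 ▸ n1)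
    have n5 := hc (m + 1)
    have e3 : qPoch c q (m + 1) = (1 - c) * qPoch (c * q) q (m + 1) / (1 - c * q ^ (m + 1)) := by
      rw [eq_div_iff n5, ← e1, e2]
    rw [e2, e3, qPoch_succ q q m, choose_two_succ]
    field_simp
    ring

theorem natDegree_littleQJacobi_le (hq0 : q ≠ 0) (hq1 : ‖q‖ < 1)
    (ha : ∀ j : ℕ, 1 ≤ j → 1 - a * q ^ j ≠ 0) (hab : ∀ j : ℕ, 2 ≤ j → 1 - a * b * q ^ j ≠ 0)
    (m : ℕ) : (littleQJacobi a b q m).natDegree ≤ m := by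
  rw [littleQJacobi_eq_sum hq0 (one_sub_pow_ne_zero hq1) ha hab]
  refine Polynomial.natDegree_sum_le_of_forall_le _ _ fun k hk => ?_
  exact (Polynomial.natDegree_C_mul_X_pow_le _ _).trans (Nat.lt_succ_iff.1 (mem_range.1 hk))

theorem coeff_littleQJacobi_self (hq0 : q ≠ 0) (hq1 : ‖q‖ < 1)
    (ha : ∀ j : ℕ, 1 ≤ j → 1 - a * q ^ j ≠ 0) (hab : ∀ j : ℕ, 2 ≤ j → 1 - a * b * q ^ j ≠ 0)
    (m : ℕ) : (littleQJacobi a b q m).coeff m = 1 := by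
  rw [littleQJacobi_eq_sum hq0 (one_sub_pow_ne_zero hq1) ha hab]
  simp [Polynomial.finsetSum_coeff, Polynomial.coeff_X_pow,
    jacobiCoeff_self (one_sub_pow_ne_zero hq1)]

variable [CompleteSpace K]

theorem littleFunctional_sum (hq1 : ‖q‖ < 1) (haq : ‖a * q‖ < 1) {ι : Type*} (S : Finset ι)
    (c : ι → K) (p : ι → Polynomial K) :
    littleFunctional a b q (∑ i ∈ S, Polynomial.C (c i) * p i) =
      ∑ i ∈ S, c i * littleFunctional a b q (p i) := by
  unfold littleFunctional
  simp only [← tsum_mul_left]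
  rw [← Summable.tsum_finsetSum fun i _ =>
    ((summable_littleFunctional hq1 haq (p i)).of_norm).mul_left (c i)]
  refine tsum_congr fun k => ?_
  rw [Polynomial.eval_finsetSum, mul_sum]
  refine sum_congr rfl fun i _ => ?_
  rw [Polynomial.eval_mul, Polynomial.eval_C]
  ring

theorem moment_mul_qPoch (hq1 : ‖q‖ < 1) (haq : ‖a * q‖ < 1) (j : ℕ) :
    littleFunctional a b q (Polynomial.X ^ j) * qPoch (a * b * q ^ 2) q j =
      qPoch (a * q) q j * littleFunctional a b q 1 := by
  rw [← pow_zero Polynomial.X, littleFunctional_X_pow, littleFunctional_X_pow, pow_zero, mul_one]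
  have h := qPoch_mul_tsum_qBinomialSeries hq1 (b * q) haq j
  rw [h, show b * q * (a * q) = a * b * q ^ 2 by ring]
  ring

/-- Over the common denominator (abq²; q)_(2m-1), the sum over coefficients times moments becomes
`fallCoeff` against a polynomial in q^i of degree at most m - 1. -/
theorem littleFunctional_X_pow_mul_eq_zero (hq0 : q ≠ 0) (hq1 : ‖q‖ < 1) (haq : ‖a * q‖ < 1)
    (ha : ∀ j : ℕ, 1 ≤ j → 1 - a * q ^ j ≠ 0) (hab : ∀ j : ℕ, 2 ≤ j → 1 - a * b * q ^ j ≠ 0)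
    {j m : ℕ} (hj : j < m) :
    littleFunctional a b q (Polynomial.X ^ j * littleQJacobi a b q m) = 0 := by
  have hq := one_sub_pow_ne_zero hq1
  rw [littleQJacobi_eq_sum hq0 hq ha hab, mul_sum]
  have h1 : ∀ k ∈ range (m + 1), Polynomial.X ^ j *
      (Polynomial.C (jacobiCoeff a b q m k) * Polynomial.X ^ k) =
      Polynomial.C (jacobiCoeff a b q m k) * Polynomial.X ^ (k + j) := fun k _ => by ring
  rw [sum_congr rfl h1, littleFunctional_sum hq1 haq]
  have hne : ∀ s n : ℕ, 2 ≤ s → qPoch (a * b * q ^ s) q n ≠ 0 := fun s n hs =>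
    qPoch_ne_zero n fun i _ => by
      rw [mul_assoc, ← pow_add]
      exact hab _ (by omega)
  have h2 : ∀ i ∈ range (m + 1), jacobiCoeff a b q m i *
      littleFunctional a b q (Polynomial.X ^ (i + j)) =
      qPoch (a * q) q m * littleFunctional a b q 1 / qPoch (a * b * q ^ 2) q (2 * m - 1) *
        (fallCoeff q m i * (qPochPoly (a * q) q j * qPochPoly (a * b * q ^ (2 + j)) q
          (m - 1 - j)).eval (q ^ i)) := by
    intro i hi
    have hi' : i ≤ m := Nat.lt_succ_iff.1 (mem_range.1 hi)
    have hm := moment_mul_qPoch (b := b) hq1 haq (i + j)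
    have e1 : qPoch (a * q) q m = qPoch (a * q) q i * qPoch (a * q ^ (i + 1)) q (m - i) := by
      conv_lhs => rw [← Nat.add_sub_cancel' hi']
      rw [qPoch_add, mul_assoc a, ← pow_succ']
    have e2 : qPoch (a * q) q (i + j) = qPoch (a * q) q i * qPoch (a * q ^ (i + 1)) q j := by
      rw [qPoch_add, mul_assoc a, ← pow_succ']
    have e3 : qPoch (a * b * q ^ 2) q (2 * m - 1) = qPoch (a * b * q ^ 2) q (i + j) *
        qPoch (a * b * q ^ (2 + j + i)) q (m - 1 - j) * qPoch (a * b * q ^ (m + i + 1)) q (m - i) := by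
      rw [show 2 * m - 1 = (i + j) + (m - 1 - j) + (m - i) by omega, qPoch_add, qPoch_add,
        mul_assoc (a * b), mul_assoc (a * b), ← pow_add, ← pow_add,
        show 2 + (i + j) = 2 + j + i by ring,
        show 2 + (i + j + (m - 1 - j)) = m + i + 1 by omega]
    rw [Polynomial.eval_mul, eval_qPochPoly, eval_qPochPoly, mul_assoc (a * b), ← pow_add,
      show a * q * q ^ i = a * q ^ (i + 1) by ring, e1, e3, jacobiCoeff]
    have n1 := hne 2 (i + j) le_rfl
    have n2 := hne (2 + j + i) (m - 1 - j) (by omega)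
    have n3 := hne (m + i + 1) (m - i) (by omega)
    rw [e2] at hm
    field_simp
    linear_combination (fallCoeff q m i * qPoch (a * q ^ (i + 1)) q (m - i)) * hm
  rw [sum_congr rfl h2, ← mul_sum, sum_fallCoeff_mul_eval hq, mul_zero]
  have h3 := natDegree_qPochPoly_le (q := q) (a * q) j
  have h4 := natDegree_qPochPoly_le (q := q) (a * b * q ^ (2 + j)) (m - 1 - j)
  have h5 := Polynomial.natDegree_mul_le (p := qPochPoly (a * q) q j)
    (q := qPochPoly (a * b * q ^ (2 + j)) q (m - 1 - j))
  omega

theorem littleFunctional_mul_littleQJacobi (hq0 : q ≠ 0) (hq1 : ‖q‖ < 1) (haq : ‖a * q‖ < 1)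
    (ha : ∀ j : ℕ, 1 ≤ j → 1 - a * q ^ j ≠ 0) (hab : ∀ j : ℕ, 2 ≤ j → 1 - a * b * q ^ j ≠ 0)
    {m : ℕ} {p : Polynomial K} (hp : p.natDegree ≤ m) :
    littleFunctional a b q (p * littleQJacobi a b q m) =
      p.coeff m * littleFunctional a b q (Polynomial.X ^ m * littleQJacobi a b q m) := by
  conv_lhs => rw [Polynomial.as_sum_range_C_mul_X_pow' p (Nat.lt_succ_of_le hp)]
  simp_rw [sum_mul, mul_assoc]
  rw [littleFunctional_sum hq1 haq, sum_range_succ, sum_eq_zero, zero_add]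
  intro j hj
  rw [littleFunctional_X_pow_mul_eq_zero hq0 hq1 haq ha hab (mem_range.1 hj), mul_zero]

/-- By orthogonality it suffices that some polynomial of degree at most m pairs nontrivially with
the m-th one. The choice (bqx; q)_m makes the pairing computable, since it merely replaces b by b
q^m in the weight. -/
theorem littleFunctional_littleQJacobi_sq_ne_zero (hq0 : q ≠ 0) (hq1 : ‖q‖ < 1) (haq : ‖a * q‖ < 1)
    (ha : ∀ j : ℕ, 1 ≤ j → 1 - a * q ^ j ≠ 0) (hb : ∀ j : ℕ, 1 ≤ j → 1 - b * q ^ j ≠ 0)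
    (hab : ∀ j : ℕ, 2 ≤ j → 1 - a * b * q ^ j ≠ 0) (ha0 : a ≠ 0) (hb0 : b ≠ 0) (m : ℕ) :
    littleFunctional a b q (Polynomial.X ^ m * littleQJacobi a b q m) ≠ 0 := by
  have hq := one_sub_pow_ne_zero hq1
  have hseries : ∀ B : K, (∀ j : ℕ, 1 - B * (a * q) * q ^ j ≠ 0) →
      ∑' k : ℕ, qPoch B q k / qPoch q q k * (a * q) ^ k ≠ 0 := fun B hB =>
    tsum_qBinomialSeries_ne_zero hq1 B haq hB
  -- For m = 0 the general argument would need 1 - abq to be nonzero, which is not available.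
  rcases Nat.eq_zero_or_pos m with h0 | hm
  · subst h0
    rw [littleQJacobi_eq_sum hq0 hq ha hab]
    simp only [zero_add, range_one, sum_singleton, jacobiCoeff_self hq, pow_zero, mul_one, map_one]
    rw [← pow_zero Polynomial.X, littleFunctional_X_pow, pow_zero, mul_one]
    refine hseries _ fun j => ?_
    rw [show b * q * (a * q) * q ^ j = a * b * q ^ (j + 2) by ring]
    exact hab _ (by omega)
  · intro hzero
    have h1 := littleFunctional_mul_littleQJacobi hq0 hq1 haq ha hab
      (natDegree_qPochPoly_le (q := q) (b * q) m)
    rw [hzero, mul_zero, littleQJacobi_eq_sum hq0 hq ha hab, mul_sum] at h1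
    have h2 : ∀ k ∈ range (m + 1), qPochPoly (b * q) q m *
        (Polynomial.C (jacobiCoeff a b q m k) * Polynomial.X ^ k) =
        Polynomial.C (jacobiCoeff a b q m k) * (qPochPoly (b * q) q m * Polynomial.X ^ k) :=
      fun k _ => by ring
    rw [sum_congr rfl h2, littleFunctional_sum hq1 haq] at h1
    set ν : K := ∑' k : ℕ, qPoch (b * q * q ^ m) q k / qPoch q q k * (a * q) ^ k with hν
    have hν0 : ν ≠ 0 := hseries _ fun j => by
      rw [show b * q * q ^ m * (a * q) * q ^ j = a * b * q ^ (m + j + 2) by ring]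
      exact hab _ (by omega)
    have h3 : ∀ i, littleFunctional a b q (qPochPoly (b * q) q m * Polynomial.X ^ i) =
        qPoch (b * q) q m *
          ∑' k : ℕ, qPoch (b * q * q ^ m) q k / qPoch q q k * (a * q * q ^ i) ^ k := by
      intro i
      rw [littleFunctional, ← tsum_mul_left]
      refine tsum_congr fun k => ?_
      rw [Polynomial.eval_mul, eval_qPochPoly, Polynomial.eval_pow, Polynomial.eval_X]
      have e1 := qPoch_add (b * q) q k m
      have e2 := qPoch_add (b * q) q m k
      rw [add_comm, e2] at e1
      rw [mul_pow _ (q ^ i), ← pow_mul, ← pow_mul, mul_comm i k]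
      linear_combination (-((a * q) ^ k * q ^ (k * i) / qPoch q q k)) * e1
    have hne : ∀ s n : ℕ, 2 ≤ s → qPoch (a * b * q ^ s) q n ≠ 0 := fun s n hs =>
      qPoch_ne_zero n fun i _ => by
        rw [mul_assoc, ← pow_add]
        exact hab _ (by omega)
    have hc : ∀ j : ℕ, 1 - a * b * q ^ (m + 1) * q ^ j ≠ 0 := fun j => by
      rw [mul_assoc, ← pow_add]
      exact hab _ (by omega)
    -- All dependence on i apart from `fallCoeff` cancels except one linear denominator, so the sum
    -- is the partial fraction sum of `sum_fallCoeff_div`.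
    have h4 : ∀ i ∈ range (m + 1), jacobiCoeff a b q m i *
        littleFunctional a b q (qPochPoly (b * q) q m * Polynomial.X ^ i) =
        qPoch (b * q) q m * qPoch (a * q) q m * ν * (1 - a * b * q ^ (2 * m + 1)) /
          qPoch (a * b * q ^ (m + 2)) q m *
          (fallCoeff q m i / (1 - a * b * q ^ (m + 1) * q ^ i)) := by
      intro i hi
      have hi' : i ≤ m := Nat.lt_succ_iff.1 (mem_range.1 hi)
      have e1 : qPoch (a * q) q m = qPoch (a * q) q i * qPoch (a * q ^ (i + 1)) q (m - i) := by
        conv_lhs => rw [← Nat.add_sub_cancel' hi']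
        rw [qPoch_add, mul_assoc a, ← pow_succ']
      have e2 := qPoch_mul_tsum_qBinomialSeries hq1 (b * q * q ^ m) haq i
      rw [← hν, show b * q * q ^ m * (a * q) = a * b * q ^ (m + 2) by ring] at e2
      have e3 : qPoch (a * b * q ^ (m + 2)) q m = qPoch (a * b * q ^ (m + 2)) q i *
          qPoch (a * b * q ^ (m + i + 2)) q (m - i) := by
        conv_lhs => rw [← Nat.add_sub_cancel' hi']
        rw [qPoch_add, mul_assoc (a * b), ← pow_add, Nat.add_sub_cancel' hi',
          show m + 2 + i = m + i + 2 by ring]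
      have e4 : qPoch (a * b * q ^ (m + i + 1)) q (m - i) * (1 - a * b * q ^ (2 * m + 1)) =
          (1 - a * b * q ^ (m + 1) * q ^ i) * qPoch (a * b * q ^ (m + i + 2)) q (m - i) := by
        have e5 := qPoch_succ (a * b * q ^ (m + i + 1)) q (m - i)
        rw [qPoch_succ_left, mul_assoc (a * b), ← pow_succ, mul_assoc (a * b), ← pow_add,
          show m + i + 1 + (m - i) = 2 * m + 1 by omega] at e5
        rw [← e5, mul_assoc (a * b), ← pow_add, show m + 1 + i = m + i + 1 by ring]
      have n1 := hne (m + 2) i (by omega)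
      have n2 := hne (m + i + 2) (m - i) (by omega)
      have n3 := hne (m + i + 1) (m - i) (by omega)
      have n4 := hc i
      have e6 : 1 - a * b * q ^ (2 * m + 1) = (1 - a * b * q ^ (m + 1) * q ^ i) *
          qPoch (a * b * q ^ (m + i + 2)) q (m - i) / qPoch (a * b * q ^ (m + i + 1)) q (m - i) := by
        rw [eq_div_iff n3, ← e4]
        ring
      rw [h3, jacobiCoeff, e6, e3, e1]
      generalize 1 - a * b * q ^ (m + 1) * q ^ i = X at *
      generalize ∑' k : ℕ, qPoch (b * q * q ^ m) q k / qPoch q q k * (a * q * q ^ i) ^ k = T at *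
      field_simp
      linear_combination (-(fallCoeff q m i * qPoch (b * q) q m *
        qPoch (a * q ^ (i + 1)) q (m - i))) * e2
    rw [sum_congr rfl h4, ← mul_sum, sum_fallCoeff_div hq m _ hc] at h1
    refine absurd h1 (mul_ne_zero (div_ne_zero (mul_ne_zero (mul_ne_zero (mul_ne_zero ?_ ?_) hν0) ?_)
      (hne _ _ (by omega))) (div_ne_zero (mul_ne_zero (mul_ne_zero (mul_ne_zero ?_ ?_) ?_)
      (qPoch_self_ne_zero hq m)) (qPoch_ne_zero _ fun j _ => hc j)))
    · exact qPoch_ne_zero _ fun j _ => by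
        rw [mul_assoc, ← pow_succ']
        exact hb _ (by omega)
    · exact qPoch_ne_zero _ fun j _ => by
        rw [mul_assoc, ← pow_succ']
        exact ha _ (by omega)
    · exact hab _ (by omega)
    · exact pow_ne_zero _ (by simp)
    · exact pow_ne_zero _ (mul_ne_zero (mul_ne_zero ha0 hb0) (pow_ne_zero _ hq0))
    · exact pow_ne_zero _ hq0

theorem littleFunctional_mul_self_ne_zero (hq0 : q ≠ 0) (hq1 : ‖q‖ < 1) (haq : ‖a * q‖ < 1)
    (ha : ∀ j : ℕ, 1 ≤ j → 1 - a * q ^ j ≠ 0) (hb : ∀ j : ℕ, 1 ≤ j → 1 - b * q ^ j ≠ 0)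
    (hab : ∀ j : ℕ, 2 ≤ j → 1 - a * b * q ^ j ≠ 0) (ha0 : a ≠ 0) (hb0 : b ≠ 0) (m : ℕ) :
    littleFunctional a b q (littleQJacobi a b q m * littleQJacobi a b q m) ≠ 0 := by
  rw [littleFunctional_mul_littleQJacobi hq0 hq1 haq ha hab
    (natDegree_littleQJacobi_le hq0 hq1 ha hab m), coeff_littleQJacobi_self hq0 hq1 ha hab, one_mul]
  exact littleFunctional_littleQJacobi_sq_ne_zero hq0 hq1 haq ha hb hab ha0 hb0 m

theorem littleFunctional_mul_eq_zero (hq0 : q ≠ 0) (hq1 : ‖q‖ < 1) (haq : ‖a * q‖ < 1)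
    (ha : ∀ j : ℕ, 1 ≤ j → 1 - a * q ^ j ≠ 0) (hab : ∀ j : ℕ, 2 ≤ j → 1 - a * b * q ^ j ≠ 0)
    {k m : ℕ} (hkm : k ≠ m) :
    littleFunctional a b q (littleQJacobi a b q k * littleQJacobi a b q m) = 0 := by
  have key : ∀ k m : ℕ, k < m →
      littleFunctional a b q (littleQJacobi a b q k * littleQJacobi a b q m) = 0 := by
    intro k m h
    have h1 := natDegree_littleQJacobi_le hq0 hq1 ha hab k
    rw [littleFunctional_mul_littleQJacobi hq0 hq1 haq ha hab (h1.trans h.le),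
      Polynomial.coeff_eq_zero_of_natDegree_lt (h1.trans_lt h), zero_mul]
  rcases lt_or_gt_of_ne hkm with h | h
  · exact key k m h
  · rw [mul_comm]
    exact key m k h

end Functional

/-! ### The orthogonality functional in several variables -/

section Multi

variable {K : Type*} [NormedField K] {a b q : K} {n : ℕ}

theorem summable_norm_eval_mul_prod (hq1 : ‖q‖ < 1) (haq : ‖a * q‖ < 1)
    (f : MvPolynomial (Fin n) K) : Summable fun k : Fin n → ℕ =>
      ‖MvPolynomial.eval (fun i => q ^ k i) f *
        ∏ i : Fin n, qPoch (b * q) q (k i) / qPoch q q (k i) * (a * q) ^ k i‖ := by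
  induction f using MvPolynomial.induction_on' with
  | monomial d c =>
    have h := (summable_norm_prod_apply (g := fun (i : Fin n) (k : ℕ) =>
      qPoch (b * q) q k / qPoch q q k * (a * q) ^ k * (Polynomial.X ^ d i : Polynomial K).eval (q ^ k))
      fun i => summable_littleFunctional hq1 haq _).mul_left ‖c‖
    refine h.congr fun k => ?_
    rw [← norm_mul, MvPolynomial.eval_monomial, Finsupp.prod_fintype _ _ (by simp)]
    congr 1
    simp only [Polynomial.eval_pow, Polynomial.eval_X, prod_mul_distrib]
    ring
  | add f g hf hg =>
    refine Summable.of_nonneg_of_le (fun k => norm_nonneg _) (fun k => ?_) (hf.add hg)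
    rw [map_add, add_mul]
    exact norm_add_le _ _

theorem eval_alternant (p : ℕ → Polynomial K) (lam : Par n) (x : Fin n → K) :
    MvPolynomial.eval x (alternant p lam) =
      ∑ σ : Equiv.Perm (Fin n), ((Equiv.Perm.sign σ : ℤ) : K) *
        ∏ i, (p (partPos lam (σ i))).eval (x i) := by
  have h : ∀ i j : Fin n, MvPolynomial.eval x (Polynomial.aeval
      (MvPolynomial.X i : MvPolynomial (Fin n) K) (p (lam.1 j + (n - (j.1 + 1))))) =
      (p (partPos lam j)).eval (x i) := by
    intro i j
    have h1 := Polynomial.aeval_algHom_apply (MvPolynomial.aeval x : MvPolynomial (Fin n) K →ₐ[K] K)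
      (MvPolynomial.X i) (p (partPos lam j))
    rw [MvPolynomial.aeval_X, Polynomial.coe_aeval_eq_eval] at h1
    exact h1.symm
  unfold alternant
  rw [← Matrix.det_transpose, Matrix.det_apply', map_sum]
  refine sum_congr rfl fun σ _ => ?_
  rw [map_mul, map_intCast, map_prod]
  congr 1
  exact prod_congr rfl fun i _ => h i (σ i)

variable [CompleteSpace K]

theorem summable_jacobiTerm (hq1 : ‖q‖ < 1) (haq : ‖a * q‖ < 1) (f : MvPolynomial (Fin n) K) :
    Summable (jacobiTerm a b q f) := by
  refine (summable_norm_eval_mul_prod (b := b) hq1 haq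
    (f * vandermondeProd K n ^ 2)).of_norm.congr fun k => ?_
  rw [jacobiTerm, map_mul, map_pow]

theorem jacobiFunctional_sum (hq1 : ‖q‖ < 1) (haq : ‖a * q‖ < 1) {ι : Type*} (S : Finset ι)
    (c : ι → K) (f : ι → MvPolynomial (Fin n) K) :
    jacobiFunctional a b q (∑ i ∈ S, MvPolynomial.C (c i) * f i) =
      ∑ i ∈ S, c i * jacobiFunctional a b q (f i) := by
  unfold jacobiFunctional
  simp only [← tsum_mul_left]
  rw [← Summable.tsum_finsetSum fun i _ => (summable_jacobiTerm hq1 haq (f i)).mul_left (c i)]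
  refine tsum_congr fun k => ?_
  simp only [jacobiTerm, map_sum, sum_mul, map_mul, MvPolynomial.eval_C]
  exact sum_congr rfl fun i _ => by ring

/-- Andréief's identity for the functional. -/
theorem jacobiFunctional_altQuotient_mul (hq1 : ‖q‖ < 1) (haq : ‖a * q‖ < 1)
    (p r : ℕ → Polynomial K) (lam mu : Par n) :
    jacobiFunctional a b q (altQuotient p lam * altQuotient r mu) =
      (n.factorial : K) * (Matrix.of fun i j : Fin n =>
        littleFunctional a b q (p (partPos lam i) * r (partPos mu j))).det := by
  have h1 : ∀ k : Fin n → ℕ, jacobiTerm a b q (altQuotient p lam * altQuotient r mu) k =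
      ∑ σ : Equiv.Perm (Fin n), ∑ τ : Equiv.Perm (Fin n),
        ((Equiv.Perm.sign σ : ℤ) : K) * ((Equiv.Perm.sign τ : ℤ) : K) *
        ∏ i, (qPoch (b * q) q (k i) / qPoch q q (k i) * (a * q) ^ k i *
          (p (partPos lam (σ i)) * r (partPos mu (τ i))).eval (q ^ k i)) := by
    intro k
    have h2 : jacobiTerm a b q (altQuotient p lam * altQuotient r mu) k =
        MvPolynomial.eval (fun i => q ^ k i) (alternant p lam) *
        MvPolynomial.eval (fun i => q ^ k i) (alternant r mu) *
        ∏ i : Fin n, qPoch (b * q) q (k i) / qPoch q q (k i) * (a * q) ^ k i := by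
      rw [jacobiTerm, ← vandermondeProd_mul_altQuotient, ← vandermondeProd_mul_altQuotient]
      simp only [map_mul]
      ring
    rw [h2, eval_alternant, eval_alternant, sum_mul_sum, sum_mul]
    refine sum_congr rfl fun σ _ => ?_
    rw [sum_mul]
    refine sum_congr rfl fun τ _ => ?_
    simp only [Polynomial.eval_mul, prod_mul_distrib]
    ring
  have hs : ∀ σ τ : Equiv.Perm (Fin n), Summable fun k : Fin n → ℕ =>
      ((Equiv.Perm.sign σ : ℤ) : K) * ((Equiv.Perm.sign τ : ℤ) : K) *
        ∏ i, (qPoch (b * q) q (k i) / qPoch q q (k i) * (a * q) ^ k i *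
          (p (partPos lam (σ i)) * r (partPos mu (τ i))).eval (q ^ k i)) := by
    intro σ τ
    exact (summable_norm_prod_apply (g := fun (i : Fin n) (k : ℕ) =>
      qPoch (b * q) q k / qPoch q q k * (a * q) ^ k *
        (p (partPos lam (σ i)) * r (partPos mu (τ i))).eval (q ^ k)) fun i =>
      summable_littleFunctional hq1 haq _).of_norm.mul_left _
  have ht : ∀ σ τ : Equiv.Perm (Fin n), ∑' k : Fin n → ℕ,
      ((Equiv.Perm.sign σ : ℤ) : K) * ((Equiv.Perm.sign τ : ℤ) : K) *
        ∏ i, (qPoch (b * q) q (k i) / qPoch q q (k i) * (a * q) ^ k i *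
          (p (partPos lam (σ i)) * r (partPos mu (τ i))).eval (q ^ k i)) =
      ((Equiv.Perm.sign σ : ℤ) : K) * (((Equiv.Perm.sign τ : ℤ) : K) *
        ∏ i, littleFunctional a b q (p (partPos lam (σ i)) * r (partPos mu (τ i)))) := by
    intro σ τ
    rw [tsum_mul_left, mul_assoc]
    congr 2
    exact tsum_prod_apply (g := fun (i : Fin n) (k : ℕ) =>
      qPoch (b * q) q k / qPoch q q k * (a * q) ^ k *
        (p (partPos lam (σ i)) * r (partPos mu (τ i))).eval (q ^ k)) fun i =>
      summable_littleFunctional hq1 haq _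
  unfold jacobiFunctional
  simp_rw [h1]
  rw [Summable.tsum_finsetSum fun σ _ => summable_sum fun τ _ => hs σ τ]
  set A := Matrix.of fun i j : Fin n =>
    littleFunctional a b q (p (partPos lam i) * r (partPos mu j)) with hA
  -- Permuting the rows by σ produces sign σ a second time, so every σ contributes the same
  -- determinant; their number gives n!.
  have h3 : ∀ σ : Equiv.Perm (Fin n), ∑' k : Fin n → ℕ, ∑ τ : Equiv.Perm (Fin n),
      ((Equiv.Perm.sign σ : ℤ) : K) * ((Equiv.Perm.sign τ : ℤ) : K) *
        ∏ i, (qPoch (b * q) q (k i) / qPoch q q (k i) * (a * q) ^ k i *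
          (p (partPos lam (σ i)) * r (partPos mu (τ i))).eval (q ^ k i)) = A.det := by
    intro σ
    rw [Summable.tsum_finsetSum fun τ _ => hs σ τ]
    simp_rw [ht, ← mul_sum]
    have h4 : ∑ τ : Equiv.Perm (Fin n), ((Equiv.Perm.sign τ : ℤ) : K) *
        ∏ i, littleFunctional a b q (p (partPos lam (σ i)) * r (partPos mu (τ i))) =
        (A.submatrix σ id).det := by
      rw [← Matrix.det_transpose, Matrix.det_apply']
      rfl
    rw [h4, Matrix.det_permute, ← mul_assoc, ← Int.cast_mul, Int.units_coe_mul_self, Int.cast_one,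
      one_mul]
  rw [sum_congr rfl fun σ _ => h3 σ, sum_const, card_univ, Fintype.card_perm, Fintype.card_fin,
    nsmul_eq_mul]

/-- The matrix of pairings is diagonal for equal partitions and has a zero row otherwise, at a
position of `lam` that `mu` lacks. Characteristic zero keeps n! invertible. -/
theorem jacobiFunctional_multiLittleQJacobi_eq_zero_iff [CharZero K] (hq0 : q ≠ 0) (hq1 : ‖q‖ < 1)
    (haq : ‖a * q‖ < 1) (ha : ∀ j : ℕ, 1 ≤ j → 1 - a * q ^ j ≠ 0)
    (hb : ∀ j : ℕ, 1 ≤ j → 1 - b * q ^ j ≠ 0) (hab : ∀ j : ℕ, 2 ≤ j → 1 - a * b * q ^ j ≠ 0)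
    (ha0 : a ≠ 0) (hb0 : b ≠ 0) (lam mu : Par n) :
    jacobiFunctional a b q (multiLittleQJacobi a b q lam * multiLittleQJacobi a b q mu) = 0 ↔
      lam ≠ mu := by
  unfold multiLittleQJacobi
  rw [jacobiFunctional_altQuotient_mul hq1 haq]
  constructor
  · rintro h rfl
    refine absurd h (mul_ne_zero (Nat.cast_ne_zero.2 (Nat.factorial_ne_zero n)) ?_)
    have h1 : (Matrix.of fun i j : Fin n => littleFunctional a b q
        (littleQJacobi a b q (partPos lam i) * littleQJacobi a b q (partPos lam j))) =
        Matrix.diagonal fun i => littleFunctional a b q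
          (littleQJacobi a b q (partPos lam i) * littleQJacobi a b q (partPos lam i)) := by
      ext i j
      by_cases hij : i = j
      · subst hij
        simp
      · rw [Matrix.diagonal_apply_ne _ hij]
        exact littleFunctional_mul_eq_zero hq0 hq1 haq ha hab
          fun h => hij ((partPos_strictAnti lam).injective h)
    rw [h1, Matrix.det_diagonal]
    exact prod_ne_zero_iff.2 fun i _ =>
      littleFunctional_mul_self_ne_zero hq0 hq1 haq ha hb hab ha0 hb0 _
  · intro h
    obtain ⟨i, hi⟩ := exists_partPos_ne h
    rw [Matrix.det_eq_zero_of_row_eq_zero i, mul_zero]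
    exact fun j => littleFunctional_mul_eq_zero hq0 hq1 haq ha hab (hi j)

theorem mixedMoment_eq [CharZero K] (hq0 : q ≠ 0) (hq1 : ‖q‖ < 1)
    (haq : ‖a * q‖ < 1) (ha : ∀ j : ℕ, 1 ≤ j → 1 - a * q ^ j ≠ 0)
    (hb : ∀ j : ℕ, 1 ≤ j → 1 - b * q ^ j ≠ 0) (hab : ∀ j : ℕ, 2 ≤ j → 1 - a * b * q ^ j ≠ 0)
    (ha0 : a ≠ 0) (hb0 : b ≠ 0) {lam : Par n} {d : Par n → K}
    (h : schurPoly K lam = ∑ mu : {mu : Par n // mu ≤ lam},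
      MvPolynomial.C (d mu.1) * multiLittleQJacobi a b q mu.1)
    (hd : ∀ mu, ¬ mu ≤ lam → d mu = 0) (mu : Par n) : mixedMoment a b q lam mu = d mu := by
  have horth := jacobiFunctional_multiLittleQJacobi_eq_zero_iff (n := n) hq0 hq1 haq ha hb hab ha0 hb0
  have hne : jacobiFunctional a b q (multiLittleQJacobi a b q mu * multiLittleQJacobi a b q mu) ≠ 0 :=
    fun h => (horth mu mu).1 h rfl
  rw [mixedMoment, sq, div_eq_iff hne, h, sum_mul]
  simp_rw [mul_assoc]
  rw [jacobiFunctional_sum hq1 haq]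
  by_cases hmu : mu ≤ lam
  · rw [sum_eq_single ⟨mu, hmu⟩]
    · intro nu _ hnu
      rw [(horth nu.1 mu).2 fun heq => hnu (Subtype.ext heq), mul_zero]
    · simp
  · rw [hd mu hmu, zero_mul]
    refine sum_eq_zero fun nu _ => ?_
    rw [(horth nu.1 mu).2 fun heq => hmu (heq ▸ nu.2), mul_zero]

end Multi

/-! ### Lecture hall Schur functions as minors -/

section LectureHall

open Filter Topology

variable {K : Type*} [NormedField K] {q u v : K} {n : ℕ}

theorem tendsto_parDet {c : ℕ → ℕ → ℕ → K} {d : ℕ → ℕ → K} {lam mu : Par n} {D : ℕ}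
    (hD : ∀ i, partPos lam i ≤ D)
    (h : ∀ m k, m ≤ D → Tendsto (fun t => c t m k) atTop (𝓝 (d m k))) :
    Tendsto (fun t => parDet (c t) lam mu) atTop (𝓝 (parDet d lam mu)) := by
  unfold parDet
  simp only [Matrix.det_apply']
  refine tendsto_finsetSum _ fun σ _ => Tendsto.const_mul _ (tendsto_finsetProd _ fun i _ => ?_)
  exact h _ _ (hD _)

theorem card_cell {lam mu : Par n} : Fintype.card (Cell lam mu) = skewSize lam mu := by
  classical
  have e : Cell lam mu ≃ (i : Fin n) × {j // j ∈ Ico (mu.1 i) (lam.1 i)} :=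
    { toFun := fun s => ⟨s.1.1, s.1.2, mem_Ico.2 s.2⟩
      invFun := fun s => ⟨(s.1, s.2.1), mem_Ico.1 s.2.2⟩
      left_inv := fun _ => rfl
      right_inv := fun _ => rfl }
  rw [Fintype.card_congr e, Fintype.card_sigma]
  simp [skewSize]

theorem exists_partPos_le (lam : Par n) : ∃ D, 0 < D ∧ ∀ i, partPos lam i ≤ D :=
  ⟨∑ i, partPos lam i + 1, Nat.succ_pos _, fun i => (single_le_sum (f := partPos lam)
    (fun _ _ => Nat.zero_le _) (mem_univ i)).trans (Nat.le_succ _)⟩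

variable [CompleteSpace K]

/-- The sign turns each cell weight w into -w. At every stage the sum is then a minor, and both
sides pass to the limit. -/
theorem lectureHallSchur_lt_le_eq_parDet (hq1 : ‖q‖ < 1) (huq : ‖u * q‖ < 1) (hv : v ≠ 0)
    {lam mu : Par n} (hle : mu ≤ lam) :
    (-1) ^ skewSize lam mu * lectureHallSchur (· < ·) (· ≤ ·) (fun m => q ^ m) u v lam mu =
      parDet (jacobiCoeff (-(u * v)) (-(u / v)) q) lam mu := by
  obtain ⟨D, hD, hlam⟩ := exists_partPos_le lam
  have h1 := (tendsto_sum_letterTableaux (R₁ := (· < ·)) (R₂ := (· ≤ ·)) (r := (· < ·)) (v := v)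
    (mu := mu) hq1 huq hD hlam (fun x y s hs hsD => (letterCode_lt_letterCode_iff hs hsD).symm)
    (fun x y s hs hsD => by
      rw [← not_lt, ← letterCode_lt_letterCode_iff hs hsD, not_lt]
      exact ⟨fun h => lt_of_le_of_ne h (letterCode_ne_letterCode hs hsD).symm, le_of_lt⟩)).const_mul
    ((-1) ^ skewSize lam mu)
  refine tendsto_nhds_unique h1 ((tendsto_parDet hlam fun m k hm =>
    tendsto_letterCoeff hq1 huq hv hD k m hm).congr fun t => ?_)
  rw [← sum_letterTableaux_eq_parDet (letterContent_pos hD) _ _ mu lam hle, mul_sum]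
  refine sum_congr rfl fun G _ => ?_
  rw [prod_neg, card_univ, card_cell]

/-- Reading the alphabet backwards makes decreasing letters increasing, and the reversed product
with unsigned weights converges to the inverse matrix. -/
theorem lectureHallSchur_ge_gt_eq_parDet (hq1 : ‖q‖ < 1) (huq : ‖u * q‖ < 1) (hv : v ≠ 0)
    {lam mu : Par n} (hle : mu ≤ lam) :
    lectureHallSchur (· ≥ ·) (· > ·) (fun m => q ^ m) u v lam mu =
      parDet (unitriangularInv (jacobiCoeff (-(u * v)) (-(u / v)) q)) lam mu := by
  obtain ⟨D, hD, hlam⟩ := exists_partPos_le lam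
  have h1 := tendsto_sum_letterTableaux (R₁ := (· ≥ ·)) (R₂ := (· > ·)) (r := (· > ·)) (v := v)
    (mu := mu) hq1 huq hD hlam (fun x y s hs hsD => by
      rw [ge_iff_le, ← not_lt, ← letterCode_lt_letterCode_iff hs hsD, not_lt]
      exact ⟨fun h => lt_of_le_of_ne h (letterCode_ne_letterCode hs hsD).symm, le_of_lt⟩)
    (fun x y s hs hsD => (letterCode_lt_letterCode_iff hs hsD).symm)
  refine tendsto_nhds_unique h1 ((tendsto_parDet hlam fun m k hm =>
    tendsto_letterCoeff_reverse hq1 huq hv hD k m hm).congr fun t => ?_)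
  rw [sum_letterTableaux_reverse]
  exact (sum_letterTableaux_eq_parDet (fun p => letterContent_pos hD _) _ _ mu lam hle).symm

end LectureHall

/-! ### The main theorem. -/

theorem mainTheorem1 {K : Type*} [NormedField K] [CompleteSpace K] [CharZero K] (q u v : K)
    (hq0 : q ≠ 0) (hq1 : ‖q‖ < 1) (hv : v ≠ 0) (huq : ‖u * q‖ < 1)
    (huv : ∀ j : ℕ, 1 ≤ j → 1 + u * v * q ^ j ≠ 0) (n : ℕ) :
    -- the series defining the lecture hall Schur functions converge unconditionally
    (∀ lam mu : Par n, mu ≤ lam →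
      Summable (fun T : LHT (· < ·) (· ≤ ·) lam mu => T.weight (fun m => q ^ m) u v) ∧
      Summable (fun T : LHT (· ≥ ·) (· > ·) lam mu => T.weight (fun m => q ^ m) u v)) ∧
    -- the dual mixed moments
    (∀ lam mu : Par n, mu ≤ lam →
      dualMixedMoment (-(u * v)) (-(u / v)) q lam mu =
        (-1) ^ skewSize lam mu *
          lectureHallSchur (· < ·) (· ≤ ·) (fun m => q ^ m) u v lam mu) ∧
    (∀ lam mu : Par n, ¬ mu ≤ lam → dualMixedMoment (-(u * v)) (-(u / v)) q lam mu = 0) ∧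
    -- the Schur expansion of the multivariate little `q`-Jacobi polynomials
    (∀ lam : Par n,
      multiLittleQJacobi (-(u * v)) (-(u / v)) q lam =
        ∑ mu : {mu : Par n // mu ≤ lam},
          MvPolynomial.C ((-1) ^ skewSize lam mu.1 *
            lectureHallSchur (· < ·) (· ≤ ·) (fun m => q ^ m) u v lam mu.1) *
          schurPoly K mu.1) ∧
    -- the expansion of the Schur polynomials
    (∀ lam : Par n,
      schurPoly K lam =
        ∑ mu : {mu : Par n // mu ≤ lam},
          MvPolynomial.C (lectureHallSchur (· ≥ ·) (· > ·) (fun m => q ^ m) u v lam mu.1) *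
          multiLittleQJacobi (-(u * v)) (-(u / v)) q mu.1) ∧
    -- orthogonality and mixed moments, where the functional converges and is nondegenerate
    (‖u * v * q‖ < 1 → u ≠ 0 → (∀ j : ℕ, 1 ≤ j → v + u * q ^ j ≠ 0) →
      (∀ f : MvPolynomial (Fin n) K, Summable (jacobiTerm (-(u * v)) (-(u / v)) q f)) ∧
      (∀ lam mu : Par n,
        jacobiFunctional (-(u * v)) (-(u / v)) q
          (multiLittleQJacobi (-(u * v)) (-(u / v)) q lam *
            multiLittleQJacobi (-(u * v)) (-(u / v)) q mu) = 0 ↔ lam ≠ mu) ∧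
      (∀ lam mu : Par n, mu ≤ lam →
        mixedMoment (-(u * v)) (-(u / v)) q lam mu =
          lectureHallSchur (· ≥ ·) (· > ·) (fun m => q ^ m) u v lam mu) ∧
      (∀ lam mu : Par n, ¬ mu ≤ lam → mixedMoment (-(u * v)) (-(u / v)) q lam mu = 0)) := by
  have hq := one_sub_pow_ne_zero hq1
  have hsq : -(u * v) * -(u / v) = u * u := by field_simp
  have ha : ∀ j : ℕ, 1 ≤ j → 1 - -(u * v) * q ^ j ≠ 0 := fun j hj => by
    rw [neg_mul, sub_neg_eq_add]
    exact huv j hj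
  have hab : ∀ j : ℕ, 2 ≤ j → 1 - -(u * v) * -(u / v) * q ^ j ≠ 0 := fun j hj => by
    rw [hsq]
    exact one_sub_sq_mul_pow_ne_zero hq1 huq j hj
  have hcoeff := jacobiCoeff_of_lt (q := q) (-(u * v)) (-(u / v))
  have hinv := unitriangularInv_of_lt (jacobiCoeff (-(u * v)) (-(u / v)) q)
  have hexp := littleQJacobi_eq_sum hq0 hq ha hab
  have hlt : ∀ lam : Par n, multiLittleQJacobi (-(u * v)) (-(u / v)) q lam =
      ∑ mu : {mu : Par n // mu ≤ lam}, MvPolynomial.C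
        (parDet (jacobiCoeff (-(u * v)) (-(u / v)) q) lam mu.1) * schurPoly K mu.1 :=
    altQuotient_eq_sum_parDet hcoeff hexp
  have hge : ∀ lam : Par n, schurPoly K lam = ∑ mu : {mu : Par n // mu ≤ lam}, MvPolynomial.C
      (parDet (unitriangularInv (jacobiCoeff (-(u * v)) (-(u / v)) q)) lam mu.1) *
        multiLittleQJacobi (-(u * v)) (-(u / v)) q mu.1 :=
    altQuotient_eq_sum_parDet hinv (eq_sum_unitriangularInv (jacobiCoeff_self hq _ _) hexp)
  refine ⟨fun lam mu _ => ⟨summable_weight hq1 huq _ _ lam mu, summable_weight hq1 huq _ _ lam mu⟩,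
    fun lam mu hle => ?_, fun lam mu hle => ?_, fun lam => ?_, fun lam => ?_, fun huvq hu0 hvu => ?_⟩
  · rw [lectureHallSchur_lt_le_eq_parDet hq1 huq hv hle]
    exact dualMixedMoment_eq (hlt lam) (fun nu => parDet_eq_zero hcoeff) mu
  · rw [dualMixedMoment_eq (hlt lam) (fun nu => parDet_eq_zero hcoeff) mu, parDet_eq_zero hcoeff hle]
  · rw [hlt lam]
    exact sum_congr rfl fun mu _ => by rw [lectureHallSchur_lt_le_eq_parDet hq1 huq hv mu.2]
  · rw [hge lam]
    exact sum_congr rfl fun mu _ => by rw [lectureHallSchur_ge_gt_eq_parDet hq1 huq hv mu.2]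
  · have haq : ‖-(u * v) * q‖ < 1 := by rwa [neg_mul, norm_neg]
    have hb : ∀ j : ℕ, 1 ≤ j → 1 - -(u / v) * q ^ j ≠ 0 := fun j hj h => by
      refine hvu j hj ?_
      field_simp at h
      linear_combination h
    have ha0 : -(u * v) ≠ 0 := neg_ne_zero.2 (mul_ne_zero hu0 hv)
    have hb0 : -(u / v) ≠ 0 := neg_ne_zero.2 (div_ne_zero hu0 hv)
    have hmixed : ∀ lam mu : Par n, mixedMoment (-(u * v)) (-(u / v)) q lam mu =
        parDet (unitriangularInv (jacobiCoeff (-(u * v)) (-(u / v)) q)) lam mu := fun lam =>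
      mixedMoment_eq hq0 hq1 haq ha hb hab ha0 hb0 (hge lam) fun nu => parDet_eq_zero hinv
    refine ⟨summable_jacobiTerm hq1 haq,
      jacobiFunctional_multiLittleQJacobi_eq_zero_iff hq0 hq1 haq ha hb hab ha0 hb0,
      fun lam mu hle => ?_, fun lam mu hle => ?_⟩
    · rw [hmixed, lectureHallSchur_ge_gt_eq_parDet hq1 huq hv hle]
    · rw [hmixed, parDet_eq_zero hinv hle]
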